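/- **Lemma (finger predecessor from predecessor).** The model of computation is the word RAM with words of $w=\Omega(\log N)$ bits (unit-cost arithmetic, bitwise operations, shifts, comparisons, and indirect loads and stores); time is the worst-case number of steps of a query, space is the number of memory words, and preprocessing is not counted. For $N\ge 1$ let $\ell(N)=\lfloor\log_2 N\rfloor+1$. A *predecessor data structure* with query time $t(N,n)$ and space $s(N,n)$ consists of two fixed query programs and a constant $a\ge 1$ such that, for every set $R\subseteq U=\{0,\dots,N-1\}$ of $n$ integers and every word length $w\ge a\,\ell(N)$, there is a data structure for $R$ occupying at most $s(N,n)$ words, addressable with $a\,\ell(N)$ bits, on which any sequence of queries $\mathrm{pred}(q)$ (the largest $r\in R$ with $r\le q$, if any) and $\mathrm{succ}(q)$ (the smallest $r\in R$ with $r\ge q$, if any), $q\in U$, is answered, each query in at most $t(N,n)$ steps. A *finger predecessor data structure* is defined in the same way, except that a query is given an integer $f\in R$ (the finger) besides $q\in U$, and its time is bounded in terms of $D=|f-q|$ and $n$. Assume the usual regularity of the bounds: there is a constant $K$ such that * $t(N',n')\le K\,t(N,n)$ whenever $N'\le N\le 2N'$ and $n'\le n$ (for instance, $t$ is non-decreasing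 in both arguments); * $\sum_i s(N_i,n_i)\le K\,s(N,n)$ for every finite family of pairs with $1\le n_i\le N_i$, $\sum_i N_i\le N$ and $\sum_i n_i\le n$. Then any predecessor data structure with query time $t(N,n)$ and space $s(N,n)$ can be turned into a finger predecessor data structure: there are a constant $C$ and a finger predecessor data structure that, for every $N$, every set $R\subseteq\{0,\dots,N-1\}$ of $n$ integers, every $f\in R$ and every $q\in U$, answers $\mathrm{pred}(q)$ and $\mathrm{succ}(q)$ in at most $C\,t(\max(D,1),n)$ steps, i.e. in time $O(t(D,n))$, and uses at most $C\,s\!\left(N,\lceil n/\ell(N)\rceil\right)\ell(N)$ words, i.e. space $O\!\left(s\!\left(N,\tfrac{n}{\log N}\right)\log N\right)$. -/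

import Mathlib

/-! ## The word RAM -/

/-- The arithmetic and bitwise instructions of the word RAM. -/
inductive RamOp where
  | add | sub | mul | div | mod | and | or | xor | shl | shr

/-- The result of an operation on two `w`-bit words, again a `w`-bit word: addition, subtraction,
multiplication and left shift are taken modulo `2 ^ w`. -/
def RamOp.eval (w : ℕ) : RamOp → ℕ → ℕ → ℕ
  | .add, x, y => (x + y) % 2 ^ w
  | .sub, x, y => (x + 2 ^ w - y) % 2 ^ w
  | .mul, x, y => (x * y) % 2 ^ w
  | .div, x, y => x / y
  | .mod, x, y => x % y
  | .and, x, y => x &&& y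
  | .or, x, y => x ||| y
  | .xor, x, y => x ^^^ y
  | .shl, x, y => (x <<< y) % 2 ^ w
  | .shr, x, y => x >>> y

/-- Tests: comparisons of the contents of two registers. -/
inductive RamTest where
  | lt (i j : ℕ)
  | eq (i j : ℕ)

/-- The truth of a test for given register contents. -/
def RamTest.Holds (reg : ℕ → ℕ) : RamTest → Prop
  | .lt i j => reg i < reg j
  | .eq i j => reg i = reg j

/-- Word RAM programs in structured form. Registers are numbered by `ℕ`; a program mentions only
finitely many of them. -/
inductive RamProg where
  | skip
  /-- put a constant into register `d` -/
  | const (d c : ℕ)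
  /-- copy register `i` into register `d` -/
  | copy (d i : ℕ)
  /-- apply an operation to registers `i`, `j` and put the result into register `d` -/
  | op (o : RamOp) (d i j : ℕ)
  /-- put into register `d` the memory cell whose address is in register `i` -/
  | load (d i : ℕ)
  /-- write register `j` into the memory cell whose address is in register `i` -/
  | store (i j : ℕ)
  | seq (p q : RamProg)
  | ite (c : RamTest) (p q : RamProg)
  | while (c : RamTest) (p : RamProg)

/-- A configuration: contents of the registers and of the memory cells. -/
structure RamState where
  reg : ℕ → ℕ
  mem : ℕ → ℕ

/-- `RamExec w S p σ k τ`: on a RAM with words of `w` bits and a memory of `S` cells (the cells with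
addresses `0, …, S - 1`), the program `p` started in configuration `σ` halts in configuration `τ`
after exactly `k` steps. Every elementary instruction and every evaluation of a test is one step.
A program that accesses a cell outside the memory gets stuck: it has no halting execution. -/
inductive RamExec (w S : ℕ) : RamProg → RamState → ℕ → RamState → Prop
  | skip (σ : RamState) : RamExec w S .skip σ 1 σ
  | const (d c : ℕ) (σ : RamState) :
      RamExec w S (.const d c) σ 1 ⟨Function.update σ.reg d (c % 2 ^ w), σ.mem⟩
  | copy (d i : ℕ) (σ : RamState) :
      RamExec w S (.copy d i) σ 1 ⟨Function.update σ.reg d (σ.reg i), σ.mem⟩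
  | op (o : RamOp) (d i j : ℕ) (σ : RamState) :
      RamExec w S (.op o d i j) σ 1
        ⟨Function.update σ.reg d (o.eval w (σ.reg i) (σ.reg j)), σ.mem⟩
  | load (d i : ℕ) (σ : RamState) (h : σ.reg i < S) :
      RamExec w S (.load d i) σ 1 ⟨Function.update σ.reg d (σ.mem (σ.reg i)), σ.mem⟩
  | store (i j : ℕ) (σ : RamState) (h : σ.reg i < S) :
      RamExec w S (.store i j) σ 1 ⟨σ.reg, Function.update σ.mem (σ.reg i) (σ.reg j)⟩
  | seq (p q : RamProg) (σ ρ τ : RamState) (k l : ℕ) (hp : RamExec w S p σ k ρ)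
      (hq : RamExec w S q ρ l τ) : RamExec w S (.seq p q) σ (k + l) τ
  | ite_true (c : RamTest) (p q : RamProg) (σ τ : RamState) (k : ℕ) (hc : c.Holds σ.reg)
      (hp : RamExec w S p σ k τ) : RamExec w S (.ite c p q) σ (k + 1) τ
  | ite_false (c : RamTest) (p q : RamProg) (σ τ : RamState) (k : ℕ) (hc : ¬ c.Holds σ.reg)
      (hq : RamExec w S q σ k τ) : RamExec w S (.ite c p q) σ (k + 1) τ
  | while_false (c : RamTest) (p : RamProg) (σ : RamState) (hc : ¬ c.Holds σ.reg) :
      RamExec w S (.while c p) σ 1 σ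
  | while_true (c : RamTest) (p : RamProg) (σ ρ τ : RamState) (k l : ℕ) (hc : c.Holds σ.reg)
      (hp : RamExec w S p σ k ρ) (hl : RamExec w S (.while c p) ρ l τ) :
      RamExec w S (.while c p) σ (k + l + 1) τ

/-- The number of binary digits `⌊log₂ N⌋ + 1` of a universe size `N ≥ 1`; it is between `log₂ N`
and `2 log₂ N` for `N ≥ 2`. -/
def bitLength (N : ℕ) : ℕ := Nat.log 2 N + 1

/-! ## Predecessor and finger predecessor data structures -/

/-- The output registers hold the answer to the predecessor query `q` in `R`: register `0` tells
whether there is a predecessor, and if there is one it is in register `1`. -/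
def IsPredAnswer (R : Finset ℕ) (q : ℕ) (reg : ℕ → ℕ) : Prop :=
  (reg 0 = 1 ∧ IsGreatest {r | r ∈ R ∧ r ≤ q} (reg 1)) ∨ (reg 0 = 0 ∧ ∀ r ∈ R, ¬ r ≤ q)

/-- The output registers hold the answer to the successor query `q` in `R`. -/
def IsSuccAnswer (R : Finset ℕ) (q : ℕ) (reg : ℕ → ℕ) : Prop :=
  (reg 0 = 1 ∧ IsLeast {r | r ∈ R ∧ q ≤ r} (reg 1)) ∨ (reg 0 = 0 ∧ ∀ r ∈ R, ¬ q ≤ r)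

/-- The registers at the start of a query with one argument (all other registers are `0`). -/
def regInput (x : ℕ) : ℕ → ℕ := Function.update 0 0 x

/-- The registers at the start of a query with two arguments (all other registers are `0`). -/
def regInput₂ (x y : ℕ) : ℕ → ℕ := Function.update (Function.update 0 0 x) 1 y

/-- Started with register contents `reg` and memory contents `M`, the program `p` halts within `T`
steps, its output registers satisfy `ans`, and it leaves the memory in a state that belongs
to `I`. -/
def AnswersWithin (w S : ℕ) (I : Set (ℕ → ℕ)) (p : RamProg) (reg M : ℕ → ℕ) (T : ℕ)
    (ans : (ℕ → ℕ) → Prop) : Prop :=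
  ∃ k ≤ T, ∃ τ : RamState, RamExec w S p ⟨reg, M⟩ k τ ∧ ans τ.reg ∧ τ.mem ∈ I

/-- The query programs `pred` and `succ` form a predecessor data structure with query time
`t N n` and space `s N n` (in words) for sets of `n` integers from the universe `{0, …, N - 1}`.

The words have `w` bits, where `w` is at least a constant `a ≥ 1` times the bit length of `N`, and
the memory can be addressed by `a * bitLength N` bits. For every set `R` there is a nonempty set `I`
of memory contents representing `R`; every query is answered correctly and in time from every
memory in `I`, and leaves a memory in `I`, so any sequence of queries can be answered. -/
def IsPredecessorStructure (a : ℕ) (t s : ℕ → ℕ → ℕ) (pred succ : RamProg) : Prop :=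
  1 ≤ a ∧ ∀ (N w : ℕ) (R : Finset ℕ), a * bitLength N ≤ w → R ⊆ Finset.range N →
    ∃ (S : ℕ) (I : Set (ℕ → ℕ)), S ≤ s N R.card ∧ S ≤ 2 ^ (a * bitLength N) ∧ I.Nonempty ∧
      ∀ M ∈ I, (∀ i < S, M i < 2 ^ w) ∧ ∀ q < N,
        AnswersWithin w S I pred (regInput q) M (t N R.card) (IsPredAnswer R q) ∧
        AnswersWithin w S I succ (regInput q) M (t N R.card) (IsSuccAnswer R q)

/-- The query programs `pred` and `succ` form a finger predecessor data structure: a query gets a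
finger `f ∈ R` and a query point `q`, and takes at most `t D n` steps, where `D = |f - q|`. The
space is `s N n` words, and the conventions are those of `IsPredecessorStructure`. -/
def IsFingerPredecessorStructure (a : ℕ) (t s : ℕ → ℕ → ℕ) (pred succ : RamProg) : Prop :=
  1 ≤ a ∧ ∀ (N w : ℕ) (R : Finset ℕ), a * bitLength N ≤ w → R ⊆ Finset.range N →
    ∃ (S : ℕ) (I : Set (ℕ → ℕ)), S ≤ s N R.card ∧ S ≤ 2 ^ (a * bitLength N) ∧ I.Nonempty ∧
      ∀ M ∈ I, (∀ i < S, M i < 2 ^ w) ∧ ∀ f ∈ R, ∀ q < N,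
        AnswersWithin w S I pred (regInput₂ f q) M (t (Nat.dist f q) R.card) (IsPredAnswer R q) ∧
        AnswersWithin w S I succ (regInput₂ f q) M (t (Nat.dist f q) R.card) (IsSuccAnswer R q)

/-! ## Regularity of time and space bounds -/

/-- A time bound is regular if, up to a constant factor, it does not decrease when the number of
elements grows and the universe size grows by at most a factor of two. Every bound that is
monotone in both arguments is regular. -/
def RegularTimeBound (t : ℕ → ℕ → ℕ) : Prop :=
  ∃ K : ℕ, ∀ N N' n n' : ℕ, N' ≤ N → N ≤ 2 * N' → n' ≤ n → t N' n' ≤ K * t N n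

/-- A space bound is regular if, up to a constant factor, separate structures for nonempty parts
of a set over disjoint parts of a universe do not need more space in total than one structure for
the whole set over the whole universe. -/
def RegularSpaceBound (s : ℕ → ℕ → ℕ) : Prop :=
  ∃ K : ℕ, ∀ (N n : ℕ) (l : List (ℕ × ℕ)), (∀ x ∈ l, 1 ≤ x.2 ∧ x.2 ≤ x.1) →
    (l.map Prod.fst).sum ≤ N → (l.map Prod.snd).sum ≤ n →
    (l.map fun x => s x.1 x.2).sum ≤ K * s N n

/-! ## Packed words -/

/-! Let `l` be the bit length of `N`. Cut the sorted elements of `R` into `m = ⌈n/l⌉` groups of `l`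
consecutive elements (the last may be shorter), and let `R'` be the set of group minima. For each
level `j < l` cover the universe by blocks of length `2 ^ j`, and give every block that meets `R'`
its own copy of the assumed structure for the part of `R'` in it. Space regularity bounds each level
by `O(s N m)`, hence all levels by `O(l * s N m)` (`sum_blockSpace_le`, `exists_blockStructures`).
Everything else takes `O(m * l)` words, and `m = O(s N m)` because regularity applies to `m`
one-point universes (`le_mul_space`).

For a query, a dictionary gives the group of the finger `f`. If `q` lies between the minimum of this
group and the next minimum, the group of `q` is known. Otherwise some group minimum `v` lies between
`f` and `q`, so `|v - q| ≤ D`. With `2 ^ j ≤ D < 2 ^ (j + 1)`, the level `j` blocks of `v` and `q`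
have numbers that differ by at most two. Each group therefore stores, for each level, pointers to
five blocks, and the block of `q` is reached in constant time. One query there costs `t (2 ^ j) _ =
O(t D n)` by time regularity. Its answer, or the stored number of minima before the block, gives the
group that contains the predecessor of `q` (`run_locateGroup`). A search inside that group finishes
the query (`run_finishQuery`); each element is stored with its successor, so successor queries need
nothing else.

The remaining steps must take constant time. The binary logarithm of `D` and the search in a group
are predecessor searches among at most `l` keys of `l` bits. They use trees of height 16 whose nodes
have at most about `l ^ (1/16)` children and are fusion nodes: a few bits of `x` are extracted and
compared with all keys at once, and a table gives the child (`exists_sketch`, `fieldCount_eq`,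
`exists_nodeConsts`, `exists_searchTree`). The dictionary is two-level perfect hashing
(`exists_dictionary`). The assumed query program runs on a part of a larger memory by relocating its
registers and addresses, with at most twice as many steps (`exec_relocate`). -/

/-- The number whose binary digits one are at the positions in `P`. -/
def bitSum (P : Finset ℕ) : ℕ := ∑ b ∈ P, 2 ^ b

theorem testBit_bitSum (P : Finset ℕ) (i : ℕ) : (bitSum P).testBit i = true ↔ i ∈ P := by
  rw [← Nat.mem_bitIndices, ← List.mem_toFinset, bitSum,
    Finset.toFinset_bitIndices_sum_two_pow]

theorem bitSum_lt {P : Finset ℕ} {n : ℕ} (h : ∀ b ∈ P, b < n) : bitSum P < 2 ^ n :=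
  Nat.geomSum_lt (le_refl 2) h

theorem and_bitSum (x : ℕ) (P : Finset ℕ) :
    x &&& bitSum P = bitSum (P.filter fun b => x.testBit b = true) := by
  apply Nat.eq_of_testBit_eq
  intro i
  rw [Bool.eq_iff_iff, testBit_bitSum, Nat.testBit_and, Bool.and_eq_true, testBit_bitSum,
    Finset.mem_filter, and_comm]

/-- Bits at positions that are distinct modulo `g` are gathered into `g` bits. -/
theorem bitSum_mod {P : Finset ℕ} {g : ℕ} (hg : P.card < g)
    (hinj : Set.InjOn (fun b => b % g) (P : Set ℕ)) :
    bitSum P % (2 ^ g - 1) = bitSum (P.image fun b => b % g) := by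
  have hg0 : 0 < g := by omega
  -- Modulo `2 ^ g - 1` the power `2 ^ g` is `1`, so exponents count only modulo `g`.
  have hpow : ∀ b : ℕ, 2 ^ b ≡ 2 ^ (b % g) [MOD (2 ^ g - 1)] := by
    intro b
    have h1 : 2 ^ g ≡ 1 [MOD (2 ^ g - 1)] := by
      have := Nat.one_le_two_pow (n := g)
      exact ((Nat.modEq_iff_dvd' this).2 (dvd_refl _)).symm
    calc 2 ^ b = (2 ^ g) ^ (b / g) * 2 ^ (b % g) := by
          rw [← pow_mul, ← pow_add, Nat.div_add_mod]
      _ ≡ 1 ^ (b / g) * 2 ^ (b % g) [MOD (2 ^ g - 1)] := (h1.pow _).mul_right _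
      _ = 2 ^ (b % g) := by simp
  have himg : bitSum (P.image fun b => b % g) = ∑ b ∈ P, 2 ^ (b % g) := by
    rw [bitSum, Finset.sum_image hinj]
  have hmod : bitSum P ≡ bitSum (P.image fun b => b % g) [MOD (2 ^ g - 1)] := by
    rw [himg, bitSum]
    exact Nat.ModEq.sum fun b _ => hpow b
  -- There are fewer than `g` positions, so the gathered bits are not all ones and the remainder is
  -- the number itself.
  have hlt : bitSum (P.image fun b => b % g) < 2 ^ g - 1 := by
    have hsub : (P.image fun b => b % g) ⊆ Finset.range g := by
      intro b hb
      obtain ⟨c, -, rfl⟩ := Finset.mem_image.1 hb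
      exact Finset.mem_range.2 (Nat.mod_lt _ hg0)
    have hss : (P.image fun b => b % g) ⊂ Finset.range g := by
      refine Finset.ssubset_iff_subset_ne.2 ⟨hsub, fun h => ?_⟩
      have h1 := congrArg Finset.card h
      have h2 := Finset.card_image_le (s := P) (f := fun b => b % g)
      rw [Finset.card_range] at h1
      omega
    have h3 : bitSum (P.image fun b => b % g) < bitSum (Finset.range g) := by
      obtain ⟨a, ha, ha'⟩ := Finset.exists_of_ssubset hss
      exact Finset.sum_lt_sum_of_subset hsub ha ha' (by positivity) (fun _ _ _ => by positivity)
    have h4 : bitSum (Finset.range g) = 2 ^ g - 1 := by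
      rw [bitSum, Nat.geomSum_eq (le_refl 2)]
      simp
    omega
  rw [← Nat.mod_eq_of_lt hlt]
  exact hmod

/-- The word with `F` fields of `β` bits and contents `f 0, f 1, …`. -/
def packWord (β F : ℕ) (f : ℕ → ℕ) : ℕ := ∑ i ∈ Finset.range F, f i * 2 ^ (β * i)

theorem packWord_succ (β F : ℕ) (f : ℕ → ℕ) :
    packWord β (F + 1) f = 2 ^ β * packWord β F (fun i => f (i + 1)) + f 0 := by
  rw [packWord, Finset.sum_range_succ', packWord, Finset.mul_sum]
  simp only [mul_zero, pow_zero, mul_one]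
  congr 1
  refine Finset.sum_congr rfl fun i _ => ?_
  rw [Nat.mul_succ, pow_add]
  ring

theorem packWord_lt {β F : ℕ} {f : ℕ → ℕ} (h : ∀ i < F, f i < 2 ^ β) :
    packWord β F f < 2 ^ (β * F) := by
  induction F generalizing f with
  | zero => simp [packWord]
  | succ F ih =>
    rw [packWord_succ, Nat.mul_succ, pow_add]
    have h1 := ih (f := fun i => f (i + 1)) fun i hi => h (i + 1) (by omega)
    have h0 := h 0 (by omega)
    have h2 : packWord β F (fun i => f (i + 1)) + 1 ≤ 2 ^ (β * F) := h1
    nlinarith [Nat.mul_le_mul_left (2 ^ β) h2]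

theorem packWord_le_packWord {β F : ℕ} {f f' : ℕ → ℕ} (h : ∀ i < F, f i ≤ f' i) :
    packWord β F f ≤ packWord β F f' :=
  Finset.sum_le_sum fun i hi => Nat.mul_le_mul_right _ (h i (Finset.mem_range.1 hi))

theorem mul_packWord (β F c : ℕ) (f : ℕ → ℕ) :
    c * packWord β F f = packWord β F fun i => c * f i := by
  simp only [packWord, Finset.mul_sum, mul_assoc]

theorem packWord_sub {β F : ℕ} {f f' : ℕ → ℕ} (h : ∀ i < F, f' i ≤ f i) :
    packWord β F f - packWord β F f' = packWord β F fun i => f i - f' i := by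
  have : packWord β F (fun i => f i - f' i) + packWord β F f' = packWord β F f := by
    rw [packWord, packWord, packWord, ← Finset.sum_add_distrib]
    refine Finset.sum_congr rfl fun i hi => ?_
    rw [← add_mul, Nat.sub_add_cancel (h i (Finset.mem_range.1 hi))]
  omega

theorem testBit_packWord {β F : ℕ} {f : ℕ → ℕ} (h : ∀ i < F, f i < 2 ^ β) (i t : ℕ) (ht : t < β) :
    (packWord β F f).testBit (β * i + t) = (decide (i < F) && (f i).testBit t) := by
  induction F generalizing f i with
  | zero => simp [packWord]
  | succ F ih =>
    rw [packWord_succ, Nat.testBit_two_pow_mul_add _ (h 0 (by omega))]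
    cases i with
    | zero => simp [ht]
    | succ i =>
      have : ¬ β * (i + 1) + t < β := by nlinarith
      rw [if_neg this, show β * (i + 1) + t - β = β * i + t by rw [Nat.mul_succ]; omega,
        ih (f := fun i => f (i + 1)) fun i hi => h (i + 1) (by omega)]
      simp

theorem packWord_div_mod {β F : ℕ} {f : ℕ → ℕ} (h : ∀ i < F, f i < 2 ^ β) {i : ℕ} (hi : i < F) :
    packWord β F f / 2 ^ (β * i) % 2 ^ β = f i := by
  apply Nat.eq_of_testBit_eq
  intro t
  rw [Nat.testBit_mod_two_pow, Nat.testBit_div_two_pow]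
  by_cases ht : t < β
  · rw [add_comm t, testBit_packWord h i t ht]
    simp [ht, hi]
  · rw [Nat.testBit_lt_two_pow (lt_of_lt_of_le (h i hi)
      (Nat.pow_le_pow_right two_pos (not_lt.1 ht)))]
    simp [ht]

/-- Casting out nines in base `2 ^ β`: the remainder is the digit sum, so one `mod` instruction adds
up all fields. -/
theorem packWord_mod {β F : ℕ} {f : ℕ → ℕ}
    (h : ∑ i ∈ Finset.range F, f i < 2 ^ β - 1) :
    packWord β F f % (2 ^ β - 1) = ∑ i ∈ Finset.range F, f i := by
  have h1 : 2 ^ β ≡ 1 [MOD (2 ^ β - 1)] :=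
    ((Nat.modEq_iff_dvd' Nat.one_le_two_pow).2 (dvd_refl _)).symm
  have hmod : packWord β F f ≡ ∑ i ∈ Finset.range F, f i [MOD (2 ^ β - 1)] := by
    refine Nat.ModEq.sum fun i _ => ?_
    have := ((h1.pow i).mul_left (f i))
    rwa [← pow_mul, one_pow, mul_one] at this
  rw [← Nat.mod_eq_of_lt h]
  exact hmod

/-- The number of fields of a packed word that are at least `x`, as computed by a word RAM. -/
def fieldCount (K C L E x : ℕ) : ℕ := (((K - x * C) >>> L) &&& C) % E

/-- Parallel comparison of `x` with the `F` keys `f i`. -/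
theorem fieldCount_eq {L F : ℕ} {f : ℕ → ℕ} (hf : ∀ i < F, f i < 2 ^ L) (hF : F < 2 ^ L) {x : ℕ}
    (hx : x < 2 ^ L) :
    fieldCount (packWord (L + 1) F fun i => 2 ^ L + f i) (packWord (L + 1) F fun _ => 1) L
      (2 ^ (L + 1) - 1) x = ((Finset.range F).filter fun i => x ≤ f i).card := by
  have hp : 2 ^ (L + 1) = 2 ^ L + 2 ^ L := by rw [pow_succ]; ring
  -- The guard bit `2 ^ L` of each field absorbs the borrow, so the subtraction acts field by field.
  -- The guard bit survives exactly in the fields with `x ≤ f i`; shift and mask isolate these bits,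
  -- and the remainder counts them.
  have hsub : packWord (L + 1) F (fun i => 2 ^ L + f i) - x * packWord (L + 1) F (fun _ => 1)
      = packWord (L + 1) F fun i => 2 ^ L + f i - x := by
    rw [mul_packWord, packWord_sub fun i hi => by omega]
    simp
  have hlt : ∀ i < F, 2 ^ L + f i - x < 2 ^ (L + 1) := fun i hi => by have := hf i hi; omega
  have hone : ∀ i < F, (fun _ : ℕ => 1) i < 2 ^ (L + 1) := fun i _ => by
    have := Nat.one_le_two_pow (n := L)
    dsimp only
    omega
  have hind : ∀ i < F, (fun i => if x ≤ f i then 1 else 0) i < 2 ^ (L + 1) := fun i _ => by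
    have := Nat.one_le_two_pow (n := L)
    dsimp only
    split_ifs <;> omega
  have hand : ((packWord (L + 1) F fun i => 2 ^ L + f i - x) >>> L) &&&
      packWord (L + 1) F (fun _ => 1) = packWord (L + 1) F fun i => if x ≤ f i then 1 else 0 := by
    apply Nat.eq_of_testBit_eq
    intro j
    obtain ⟨i, t, ht, rfl⟩ : ∃ i t, t < L + 1 ∧ j = (L + 1) * i + t :=
      ⟨j / (L + 1), j % (L + 1), Nat.mod_lt _ (by omega), (Nat.div_add_mod _ _).symm⟩
    rw [Nat.testBit_and, testBit_packWord hone i t ht, testBit_packWord hind i t ht]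
    by_cases hi : i < F
    · rcases Nat.eq_zero_or_pos t with rfl | htp
      · rw [Nat.testBit_shiftRight,
          show L + ((L + 1) * i + 0) = (L + 1) * i + L by ring,
          testBit_packWord hlt i L (by omega), Nat.testBit_eq_decide_div_mod_eq]
        have h1 := hf i hi
        by_cases hxi : x ≤ f i
        · have : (2 ^ L + f i - x) / 2 ^ L = 1 := by
            apply Nat.div_eq_of_lt_le <;> omega
          simp [hi, hxi, this]
        · have : (2 ^ L + f i - x) / 2 ^ L = 0 := Nat.div_eq_of_lt (by omega)
          simp [hxi, this]
      · obtain ⟨t, rfl⟩ : ∃ s, t = s + 1 := ⟨t - 1, by omega⟩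
        have h1 : Nat.testBit 1 (t + 1) = false := by simp [Nat.testBit_succ]
        split_ifs <;> simp [h1]
    · simp [hi]
  have hsum : (∑ i ∈ Finset.range F, if x ≤ f i then 1 else 0)
      = ((Finset.range F).filter fun i => x ≤ f i).card := by
    rw [Finset.card_filter]
  rw [fieldCount, hsub, hand, packWord_mod, hsum]
  rw [hsum]
  have := Finset.card_filter_le (Finset.range F) (fun i => x ≤ f i)
  rw [Finset.card_range] at this
  omega

/-! ## Sketches: extracting few bits of a word in constant time -/

/-- In each factorization of `d` one factor is at most `s`, so every divisor is either at most `s`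
or the cofactor of such a number. -/
theorem card_divisors_le_two_mul {d s : ℕ} (hd : d ≤ s * s) : d.divisors.card ≤ 2 * s := by
  have hsub : d.divisors ⊆ Finset.Icc 1 s ∪ (Finset.Icc 1 s).image (d / ·) := by
    intro c hc
    have hcd := Nat.dvd_of_mem_divisors hc
    have hc0 := Nat.pos_of_mem_divisors hc
    have hd0 : 0 < d := Nat.pos_of_ne_zero (Nat.mem_divisors.1 hc).2
    rw [Finset.mem_union, Finset.mem_image]
    by_cases h : c ≤ s
    · exact Or.inl (Finset.mem_Icc.2 ⟨hc0, h⟩)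
    · obtain ⟨e, rfl⟩ := hcd
      refine Or.inr ⟨e, Finset.mem_Icc.2 ⟨Nat.pos_of_mul_pos_left hd0, ?_⟩, ?_⟩
      · by_contra hes
        nlinarith
      · exact Nat.mul_div_cancel _ (Nat.pos_of_mul_pos_left hd0)
  calc d.divisors.card ≤ _ := Finset.card_le_card hsub
    _ ≤ _ := Finset.card_union_le _ _
    _ ≤ s + s := by
      refine add_le_add (by simp) (Finset.card_image_le.trans (by simp))
    _ = 2 * s := by ring

/-- A small modulus that separates the elements of a small set of small numbers. -/
theorem exists_separating_modulus {P : Finset ℕ} {F l s : ℕ} (hP : ∀ b ∈ P, b ≤ l)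
    (hF : P.card ≤ F) (hl : l ≤ s * s) :
    ∃ g, F < g ∧ g ≤ F + F * F * (2 * s) + 1 ∧ Set.InjOn (fun b => b % g) (P : Set ℕ) := by
  set bad : Finset ℕ := (P ×ˢ P).biUnion fun b => (b.2 - b.1).divisors with hbad
  have hcard : bad.card ≤ F * F * (2 * s) := by
    calc bad.card ≤ ∑ b ∈ P ×ˢ P, (b.2 - b.1).divisors.card := Finset.card_biUnion_le
      _ ≤ ∑ _b ∈ P ×ˢ P, 2 * s := by
        refine Finset.sum_le_sum fun b hb => card_divisors_le_two_mul ?_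
        have := hP b.2 (Finset.mem_product.1 hb).2
        omega
      _ = P.card * P.card * (2 * s) := by simp
      _ ≤ _ := Nat.mul_le_mul_right _ (Nat.mul_le_mul hF hF)
  -- A modulus fails to separate two positions only if it divides their difference. The interval has
  -- one more element than there can be such divisors.
  obtain ⟨g, hg, hgb⟩ : ∃ g ∈ Finset.Ioc F (F + F * F * (2 * s) + 1), g ∉ bad := by
    apply Finset.exists_mem_notMem_of_card_lt_card
    rw [Nat.card_Ioc]
    omega
  rw [Finset.mem_Ioc] at hg
  refine ⟨g, hg.1, hg.2, ?_⟩
  have key : ∀ b ∈ P, ∀ c ∈ P, b % g = c % g → ¬ b < c := by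
    intro b hb c hc h hlt
    refine hgb (Finset.mem_biUnion.2 ⟨(b, c), Finset.mem_product.2 ⟨hb, hc⟩, ?_⟩)
    exact Nat.mem_divisors.2 ⟨(Nat.modEq_iff_dvd' hlt.le).1 h, by dsimp only; omega⟩
  intro b hb c hc h
  exact le_antisymm (not_lt.1 (key c hc b hb h.symm)) (not_lt.1 (key b hb c hc h))

/-- The sketch of `v` with respect to given constants, as computed by a word RAM. -/
def sketch (mask E copies mask' v : ℕ) : ℕ := ((v &&& mask) % E * copies) &&& mask'

/-- An upper bound for the number of bits of a sketch that extracts `F` of `l ≤ s ^ 2` bits. -/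
def sketchBits (F s : ℕ) : ℕ := F * (F + F * F * (2 * s) + 1)

/-- The bits of a word at the positions in a small set `P` can be extracted in order, to
positions `φ b` below a small bound. -/
theorem exists_sketch {P : Finset ℕ} {F l s : ℕ} (hP : ∀ b ∈ P, b ≤ l) (hF : P.card ≤ F)
    (hF0 : 0 < F) (hl : l ≤ s * s) :
    ∃ (mask E copies mask' : ℕ) (φ : ℕ → ℕ), mask < 2 ^ (l + 1) ∧ 0 < E ∧
      E < 2 ^ sketchBits F s ∧
      E * copies < 2 ^ (2 * sketchBits F s) ∧ mask' < 2 ^ sketchBits F s ∧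
      (∀ b ∈ P, φ b < sketchBits F s) ∧ StrictMonoOn φ (P : Set ℕ) ∧
      ∀ v, (∀ b ∈ P, (sketch mask E copies mask' v).testBit (φ b) = v.testBit b) ∧
        ∀ j, (sketch mask E copies mask' v).testBit j = true → ∃ b ∈ P, φ b = j := by
  obtain ⟨g, hFg, hg, hinj⟩ := exists_separating_modulus hP hF hl
  -- Reduction modulo `2 ^ g - 1` keeps the bits apart but loses their order. Multiplication makes
  -- `F` copies of the result, and the bit of `b` is read from copy number `rk b`, which restores
  -- the order.
  set rk : ℕ → ℕ := fun b => (P.filter (· < b)).card with hrk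
  set φ : ℕ → ℕ := fun b => g * rk b + b % g with hφ
  have hg0 : 0 < g := by omega
  have hL : g * F ≤ sketchBits F s := by
    rw [mul_comm]; exact Nat.mul_le_mul_left _ hg
  have hgL : g ≤ sketchBits F s := le_trans (Nat.le_mul_of_pos_right g hF0) hL
  have hrklt : ∀ b ∈ P, rk b < F := fun b hb =>
    lt_of_lt_of_le (Finset.card_lt_card
      (Finset.filter_ssubset.2 ⟨b, hb, lt_irrefl b⟩)) hF
  have hφlt : ∀ b ∈ P, φ b < g * F := by
    intro b hb
    have h1 : rk b + 1 ≤ F := hrklt b hb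
    have h2 := Nat.mod_lt b hg0
    have h3 := Nat.mul_le_mul_left g h1
    rw [Nat.mul_succ] at h3
    simp only [hφ]
    omega
  have hφmono : StrictMonoOn φ (P : Set ℕ) := by
    intro b hb c hc hbc
    have h1 : rk b < rk c := by
      apply Finset.card_lt_card
      refine Finset.ssubset_iff_subset_ne.2 ⟨fun x hx => ?_, fun h => ?_⟩
      · rw [Finset.mem_filter] at hx ⊢
        exact ⟨hx.1, hx.2.trans hbc⟩
      · have : b ∈ P.filter (· < c) := Finset.mem_filter.2 ⟨hb, hbc⟩
        rw [← h, Finset.mem_filter] at this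
        exact lt_irrefl _ this.2
    have h2 := Nat.mod_lt b hg0
    have h3 := Nat.mul_le_mul_left g (show rk b + 1 ≤ rk c from h1)
    rw [Nat.mul_succ] at h3
    simp only [hφ]
    omega
  have hcopies : packWord g F (fun _ => 1) < 2 ^ (g * F) :=
    packWord_lt fun _ _ => Nat.one_lt_two_pow (by omega)
  have hE : 2 ^ g - 1 < 2 ^ g := by have := Nat.one_le_two_pow (n := g); omega
  refine ⟨bitSum P, 2 ^ g - 1, packWord g F fun _ => 1, bitSum (P.image φ), φ,
    bitSum_lt fun b hb => Nat.lt_succ_of_le (hP b hb), ?_, ?_, ?_, ?_,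
    fun b hb => (hφlt b hb).trans_le hL, hφmono, fun v => ?_⟩
  · have := Nat.one_lt_two_pow (n := g) (by omega); omega
  · exact hE.trans_le (Nat.pow_le_pow_right two_pos hgL)
  · rw [two_mul, pow_add]
    exact Nat.mul_lt_mul'' (hE.trans_le (Nat.pow_le_pow_right two_pos hgL))
      (hcopies.trans_le (Nat.pow_le_pow_right two_pos hL))
  · refine bitSum_lt fun j hj => ?_
    obtain ⟨b, hb, rfl⟩ := Finset.mem_image.1 hj
    exact (hφlt b hb).trans_le hL
  · set Q := P.filter fun b => v.testBit b = true with hQ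
    have hQP : Q ⊆ P := Finset.filter_subset _ _
    have hQmod : bitSum Q % (2 ^ g - 1) = bitSum (Q.image fun b => b % g) :=
      bitSum_mod (lt_of_le_of_lt ((Finset.card_le_card hQP).trans hF) hFg)
        (hinj.mono (by exact_mod_cast hQP))
    have hτ : bitSum (Q.image fun b => b % g) < 2 ^ g := by
      refine bitSum_lt fun j hj => ?_
      obtain ⟨b, -, rfl⟩ := Finset.mem_image.1 hj
      exact Nat.mod_lt _ hg0
    have hsk : ∀ j, (sketch (bitSum P) (2 ^ g - 1) (packWord g F fun _ => 1)
        (bitSum (P.image φ)) v).testBit j = true ↔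
        (packWord g F fun _ => bitSum (Q.image fun b => b % g)).testBit j = true ∧
          j ∈ P.image φ := by
      intro j
      rw [sketch, and_bitSum v P, ← hQ, hQmod, mul_packWord, Nat.testBit_and, Bool.and_eq_true,
        testBit_bitSum]
      simp only [mul_one]
    refine ⟨fun b hb => ?_, fun j hj => ?_⟩
    · rw [Bool.eq_iff_iff, hsk, hφ, testBit_packWord (fun _ _ => hτ) _ _ (Nat.mod_lt _ hg0)]
      rw [Bool.and_eq_true, testBit_bitSum, decide_eq_true_iff]
      constructor
      · rintro ⟨⟨-, h⟩, -⟩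
        obtain ⟨c, hc, hcb⟩ := Finset.mem_image.1 h
        have : c = b := hinj (hQP hc) hb hcb
        exact this ▸ (Finset.mem_filter.1 hc).2
      · intro h
        exact ⟨⟨hrklt b hb, Finset.mem_image.2 ⟨b, Finset.mem_filter.2 ⟨hb, h⟩, rfl⟩⟩,
          Finset.mem_image.2 ⟨b, hb, rfl⟩⟩
    · obtain ⟨b, hb, rfl⟩ := Finset.mem_image.1 ((hsk j).1 hj).2
      exact ⟨b, hb, rfl⟩

/-! ## Longest common prefixes and branching bits -/

/-- Both sides say that no digit from position `b` on differs. Lengths of common prefixes thus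
become sizes of exclusive ors, which the machine can compare. -/
theorem xor_lt_two_pow_iff {x y b : ℕ} : x ^^^ y < 2 ^ b ↔ x / 2 ^ b = y / 2 ^ b := by
  rw [← Nat.xor_eq_zero_iff, ← Nat.shiftRight_eq_div_pow, ← Nat.shiftRight_eq_div_pow,
    ← Nat.shiftRight_xor_distrib, Nat.shiftRight_eq_div_pow, Nat.div_eq_zero_iff]
  simp

theorem div_two_pow_eq_of_le {x y a b : ℕ} (h : x / 2 ^ a = y / 2 ^ a) (hab : a ≤ b) :
    x / 2 ^ b = y / 2 ^ b := by
  obtain ⟨c, rfl⟩ := Nat.exists_eq_add_of_le hab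
  rw [pow_add, ← Nat.div_div_eq_div_mul, ← Nat.div_div_eq_div_mul, h]

theorem testBit_eq_of_div_eq {x y a b : ℕ} (h : x / 2 ^ a = y / 2 ^ a) (hab : a ≤ b) :
    x.testBit b = y.testBit b := by
  rw [Nat.testBit_eq_decide_div_mod_eq, Nat.testBit_eq_decide_div_mod_eq,
    div_two_pow_eq_of_le h hab]

/-- The position of the highest bit in which two numbers differ. -/
def branchBit (x y : ℕ) : ℕ := Nat.log2 (x ^^^ y)

theorem div_branchBit_succ (x y : ℕ) :
    x / 2 ^ (branchBit x y + 1) = y / 2 ^ (branchBit x y + 1) := by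
  rw [← xor_lt_two_pow_iff]
  exact Nat.lt_log2_self

theorem div_branchBit_ne {x y : ℕ} (h : x ≠ y) :
    x / 2 ^ branchBit x y ≠ y / 2 ^ branchBit x y := by
  rw [Ne, ← xor_lt_two_pow_iff, not_lt]
  exact Nat.log2_self_le (by rwa [Ne, Nat.xor_eq_zero_iff])

theorem testBit_of_lt {x y b : ℕ} (hlt : x < y) (h : x / 2 ^ (b + 1) = y / 2 ^ (b + 1))
    (hne : x / 2 ^ b ≠ y / 2 ^ b) : x.testBit b = false ∧ y.testBit b = true := by
  rw [pow_succ, ← Nat.div_div_eq_div_mul, ← Nat.div_div_eq_div_mul] at h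
  have hle : x / 2 ^ b ≤ y / 2 ^ b := Nat.div_le_div_right hlt.le
  rw [Nat.testBit_eq_decide_div_mod_eq, Nat.testBit_eq_decide_div_mod_eq]
  simp only [decide_eq_false_iff_not, decide_eq_true_eq]
  omega

/-- `P` contains all positions at which the trie of the keys `y 0, …, y (cnt - 1)` branches. -/
def BranchesIn (P : Finset ℕ) (cnt : ℕ) (y : ℕ → ℕ) : Prop :=
  ∀ i < cnt, ∀ j < cnt, y i ≠ y j → branchBit (y i) (y j) ∈ P

/-- No key has a longer common prefix with `x` than the key `y c`. -/
def MaxPrefix (cnt : ℕ) (y : ℕ → ℕ) (x c : ℕ) : Prop :=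
  ∀ i < cnt, ∀ b, y i / 2 ^ b = x / 2 ^ b → y c / 2 ^ b = x / 2 ^ b

/-- `sk` extracts the bits at the positions in `P` to the positions `φ b`. -/
structure IsSketch (P : Finset ℕ) (φ : ℕ → ℕ) (sk : ℕ → ℕ) : Prop where
  mono : StrictMonoOn φ (P : Set ℕ)
  bit : ∀ v, ∀ b ∈ P, (sk v).testBit (φ b) = v.testBit b
  only : ∀ v j, (sk v).testBit j = true → ∃ b ∈ P, φ b = j

namespace IsSketch

variable {P : Finset ℕ} {φ sk : ℕ → ℕ}

/-- The sketches differ at `φ b`. Above it they agree: digits there are either copies of digits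
above `b`, where `x` and `y` coincide, or zero in both by `only`. -/
theorem lt_of_branch (hs : IsSketch P φ sk) {x y b : ℕ} (hb : b ∈ P)
    (h : x / 2 ^ (b + 1) = y / 2 ^ (b + 1))
    (hx : x.testBit b = false) (hy : y.testBit b = true) : sk x < sk y := by
  refine Nat.lt_of_testBit (φ b) (by rw [hs.bit x b hb, hx]) (by rw [hs.bit y b hb, hy]) ?_
  intro j hj
  have key : ∀ c ∈ P, φ c = j → (sk x).testBit j = (sk y).testBit j := by
    rintro c hc rfl
    rw [hs.bit x c hc, hs.bit y c hc]
    exact testBit_eq_of_div_eq h ((hs.mono.lt_iff_lt hb hc).1 hj)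
  by_cases h1 : (sk x).testBit j = true
  · obtain ⟨c, hc, hcj⟩ := hs.only x j h1
    exact key c hc hcj
  · by_cases h2 : (sk y).testBit j = true
    · obtain ⟨c, hc, hcj⟩ := hs.only y j h2
      exact key c hc hcj
    · rw [Bool.not_eq_true] at h1 h2
      rw [h1, h2]

theorem lt_of_lt (hs : IsSketch P φ sk) {x y : ℕ} (hlt : x < y) (hb : branchBit x y ∈ P) :
    sk x < sk y := by
  obtain ⟨h1, h2⟩ := testBit_of_lt hlt (div_branchBit_succ x y) (div_branchBit_ne hlt.ne)
  exact hs.lt_of_branch hb (div_branchBit_succ x y) h1 h2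

/-- A key whose sketch lies between those of `x` and of another key `w` shares with `x` all common
prefixes of `x` and `w`. -/
theorem prefix_of_between (hs : IsSketch P φ sk) {x v w b : ℕ} (hw : w / 2 ^ b = x / 2 ^ b)
    (hP : v ≠ w → branchBit v w ∈ P)
    (hbt : (sk x ≤ sk v ∧ sk v ≤ sk w) ∨ (sk w ≤ sk v ∧ sk v ≤ sk x)) :
    v / 2 ^ b = x / 2 ^ b := by
  by_contra hne
  have hvw : v ≠ w := fun h => hne (h ▸ hw)
  -- If `v` leaves the common prefix of `w` and `x`, it does so at a position `c ≥ b` where `w` and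
  -- `x` still agree. Then `v` branches off from both in the same direction, and its sketch lies
  -- strictly on one side of both sketches.
  set c := branchBit v w with hc
  have hcP := hP hvw
  have hsucc := div_branchBit_succ v w
  have hcne := div_branchBit_ne hvw
  rw [← hc] at hsucc hcne
  have hbc : b ≤ c := by
    by_contra hlt
    exact hne ((div_two_pow_eq_of_le hsucc (by omega)).trans hw)
  have hxsucc : v / 2 ^ (c + 1) = x / 2 ^ (c + 1) :=
    hsucc.trans (div_two_pow_eq_of_le hw (by omega))
  have hbit : w.testBit c = x.testBit c := testBit_eq_of_div_eq hw hbc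
  rcases lt_or_gt_of_ne hvw with hlt | hlt
  · obtain ⟨h1, h2⟩ := testBit_of_lt hlt hsucc hcne
    have h3 := hs.lt_of_branch hcP hsucc h1 h2
    have h4 := hs.lt_of_branch hcP hxsucc h1 (hbit ▸ h2)
    omega
  · obtain ⟨h1, h2⟩ := testBit_of_lt hlt hsucc.symm hcne.symm
    have h3 := hs.lt_of_branch hcP hsucc.symm h1 h2
    have h4 := hs.lt_of_branch hcP hxsucc.symm (hbit ▸ h1) h2
    omega

end IsSketch

/-- In a nondecreasing sequence the entries that are at least `x` form a final segment, so their
number determines where the segment starts. This turns the result of a parallel comparison into a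
rank. -/
theorem sub_card_le_iff {n x : ℕ} {f : ℕ → ℕ} (hf : ∀ i j, i < j → j < n → f i ≤ f j) {i : ℕ}
    (hi : i < n) : n - ((Finset.range n).filter fun i => x ≤ f i).card ≤ i ↔ x ≤ f i := by
  obtain ⟨u, hu, hu'⟩ : ∃ u ≤ n, ∀ i < n, x ≤ f i ↔ u ≤ i := by
    by_cases h : ∃ j < n, x ≤ f j
    · classical
      refine ⟨Nat.find h, (Nat.find_spec h).1.le, fun i hi => ⟨fun hx => Nat.find_min' h ⟨hi, hx⟩,
        fun hle => ?_⟩⟩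
      rcases hle.eq_or_lt with heq | hlt
      · exact heq ▸ (Nat.find_spec h).2
      · exact (Nat.find_spec h).2.trans (hf _ _ hlt hi)
    · push Not at h
      exact ⟨n, le_refl n, fun i hi => by have := h i hi; omega⟩
  have : (Finset.range n).filter (fun i => x ≤ f i) = Finset.Ico u n := by
    ext j
    rw [Finset.mem_filter, Finset.mem_range, Finset.mem_Ico]
    constructor
    · rintro ⟨h1, h2⟩
      exact ⟨(hu' j h1).1 h2, h1⟩
    · rintro ⟨h1, h2⟩
      exact ⟨h2, (hu' j h2).2 h1⟩
  rw [this, Nat.card_Ico, hu' i hi]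
  omega

/-- One of the two keys next to `x` in the order of sketches has a longest common prefix
with `x`: the one with the smaller exclusive or. -/
theorem maxPrefix_of_candidates {P : Finset ℕ} {φ sk : ℕ → ℕ} (hs : IsSketch P φ sk) {cnt : ℕ}
    {y : ℕ → ℕ} (hP : BranchesIn P cnt y) {x u cu cl : ℕ}
    (hu : ∀ i < cnt, u ≤ i ↔ sk x ≤ sk (y i))
    (hmono : ∀ i j, i < j → j < cnt → sk (y i) ≤ sk (y j)) (hul : u ≤ cnt)
    (hcu : u < cnt → cu = u) (hcl : 0 < u → cl = u - 1) :
    MaxPrefix cnt y x (if x ^^^ y cl < x ^^^ y cu then cl else cu) := by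
  have hmono' : ∀ i j, i ≤ j → j < cnt → sk (y i) ≤ sk (y j) := fun i j hij hj => by
    rcases hij.eq_or_lt with rfl | h
    · exact le_refl _
    · exact hmono i j h hj
  intro i hi b hb
  -- Whichever key has the long prefix, one of the two neighbours of `x` in sketch order lies
  -- between `x` and that key, and so shares the prefix.
  have key : y cl / 2 ^ b = x / 2 ^ b ∨ y cu / 2 ^ b = x / 2 ^ b := by
    by_cases hui : u ≤ i
    · right
      rw [hcu (by omega)]
      exact hs.prefix_of_between hb (hP u (by omega) i hi)
        (Or.inl ⟨(hu u (by omega)).1 le_rfl, hmono' u i hui hi⟩)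
    · left
      rw [hcl (by omega)]
      refine hs.prefix_of_between hb (hP (u - 1) (by omega) i hi)
        (Or.inr ⟨hmono' i (u - 1) (by omega) (by omega), ?_⟩)
      have := hu (u - 1) (by omega)
      by_contra hcon
      have := this.2 (by omega)
      omega
  rw [eq_comm, ← xor_lt_two_pow_iff, eq_comm, ← xor_lt_two_pow_iff] at key
  rw [eq_comm, ← xor_lt_two_pow_iff]
  split_ifs <;> omega

/-- The rank of `x` among the keys is determined by a key `y c` with a longest common prefix, by
the comparison of `x` with `y c`, and by the number of branching positions below which `x` and `y c`
differ. -/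
theorem le_of_same_branch {P : Finset ℕ} {cnt F : ℕ} {y en : ℕ → ℕ} (hP : BranchesIn P cnt y)
    (hen : ∀ b ∈ P, ∃ i < F, en i = b) {x x' c : ℕ} (hc : c < cnt)
    (hx : MaxPrefix cnt y x c) (hx' : MaxPrefix cnt y x' c) (hlt : x < y c ↔ x' < y c)
    (hcard : ((Finset.range F).filter fun i => x ^^^ y c < 2 ^ en i).card =
      ((Finset.range F).filter fun i => x' ^^^ y c < 2 ^ en i).card) {i : ℕ} (hi : i < cnt)
    (hle : y i ≤ x) : y i ≤ x' := by
  -- The sets of positions above the two exclusive ors are nested, so equal cardinality makes them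
  -- equal.
  have heq : ∀ j < F, x ^^^ y c < 2 ^ en j ↔ x' ^^^ y c < 2 ^ en j := by
    have hsame : (Finset.range F).filter (fun i => x ^^^ y c < 2 ^ en i) =
        (Finset.range F).filter (fun i => x' ^^^ y c < 2 ^ en i) := by
      rcases le_total (x ^^^ y c) (x' ^^^ y c) with h | h
      · exact (Finset.eq_of_subset_of_card_le (Finset.monotone_filter_right _
          (fun j _ hj => h.trans_lt hj)) hcard.le).symm
      · exact Finset.eq_of_subset_of_card_le (Finset.monotone_filter_right _
          (fun j _ hj => h.trans_lt hj)) hcard.ge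
    intro j hj
    have := Finset.ext_iff.1 hsame j
    simpa [hj] using this
  by_contra hcon
  rw [not_le] at hcon
  have hne : y c ≠ y i := by
    rintro h
    rw [← h] at hle hcon
    omega
  -- If `y i` separated `x'` from `x`, look at the digit `b` where `y i` branches off from `y c`. By
  -- maximality neither `x` nor `x'` follows `y i` there, and by `heq` either both or none follow `y
  -- c`. With both on the same side of `y c` this is contradictory.
  set b := branchBit (y c) (y i) with hb
  obtain ⟨j, hj, hjb⟩ := hen b (hP c hc i hi hne)
  have hsucc := div_branchBit_succ (y c) (y i)
  have hbne := div_branchBit_ne hne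
  rw [← hb] at hsucc hbne
  have hiff := heq j hj
  rw [hjb, xor_lt_two_pow_iff, xor_lt_two_pow_iff] at hiff
  have hsucc' := hsucc
  rw [pow_succ, ← Nat.div_div_eq_div_mul, ← Nat.div_div_eq_div_mul] at hsucc'
  have m1 : y i / 2 ^ b ≤ x / 2 ^ b := Nat.div_le_div_right hle
  have m2 : x' / 2 ^ b ≤ y i / 2 ^ b := Nat.div_le_div_right hcon.le
  by_cases hxc : x < y c
  · have m3 : x / 2 ^ b ≤ y c / 2 ^ b := Nat.div_le_div_right hxc.le
    have h1 : ¬ y i / 2 ^ b = x / 2 ^ b := fun h => hbne ((hx i hi b h).trans h.symm)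
    omega
  · have m3 : y c / 2 ^ b ≤ x' / 2 ^ b :=
      Nat.div_le_div_right (not_lt.1 fun h => hxc (hlt.2 h))
    have h1 : ¬ y i / 2 ^ b = x' / 2 ^ b := fun h => hbne ((hx' i hi b h).trans h.symm)
    omega

/-! ## Comparing a word with the powers of two at given positions -/

theorem bitSum_mono {P Q : Finset ℕ} (h : P ⊆ Q) : bitSum P ≤ bitSum Q :=
  Finset.sum_le_sum_of_subset h

theorem bitSum_range (n : ℕ) : bitSum (Finset.range n) + 1 = 2 ^ n := by
  have := Nat.geomSum_eq (le_refl 2) n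
  rw [bitSum, this]
  have := Nat.one_le_two_pow (n := n)
  simp
  omega

/-- The digit at a position missing from `M` is zero; this gap will receive the carry of an addition
to the lower part. -/
theorem bitSum_split {M : Finset ℕ} {b : ℕ} (hb : b ∉ M) :
    ∃ q, bitSum M = 2 ^ (b + 1) * q + bitSum (M.filter (· < b)) := by
  have h1 : bitSum M = bitSum (M.filter (· < b)) + bitSum (M.filter fun j => ¬ j < b) :=
    (Finset.sum_filter_add_sum_filter_not M (· < b) _).symm
  obtain ⟨q, hq⟩ : 2 ^ (b + 1) ∣ bitSum (M.filter fun j => ¬ j < b) := by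
    refine Finset.dvd_sum fun j hj => pow_dvd_pow 2 ?_
    rw [Finset.mem_filter] at hj
    have : j ≠ b := fun h => hb (h ▸ hj.1)
    omega
  exact ⟨q, by rw [h1, hq]; ring⟩

/-- The number whose comparison with the images of powers of two decides the comparison of `z` with
these powers; `sk` extracts bits and `m` is the complement of their positions. -/
def levelWord (sk : ℕ → ℕ) (m z : ℕ) : ℕ := sk z ||| (sk ((z &&& m) + m) >>> 1)

/-- Let `p` be the highest digit of `z`. If `p ∈ P`, the sketch of `z` shows it. Otherwise adding
the complement mask makes a carry run from `p` through all positions outside `P` to the next `c ∈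
P`, where it is visible in the second sketch. Such a carry means only that `z` reaches beyond the
positions of `P` below `c`; the shift by one places it below `φ c` but not below `φ b` for any
smaller `b ∈ P`. -/
theorem levelWord_lt_iff {P : Finset ℕ} {φ sk : ℕ → ℕ} (hs : IsSketch P φ sk) {l : ℕ} (hl : l ∈ P)
    {z : ℕ} (hz : z < 2 ^ l) {b : ℕ} (hb : b ∈ P) :
    levelWord sk (bitSum (Finset.range l \ P)) z < 2 ^ φ b ↔ z < 2 ^ b := by
  set M := Finset.range l \ P with hM
  set z1 := z &&& bitSum M with hz1
  have hnotM : ∀ c ∈ P, c ∉ M := fun c hc h => (Finset.mem_sdiff.1 h).2 hc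
  have hz1z : z1 ≤ z := Nat.and_le_left
  constructor
  · contrapose!
    intro hzb
    have hz0 : z ≠ 0 := by have := Nat.one_le_two_pow (n := b); omega
    set p := Nat.log2 z with hp
    have hpz : 2 ^ p ≤ z := Nat.log2_self_le hz0
    have hzp : z < 2 ^ (p + 1) := Nat.lt_log2_self
    have hbp : b ≤ p := (Nat.le_log2 hz0).2 hzb
    have hpl : p < l := (Nat.pow_lt_pow_iff_right (by norm_num)).1 (hpz.trans_lt hz)
    have hzbit : z.testBit p = true := Nat.testBit_log2 hz0
    by_cases hpP : p ∈ P
    · have h1 : (levelWord sk (bitSum M) z).testBit (φ p) = true := by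
        rw [levelWord, Nat.testBit_or, hs.bit z p hpP, hzbit, Bool.true_or]
      exact (Nat.pow_le_pow_right two_pos (hs.mono.monotoneOn hb hpP hbp)).trans
        (Nat.ge_two_pow_of_testBit h1)
    · have hpM : p ∈ M := Finset.mem_sdiff.2 ⟨Finset.mem_range.2 hpl, hpP⟩
      have hz1p : 2 ^ p ≤ z1 := by
        apply Nat.ge_two_pow_of_testBit
        rw [hz1, Nat.testBit_and, hzbit, (testBit_bitSum M p).2 hpM]
        rfl
      -- The position `l ∈ P` is the sentinel that stops every carry.
      obtain ⟨c, hc, hcmin⟩ := (P.filter (p < ·)).exists_min_image id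
        ⟨l, Finset.mem_filter.2 ⟨hl, hpl⟩⟩
      rw [Finset.mem_filter] at hc
      have hcl : c ≤ l := hcmin l (Finset.mem_filter.2 ⟨hl, hpl⟩)
      obtain ⟨q, hq⟩ := bitSum_split (hnotM c hc.1)
      set ml := bitSum (M.filter (· < c)) with hml
      have hmllt : ml < 2 ^ c := bitSum_lt fun j hj => (Finset.mem_filter.1 hj).2
      -- All positions from `p` up to `c - 1` belong to `M`, so adding `2 ^ p` overflows into
      -- position `c`.
      have hmlge : 2 ^ c ≤ ml + 2 ^ p := by
        have h1 : Finset.range c ⊆ Finset.range p ∪ M.filter (· < c) := by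
          intro j hj
          rw [Finset.mem_range] at hj
          rw [Finset.mem_union, Finset.mem_range, Finset.mem_filter, hM, Finset.mem_sdiff,
            Finset.mem_range]
          by_cases hjp : j < p
          · exact Or.inl hjp
          · refine Or.inr ⟨⟨by omega, fun hjP => ?_⟩, hj⟩
            have hjne : j ≠ p := fun h => hpP (h ▸ hjP)
            have := hcmin j (Finset.mem_filter.2 ⟨hjP, by omega⟩)
            simp only [id] at this
            omega
        have h2 : bitSum (Finset.range p ∪ M.filter (· < c)) ≤ bitSum (Finset.range p) + ml :=
          Finset.sum_union_inter (s₁ := Finset.range p) (s₂ := M.filter (· < c)) (f := (2 ^ ·)) ▸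
            Nat.le_add_right _ _
        have h3 := bitSum_mono h1
        have h4 := bitSum_range c
        have h5 := bitSum_range p
        omega
      have hpc : 2 ^ (p + 1) ≤ 2 ^ c := Nat.pow_le_pow_right two_pos hc.2
      have h2c : 2 ^ (c + 1) = 2 * 2 ^ c := by rw [pow_succ]; ring
      have hbit : (z1 + bitSum M).testBit c = true := by
        rw [hq, show z1 + (2 ^ (c + 1) * q + ml) = 2 ^ (c + 1) * q + (z1 + ml) by ring,
          Nat.testBit_two_pow_mul_add _ (by omega), if_pos (by omega)]
        exact Nat.testBit_of_two_pow_le_and_two_pow_add_one_gt (by omega) (by omega)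
      have hφ : φ b < φ c := hs.mono hb hc.1 (by omega)
      have h1 : (levelWord sk (bitSum M) z).testBit (φ c - 1) = true := by
        rw [levelWord, Nat.testBit_or, Nat.testBit_shiftRight, ← hz1,
          show 1 + (φ c - 1) = φ c by omega, hs.bit _ c hc.1, hbit, Bool.or_true]
      exact (Nat.pow_le_pow_right two_pos (by omega)).trans (Nat.ge_two_pow_of_testBit h1)
  · intro hzb
    apply Nat.lt_pow_two_of_testBit
    intro j hj
    rw [levelWord, Nat.testBit_or, Nat.testBit_shiftRight, ← hz1, Bool.or_eq_false_iff]
    constructor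
    · by_contra h
      rw [Bool.not_eq_false] at h
      obtain ⟨c, hc, rfl⟩ := hs.only _ _ h
      rw [hs.bit z c hc] at h
      have h1 := Nat.ge_two_pow_of_testBit h
      have h2 : c < b := (Nat.pow_lt_pow_iff_right (by norm_num)).1 (h1.trans_lt hzb)
      have := hs.mono hc hb h2
      omega
    · by_contra h
      rw [Bool.not_eq_false] at h
      obtain ⟨c, hc, hcj⟩ := hs.only _ _ h
      rw [← hcj, hs.bit _ c hc] at h
      have hbc : b < c := (hs.mono.lt_iff_lt hb hc).1 (by omega)
      obtain ⟨q, hq⟩ := bitSum_split (hnotM c hc)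
      set ml := bitSum (M.filter (· < c)) with hml
      -- Position `b` is missing from `M`, so an addend below `2 ^ b` cannot push a carry past `b`
      -- into `c`.
      have hins : ml + 2 ^ b < 2 ^ c := by
        have h1 : bitSum (insert b (M.filter (· < c))) = 2 ^ b + ml :=
          Finset.sum_insert fun h => hnotM b hb (Finset.mem_filter.1 h).1
        have h2 : bitSum (insert b (M.filter (· < c))) < 2 ^ c := by
          refine bitSum_lt fun j hj => ?_
          rcases Finset.mem_insert.1 hj with rfl | hj
          · exact hbc
          · exact (Finset.mem_filter.1 hj).2
        omega
      have h2c : 2 ^ (c + 1) = 2 * 2 ^ c := by rw [pow_succ]; ring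
      rw [hq, show z1 + (2 ^ (c + 1) * q + ml) = 2 ^ (c + 1) * q + (z1 + ml) by ring,
        Nat.testBit_two_pow_mul_add _ (by omega), if_pos (by omega),
        Nat.testBit_lt_two_pow (by omega)] at h
      exact absurd h (by simp)

/-! ## Fusion nodes: constant time rank among few keys -/

/-- The index of the largest of the keys `y 0, …, y (cnt - 1)` that is at most `x`. -/
def IsPredIndex (cnt : ℕ) (y : ℕ → ℕ) (x i : ℕ) : Prop :=
  i < cnt ∧ y i ≤ x ∧ ∀ j < cnt, y j ≤ x → j ≤ i

theorem exists_isPredIndex {cnt : ℕ} {y : ℕ → ℕ} {x : ℕ} (h0 : 0 < cnt) (hx : y 0 ≤ x) :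
    ∃ i, IsPredIndex cnt y x i := by
  obtain ⟨i, hi, himax⟩ := ((Finset.range cnt).filter fun j => y j ≤ x).exists_max_image id
    ⟨0, Finset.mem_filter.2 ⟨Finset.mem_range.2 h0, hx⟩⟩
  rw [Finset.mem_filter, Finset.mem_range] at hi
  exact ⟨i, hi.1, hi.2, fun j hj hjx => himax j
    (Finset.mem_filter.2 ⟨Finset.mem_range.2 hj, hjx⟩)⟩

/-- The sketch of `v` in the fusion node with constants `c`. -/
def nodeSketch (c : ℕ → ℕ) (v : ℕ) : ℕ := sketch (c 0) (c 1) (c 2) (c 3) v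

/-- The number of keys whose sketch is smaller than that of `x`. -/
def nodeRank (c : ℕ → ℕ) (x : ℕ) : ℕ :=
  c 11 - fieldCount (c 6) (c 7) (c 4) (c 5) (nodeSketch c x)

/-- The index of the first key whose sketch is not smaller than that of `x`. -/
def nodeUpper (c : ℕ → ℕ) (x : ℕ) : ℕ :=
  if nodeRank c x < c 11 then nodeRank c x else c 11 - 1

/-- The index of the last key whose sketch is smaller than that of `x`. -/
def nodeLower (c : ℕ → ℕ) (x : ℕ) : ℕ :=
  if 0 < nodeRank c x then nodeRank c x - 1 else 0

/-- The index of a key that has a longest common prefix with `x`. -/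
def nodeCand (c y : ℕ → ℕ) (x : ℕ) : ℕ :=
  if x ^^^ y (nodeLower c x) < x ^^^ y (nodeUpper c x) then nodeLower c x else nodeUpper c x

/-- The number of branching positions above the highest digit of `z`. -/
def nodeLevel (c : ℕ → ℕ) (z : ℕ) : ℕ :=
  fieldCount (c 8) (c 9) (c 4) (c 5) (levelWord (nodeSketch c) (c 10) z)

/-- The entry of the table of the node for candidate `i` and level `j`. -/
def nodeEntry (c : ℕ → ℕ) (T i j : ℕ) : ℕ := (T >>> (c 13 * (i * c 12 + j))) % c 14

/-- The index of the predecessor of `x` among the keys `y` of the fusion node with constants `c`. -/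
def nodeIndex (c y : ℕ → ℕ) (x : ℕ) : ℕ :=
  nodeEntry c (if x < y (nodeCand c y x) then c 15 else c 16) (nodeCand c y x)
    (nodeLevel c (x ^^^ y (nodeCand c y x)))

/-- Bounds for the constants of a fusion node that prevent overflows in words of `w` bits. -/
structure NodeBounds (w : ℕ) (c : ℕ → ℕ) : Prop where
  lt : ∀ i, c i < 2 ^ w
  pos : 0 < c 1
  prod : c 1 * c 2 < 2 ^ w
  sketch_lt : c 3 < 2 ^ c 4
  keys : 2 ^ c 4 * c 7 ≤ c 6
  levels : 2 ^ c 4 * c 9 ≤ c 8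
  gap : c 10 + c 10 < 2 ^ w
  cnt_pos : 0 < c 11
  rows : c 11 * c 12 < 2 ^ w
  table : c 13 * (c 11 * c 12) < 2 ^ w

/-- By `huniq` the predecessor index depends on `x` only through the pair of candidate and level.
Hence the indices fit in one word with a field of `e` bits for each pair. -/
theorem exists_nodeTable {cnt W e : ℕ} {A : ℕ → Prop} {cand level : ℕ → ℕ} {y : ℕ → ℕ}
    (hcnt : cnt < 2 ^ e)
    (hc : ∀ x, A x → cand x < cnt) (hl : ∀ x, A x → level x < W)
    (huniq : ∀ x x', A x → A x' → cand x = cand x' → level x = level x' →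
      ∀ i < cnt, y i ≤ x → y i ≤ x') :
    ∃ T < 2 ^ (e * (cnt * W)), ∀ x i, A x → IsPredIndex cnt y x i →
      (T >>> (e * (cand x * W + level x))) % 2 ^ e = i := by
  classical
  set R : ℕ → ℕ → Prop := fun a i => ∃ x, A x ∧ a = cand x * W + level x ∧ IsPredIndex cnt y x i
    with hR
  set f : ℕ → ℕ := fun a => if h : ∃ i, R a i then h.choose else 0 with hf
  have hRuniq : ∀ a i j, R a i → R a j → i = j := by
    rintro a i j ⟨x, hx, rfl, hi⟩ ⟨x', hx', heq, hj⟩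
    have h1 := hl x hx
    have h2 := hl x' hx'
    have hW : 0 < W := by omega
    have hcand : cand x = cand x' := by
      have := congrArg (· / W) heq
      simpa [Nat.add_div_of_dvd_right, Nat.mul_comm _ W, Nat.mul_add_div hW,
        Nat.div_eq_of_lt h1, Nat.div_eq_of_lt h2] using this
    have hlev : level x = level x' := by rw [hcand] at heq; omega
    exact le_antisymm (hj.2.2 i hi.1 (huniq x x' hx hx' hcand hlev i hi.1 hi.2.1))
      (hi.2.2 j hj.1 (huniq x' x hx' hx hcand.symm hlev.symm j hj.1 hj.2.1))
  have hflt : ∀ a < cnt * W, f a < 2 ^ e := by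
    intro a _
    simp only [hf]
    split_ifs with h
    · obtain ⟨x, -, -, hi⟩ := h.choose_spec
      exact hi.1.trans hcnt
    · positivity
  refine ⟨packWord e (cnt * W) f, packWord_lt hflt, fun x i hx hi => ?_⟩
  have ha : cand x * W + level x < cnt * W := by
    have h1 := hc x hx
    have h2 := hl x hx
    nlinarith [Nat.mul_le_mul_right W h1]
  rw [Nat.shiftRight_eq_div_pow, packWord_div_mod hflt ha]
  have hex : ∃ i, R (cand x * W + level x) i := ⟨i, x, hx, rfl, hi⟩
  simp only [hf]
  rw [dif_pos hex]
  exact hRuniq _ _ _ hex.choose_spec ⟨x, hx, rfl, hi⟩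

/-- The number of bits of the words of a fusion node with at most `k` keys of `l ≤ s ^ 2` bits. -/
def nodeBits (k l s : ℕ) : ℕ :=
  l + 2 + (sketchBits (k * k + 1) s + 1) * (k * k + 2) + k * (k * (k * k + 2))

/-- Only the at most `k * k` positions where two keys branch matter. A sketch of these positions
yields a key with longest common prefix (`maxPrefix_of_candidates`). The side of this key on which
`x` lies and the number of branching positions above the first difference then fix the predecessor
(`le_of_same_branch`), so it can be tabulated. -/
theorem exists_nodeConsts {k l s w cnt : ℕ} {y : ℕ → ℕ} (hcnt : 0 < cnt) (hck : cnt ≤ k)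
    (hy : ∀ i j, i < j → j < cnt → y i < y j) (hyl : ∀ i < cnt, y i < 2 ^ l) (hl : l ≤ s * s)
    (hw : nodeBits k l s ≤ w) :
    ∃ c : ℕ → ℕ, NodeBounds w c ∧ c 11 = cnt ∧ ∀ x < 2 ^ l,
      fieldCount (c 6) (c 7) (c 4) (c 5) (nodeSketch c x) ≤ cnt ∧
      nodeLevel c (x ^^^ y (nodeCand c y x)) < c 12 ∧
      (y 0 ≤ x → IsPredIndex cnt y x (nodeIndex c y x)) := by
  set F := k * k + 1 with hF
  set L := sketchBits F s with hL
  have hF0 : 0 < F := by omega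
  have hFL : F ≤ L := Nat.le_mul_of_pos_right F (by omega)
  have hk : 0 < k := by omega
  have hkF : k ≤ F := by nlinarith
  have hwl : l + 2 ≤ w := by
    rw [nodeBits] at hw; omega
  have hwF : (L + 1) * (F + 1) ≤ w := by
    rw [nodeBits, ← hF, ← hL] at hw
    rw [show F + 1 = k * k + 2 by omega]; omega
  have hwT : k * (k * (F + 1)) ≤ w := by
    rw [nodeBits] at hw
    rw [show F + 1 = k * k + 2 by omega]; omega
  have hwL : (L + 1) * F ≤ w := le_trans (Nat.mul_le_mul_left _ (by omega)) hwF
  have hwL1 : L + 1 ≤ w := le_trans (Nat.le_mul_of_pos_right _ hF0) hwL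
  have hw2L : 2 * L ≤ w := by nlinarith
  have pow_le : ∀ {a}, a ≤ w → 2 ^ a ≤ 2 ^ w := fun h => Nat.pow_le_pow_right two_pos h
  have lt_pow : ∀ {a}, a ≤ w → a < 2 ^ w := fun h => h.trans_lt Nat.lt_two_pow_self
  -- Index `k * i + j` stands for the pair of keys `i`, `j`. Unused indices, among them `k * k`, get
  -- the value `l`, which supplies the sentinel for `levelWord_lt_iff`.
  set en : ℕ → ℕ := fun i => if i / k < cnt ∧ i % k < cnt ∧ y (i / k) ≠ y (i % k) then
    branchBit (y (i / k)) (y (i % k)) else l with hen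
  set P := (Finset.range F).image en with hP
  have henP : ∀ i < F, en i ∈ P := fun i hi =>
    Finset.mem_image_of_mem _ (Finset.mem_range.2 hi)
  have henP' : ∀ b ∈ P, ∃ i < F, en i = b := fun b hb => by
    obtain ⟨i, hi, h⟩ := Finset.mem_image.1 hb
    exact ⟨i, Finset.mem_range.1 hi, h⟩
  have hPl : ∀ b ∈ P, b ≤ l := by
    intro b hb
    obtain ⟨i, -, rfl⟩ := henP' b hb
    simp only [hen]
    split_ifs with h
    · refine le_of_lt ((Nat.log2_lt (by simpa [Nat.xor_eq_zero_iff] using h.2.2)).2 ?_)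
      exact Nat.xor_lt_two_pow (hyl _ h.1) (hyl _ h.2.1)
    · exact le_refl l
  have hlP : l ∈ P := by
    have := henP (k * k) (by omega)
    simp only [hen] at this
    rwa [if_neg] at this
    rintro ⟨h, -⟩
    rw [Nat.mul_div_cancel _ hk] at h
    omega
  have hbranch : BranchesIn P cnt y := by
    intro i hi j hj hij
    have hjk : j < k := by omega
    have := henP (k * i + j) (by nlinarith)
    simp only [hen] at this
    rwa [Nat.mul_add_div hk, Nat.div_eq_of_lt hjk, add_zero, Nat.mul_add_mod,
      Nat.mod_eq_of_lt hjk, if_pos ⟨hi, hj, hij⟩] at this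
  have hPF : P.card ≤ F := Finset.card_image_le.trans (by simp)
  obtain ⟨mask, E, copies, mask', φ, hmask, hE0, hE, hEc, hmask', hφ, hφmono, hbits⟩ :=
    exists_sketch hPl hPF hF0 hl
  rw [← hL] at hE hEc hmask' hφ
  set sk := sketch mask E copies mask' with hsk
  have hs : IsSketch P φ sk := ⟨hφmono, fun v => (hbits v).1, fun v => (hbits v).2⟩
  have hskL : ∀ v, sk v < 2 ^ L := fun v => lt_of_le_of_lt Nat.and_le_right hmask'
  have hLL : 2 ^ (L + 1) = 2 ^ L + 2 ^ L := by rw [pow_succ]; ring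
  have hone : 1 ≤ 2 ^ L := Nat.one_le_two_pow
  set m := bitSum (Finset.range l \ P) with hm
  have hml : m < 2 ^ l := bitSum_lt fun b hb =>
    Finset.mem_range.1 (Finset.mem_sdiff.1 hb).1
  set keyW := packWord (L + 1) cnt fun i => 2 ^ L + sk (y i) with hkeyW
  set keyC := packWord (L + 1) cnt fun _ => 1 with hkeyC
  set levW := packWord (L + 1) F fun i => 2 ^ L + (2 ^ φ (en i) - 1) with hlevW
  set levC := packWord (L + 1) F fun _ => 1 with hlevC
  set cnt1 : ℕ → ℕ := fun x => fieldCount keyW keyC L (2 ^ (L + 1) - 1) (sk x) with hcnt1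
  set lev : ℕ → ℕ := fun z => fieldCount levW levC L (2 ^ (L + 1) - 1) (levelWord sk m z) with hlev
  set rk : ℕ → ℕ := fun x => cnt - cnt1 x with hrk
  set up : ℕ → ℕ := fun x => if rk x < cnt then rk x else cnt - 1 with hup
  set lo : ℕ → ℕ := fun x => if 0 < rk x then rk x - 1 else 0 with hlo
  set cand : ℕ → ℕ := fun x => if x ^^^ y (lo x) < x ^^^ y (up x) then lo x else up x with hcand
  have hkey : ∀ x, cnt1 x = ((Finset.range cnt).filter fun i => sk x ≤ sk (y i)).card := fun x =>
    fieldCount_eq (fun i _ => hskL (y i)) (by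
      have := Nat.lt_two_pow_self (n := L); omega) (hskL x)
  have hfieldlt : ∀ i < F, 2 ^ φ (en i) - 1 < 2 ^ L := fun i hi => by
    have h1 := Nat.pow_le_pow_right two_pos (hφ _ (henP i hi)).le
    have h2 := Nat.one_le_two_pow (n := φ (en i))
    omega
  have hlevlt : ∀ z, levelWord sk m z < 2 ^ L := fun z =>
    Nat.or_lt_two_pow (hskL _) ((Nat.shiftRight_le _ _).trans_lt (hskL _))
  have hlevel : ∀ z < 2 ^ l,
      lev z = ((Finset.range F).filter fun i => z < 2 ^ en i).card := by
    intro z hz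
    have h1 : lev z = ((Finset.range F).filter fun i => levelWord sk m z ≤ 2 ^ φ (en i) - 1).card :=
      fieldCount_eq hfieldlt (by have := Nat.lt_two_pow_self (n := L); omega) (hlevlt z)
    rw [h1]
    congr 1
    refine Finset.filter_congr fun i hi => ?_
    rw [← levelWord_lt_iff hs hlP hz (henP i (Finset.mem_range.1 hi))]
    exact Nat.le_sub_one_iff_lt (Nat.two_pow_pos _)
  have hlevF : ∀ z < 2 ^ l, lev z < F + 1 := fun z hz => by
    rw [hlevel z hz]
    exact Nat.lt_succ_of_le ((Finset.card_filter_le _ _).trans (by simp))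
  have hmono : ∀ i j, i < j → j < cnt → sk (y i) ≤ sk (y j) := fun i j hij hj =>
    (hs.lt_of_lt (hy i j hij hj) (hbranch i (by omega) j hj (hy i j hij hj).ne)).le
  have hcandlt : ∀ x, cand x < cnt := by
    intro x
    have h1 : rk x ≤ cnt := Nat.sub_le _ _
    simp only [hcand, hup, hlo]
    split_ifs <;> omega
  have hmax : ∀ x, MaxPrefix cnt y x (cand x) := by
    intro x
    refine maxPrefix_of_candidates hs hbranch (u := rk x) (fun i hi => ?_) hmono
      (Nat.sub_le _ _) (fun h => if_pos h) (fun h => if_pos h)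
    simp only [hrk, hkey]
    exact sub_card_le_iff hmono hi
  have hcnt2 : cnt < 2 ^ k := hck.trans_lt Nat.lt_two_pow_self
  have hxor : ∀ x < 2 ^ l, ∀ i < cnt, x ^^^ y i < 2 ^ l := fun x hx i hi =>
    Nat.xor_lt_two_pow hx (hyl i hi)
  -- One table for each outcome of the comparison of `x` with the candidate key.
  have htab : ∀ b : Prop, ∃ T < 2 ^ (k * (cnt * (F + 1))), ∀ x i,
      (x < 2 ^ l ∧ (x < y (cand x) ↔ b)) → IsPredIndex cnt y x i →
        (T >>> (k * (cand x * (F + 1) + lev (x ^^^ y (cand x))))) % 2 ^ k = i := by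
    intro b
    refine exists_nodeTable (A := fun x => x < 2 ^ l ∧ (x < y (cand x) ↔ b)) (cand := cand)
      (level := fun x => lev (x ^^^ y (cand x))) hcnt2 (fun x _ => hcandlt x)
      (fun x hx => hlevF _ (hxor x hx.1 _ (hcandlt x))) ?_
    intro x x' hx hx' hcc hll i hi hle
    have h1 := hmax x
    have h2 := hmax x'
    rw [← hcc] at h2
    rw [hlevel _ (hxor x hx.1 _ (hcandlt x)), hlevel _ (hxor x' hx'.1 _ (hcandlt x')), ← hcc] at hll
    exact le_of_same_branch hbranch henP' (hcandlt x) h1 h2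
      (hx.2.trans (by rw [hcc]; exact hx'.2.symm)) hll hi hle
  obtain ⟨T0, hT0, htab0⟩ := htab True
  obtain ⟨T1, hT1, htab1⟩ := htab False
  have hTw : k * (cnt * (F + 1)) ≤ w :=
    le_trans (Nat.mul_le_mul_left _ (Nat.mul_le_mul_right _ hck)) hwT
  have hkeyWlt : keyW < 2 ^ w := by
    refine (packWord_lt fun i _ => ?_).trans_le
      (pow_le ((Nat.mul_le_mul_left (L + 1) (hck.trans hkF)).trans hwL))
    have := hskL (y i); omega
  have hlevWlt : levW < 2 ^ w := by
    refine (packWord_lt fun i hi => ?_).trans_le (pow_le hwL)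
    have := hfieldlt i hi; omega
  have hkeys : 2 ^ L * keyC ≤ keyW := by
    rw [hkeyC, mul_packWord]
    exact packWord_le_packWord fun i _ => by omega
  have hlevs : 2 ^ L * levC ≤ levW := by
    rw [hlevC, mul_packWord]
    exact packWord_le_packWord fun i _ => by omega
  -- The order is the one in which `nodeSketch`, `nodeRank`, `nodeLevel` and `nodeIndex` read the
  -- constants, so that the identifications below hold by `rfl`.
  set c : ℕ → ℕ := fun i => [mask, E, copies, mask', L, 2 ^ (L + 1) - 1, keyW, keyC, levW, levC, m,
    cnt, F + 1, k, 2 ^ k, T0, T1].getD i 0 with hc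
  have hskc : nodeSketch c = sk := rfl
  have hcandc : nodeCand c y = cand := rfl
  have hlevc : nodeLevel c = lev := rfl
  have hkw : k < w := by nlinarith
  refine ⟨c, ⟨?_, hE0, ?_, hmask', hkeys, hlevs, ?_, hcnt, ?_, ?_⟩, rfl, ?_⟩
  · have hkeyClt : keyC < 2 ^ w := lt_of_le_of_lt (le_trans (Nat.le_mul_of_pos_left _ hone) hkeys)
      hkeyWlt
    have hlevClt : levC < 2 ^ w := lt_of_le_of_lt (le_trans (Nat.le_mul_of_pos_left _ hone) hlevs)
      hlevWlt
    have hcop : copies < 2 ^ w := lt_of_le_of_lt (Nat.le_mul_of_pos_left _ hE0)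
      (hEc.trans_le (pow_le hw2L))
    have hall : ∀ v ∈ [mask, E, copies, mask', L, 2 ^ (L + 1) - 1, keyW, keyC, levW, levC, m,
        cnt, F + 1, k, 2 ^ k, T0, T1], v < 2 ^ w := by
      simp only [List.forall_mem_cons]
      refine ⟨hmask.trans_le (pow_le (by omega)), hE.trans_le (pow_le (by omega)), hcop,
        hmask'.trans_le (pow_le (by omega)), lt_pow (by omega), ?_, hkeyWlt, hkeyClt, hlevWlt,
        hlevClt, hml.trans_le (pow_le (by omega)), lt_pow (by omega), lt_pow (by omega),
        lt_pow hkw.le, Nat.pow_lt_pow_right (by norm_num) hkw, hT0.trans_le (pow_le hTw),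
        hT1.trans_le (pow_le hTw), by simp⟩
      have := pow_le hwL1
      have := Nat.one_le_two_pow (n := L + 1)
      omega
    intro i
    simp only [hc]
    rw [List.getD_eq_getElem?_getD]
    rcases h : ([mask, E, copies, mask', L, 2 ^ (L + 1) - 1, keyW, keyC, levW, levC, m,
        cnt, F + 1, k, 2 ^ k, T0, T1][i]?) with _ | v
    · exact Nat.two_pow_pos w
    · exact hall v (List.mem_of_getElem? h)
  · exact hEc.trans_le (pow_le hw2L)
  · change m + m < 2 ^ w
    have h1 : 2 ^ (l + 1) = 2 ^ l + 2 ^ l := by rw [pow_succ]; ring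
    have h2 := pow_le (show l + 1 ≤ w by omega)
    omega
  · exact lt_pow (le_trans (Nat.le_mul_of_pos_left _ hk) hTw)
  · exact lt_pow hTw
  · intro x hx
    rw [hcandc, hlevc]
    refine ⟨?_, hlevF _ (hxor x hx _ (hcandlt x)), fun h0 => ?_⟩
    · change cnt1 x ≤ cnt
      rw [hkey]
      exact (Finset.card_filter_le _ _).trans (by simp)
    obtain ⟨i, hi⟩ := exists_isPredIndex hcnt h0
    have : nodeIndex c y x = i := by
      rw [nodeIndex, hcandc, hlevc]
      by_cases hxc : x < y (cand x)
      · rw [if_pos hxc]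
        exact htab0 x i ⟨hx, by simp [hxc]⟩ hi
      · rw [if_neg hxc]
        exact htab1 x i ⟨hx, by simp [hxc]⟩ hi
    rwa [this]

/-! ## Expressions -/

/-- Expressions, evaluated by word RAM programs without loops and without writing to the memory. -/
inductive RamExpr where
  | var (i : ℕ)
  | const (c : ℕ)
  | op (o : RamOp) (a b : RamExpr)
  | load (a : RamExpr)
  /-- if `a < b` then `p` else `q` -/
  | ifLt (a b p q : RamExpr)

namespace RamExpr

/-- The program that evaluates an expression into register `d`, using registers `d, d + 1, …`. -/
def compile : RamExpr → ℕ → RamProg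
  | var i, d => .copy d i
  | const c, d => .const d c
  | op o a b, d => .seq (a.compile d) (.seq (b.compile (d + 1)) (.op o d d (d + 1)))
  | load a, d => .seq (a.compile d) (.load d d)
  | ifLt a b p q, d => .seq (a.compile d) (.seq (b.compile (d + 1))
      (.ite (.lt d (d + 1)) (p.compile d) (q.compile d)))

/-- A bound for the number of steps of the evaluation of an expression. -/
def cost : RamExpr → ℕ
  | var _ => 1
  | const _ => 1
  | op _ a b => a.cost + (b.cost + 1)
  | load a => a.cost + 1
  | ifLt a b p q => a.cost + (b.cost + (p.cost + q.cost + 1))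

/-- `Ev w S V r M e v`: for memory contents `M` and variables `r 0, …, r (V - 1)`, the expression
`e` evaluates to `v` without accessing memory cells outside `0, …, S - 1`. -/
inductive Ev (w S V : ℕ) (r M : ℕ → ℕ) : RamExpr → ℕ → Prop
  | var {i : ℕ} (h : i < V) : Ev w S V r M (var i) (r i)
  | const {c : ℕ} (h : c < 2 ^ w) : Ev w S V r M (const c) c
  | op {o : RamOp} {a b : RamExpr} {x y : ℕ} (ha : Ev w S V r M a x) (hb : Ev w S V r M b y) :
      Ev w S V r M (op o a b) (o.eval w x y)
  | load {a : RamExpr} {x : ℕ} (ha : Ev w S V r M a x) (h : x < S) : Ev w S V r M (load a) (M x)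
  | ifLt_true {a b p q : RamExpr} {x y v : ℕ} (ha : Ev w S V r M a x) (hb : Ev w S V r M b y)
      (h : x < y) (hp : Ev w S V r M p v) : Ev w S V r M (ifLt a b p q) v
  | ifLt_false {a b p q : RamExpr} {x y v : ℕ} (ha : Ev w S V r M a x) (hb : Ev w S V r M b y)
      (h : ¬ x < y) (hq : Ev w S V r M q v) : Ev w S V r M (ifLt a b p q) v

/-- Registers below `d` survive. Hence the first operand, held in `d`, is not lost while the second
is computed in `d + 1`, and the variables stay intact. -/
theorem exec_compile {w S V : ℕ} {r M : ℕ → ℕ} {e : RamExpr} {v : ℕ} (h : Ev w S V r M e v)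
    (d : ℕ) (hd : V ≤ d) (reg : ℕ → ℕ) (hr : ∀ i < V, reg i = r i) :
    ∃ k ≤ e.cost, ∃ reg', RamExec w S (e.compile d) ⟨reg, M⟩ k ⟨reg', M⟩ ∧ reg' d = v ∧
      ∀ i < d, reg' i = reg i := by
  induction h generalizing d reg with
  | var hi =>
    exact ⟨1, le_rfl, _, RamExec.copy _ _ _, by simp [hr _ hi], fun i hi => by
      simp [Function.update_of_ne hi.ne]⟩
  | const hc =>
    exact ⟨1, le_rfl, _, RamExec.const _ _ _, by simp [Nat.mod_eq_of_lt hc], fun i hi => by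
      simp [Function.update_of_ne hi.ne]⟩
  | op ha hb iha ihb =>
    obtain ⟨k1, hk1, r1, e1, v1, p1⟩ := iha d hd reg hr
    obtain ⟨k2, hk2, r2, e2, v2, p2⟩ := ihb (d + 1) (by omega) r1
      fun i hi => (p1 i (by omega)).trans (hr i hi)
    refine ⟨k1 + (k2 + 1), by rw [cost]; omega, _,
      RamExec.seq _ _ _ _ _ _ _ e1 (RamExec.seq _ _ _ _ _ _ _ e2 (RamExec.op _ _ _ _ _)), ?_, ?_⟩
    · simp [v2, p2 d (by omega), v1]
    · intro i hi
      simp [Function.update_of_ne hi.ne, p2 i (by omega), p1 i hi]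
  | load ha hx iha =>
    obtain ⟨k1, hk1, r1, e1, v1, p1⟩ := iha d hd reg hr
    refine ⟨k1 + 1, by rw [cost]; omega, _, RamExec.seq _ _ _ _ _ _ _ e1
      (RamExec.load _ _ _ (v1.trans_lt hx)), ?_, ?_⟩
    · simp [v1]
    · intro i hi
      simp [Function.update_of_ne hi.ne, p1 i hi]
  | ifLt_true ha hb hxy hp iha ihb ihp =>
    obtain ⟨k1, hk1, r1, e1, v1, p1⟩ := iha d hd reg hr
    obtain ⟨k2, hk2, r2, e2, v2, p2⟩ := ihb (d + 1) (by omega) r1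
      fun i hi => (p1 i (by omega)).trans (hr i hi)
    have pr : ∀ i < d, r2 i = reg i := fun i hi => (p2 i (by omega)).trans (p1 i hi)
    obtain ⟨k3, hk3, r3, e3, v3, p3⟩ := ihp d hd r2 fun i hi => (pr i (by omega)).trans (hr i hi)
    refine ⟨k1 + (k2 + (k3 + 1)), by rw [cost]; omega, r3,
      RamExec.seq _ _ _ _ _ _ _ e1 (RamExec.seq _ _ _ _ _ _ _ e2
        (RamExec.ite_true _ _ _ _ _ _ ?_ e3)), v3, fun i hi => (p3 i hi).trans (pr i hi)⟩
    simp only [RamTest.Holds]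
    rw [v2, p2 d (by omega), v1]
    exact hxy
  | ifLt_false ha hb hxy hq iha ihb ihq =>
    obtain ⟨k1, hk1, r1, e1, v1, p1⟩ := iha d hd reg hr
    obtain ⟨k2, hk2, r2, e2, v2, p2⟩ := ihb (d + 1) (by omega) r1
      fun i hi => (p1 i (by omega)).trans (hr i hi)
    have pr : ∀ i < d, r2 i = reg i := fun i hi => (p2 i (by omega)).trans (p1 i hi)
    obtain ⟨k3, hk3, r3, e3, v3, p3⟩ := ihq d hd r2 fun i hi => (pr i (by omega)).trans (hr i hi)
    refine ⟨k1 + (k2 + (k3 + 1)), by rw [cost]; omega, r3,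
      RamExec.seq _ _ _ _ _ _ _ e1 (RamExec.seq _ _ _ _ _ _ _ e2
        (RamExec.ite_false _ _ _ _ _ _ ?_ e3)), v3, fun i hi => (p3 i hi).trans (pr i hi)⟩
    simp only [RamTest.Holds]
    rw [v2, p2 d (by omega), v1]
    exact hxy

namespace Ev

variable {w S V : ℕ} {r M : ℕ → ℕ} {a b p q : RamExpr} {x y v : ℕ}

theorem cast (h : Ev w S V r M a x) (hx : x = y) : Ev w S V r M a y := hx ▸ h

theorem add (ha : Ev w S V r M a x) (hb : Ev w S V r M b y) (h : x + y < 2 ^ w) :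
    Ev w S V r M (.op .add a b) (x + y) :=
  (op ha hb).cast (Nat.mod_eq_of_lt h)

theorem mul (ha : Ev w S V r M a x) (hb : Ev w S V r M b y) (h : x * y < 2 ^ w) :
    Ev w S V r M (.op .mul a b) (x * y) :=
  (op ha hb).cast (Nat.mod_eq_of_lt h)

theorem sub (ha : Ev w S V r M a x) (hb : Ev w S V r M b y) (h : y ≤ x) (hx : x < 2 ^ w) :
    Ev w S V r M (.op .sub a b) (x - y) :=
  (op ha hb).cast (by
    change (x + 2 ^ w - y) % 2 ^ w = x - y
    rw [show x + 2 ^ w - y = (x - y) + 2 ^ w by omega, Nat.add_mod_right]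
    exact Nat.mod_eq_of_lt (by omega))

theorem shl (ha : Ev w S V r M a x) (hb : Ev w S V r M b y) (h : x * 2 ^ y < 2 ^ w) :
    Ev w S V r M (.op .shl a b) (x * 2 ^ y) :=
  (op ha hb).cast (by
    change (x <<< y) % 2 ^ w = x * 2 ^ y
    rw [Nat.shiftLeft_eq]
    exact Nat.mod_eq_of_lt h)

theorem and (ha : Ev w S V r M a x) (hb : Ev w S V r M b y) :
    Ev w S V r M (.op .and a b) (x &&& y) := op ha hb

theorem or (ha : Ev w S V r M a x) (hb : Ev w S V r M b y) :
    Ev w S V r M (.op .or a b) (x ||| y) := op ha hb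

theorem xor (ha : Ev w S V r M a x) (hb : Ev w S V r M b y) :
    Ev w S V r M (.op .xor a b) (x ^^^ y) := op ha hb

theorem shr (ha : Ev w S V r M a x) (hb : Ev w S V r M b y) :
    Ev w S V r M (.op .shr a b) (x >>> y) := op ha hb

theorem mod (ha : Ev w S V r M a x) (hb : Ev w S V r M b y) :
    Ev w S V r M (.op .mod a b) (x % y) := op ha hb

theorem ite {u v' : ℕ} (ha : Ev w S V r M a x) (hb : Ev w S V r M b y)
    (hp : x < y → Ev w S V r M p u) (hq : ¬ x < y → Ev w S V r M q v') :
    Ev w S V r M (.ifLt a b p q) (if x < y then u else v') := by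
  split_ifs with h
  · exact ifLt_true ha hb h (hp h)
  · exact ifLt_false ha hb h (hq h)

end Ev

end RamExpr

/-! ## Running programs with `V` variables and scratch registers from `V` on -/

/-- Started with variables `r 0, …, r (V - 1)` and memory `M`, the program halts within `T` steps
with variables and memory that satisfy `Q`. -/
def RunsWithin (w S V : ℕ) (p : RamProg) (r M : ℕ → ℕ) (T : ℕ)
    (Q : (ℕ → ℕ) → (ℕ → ℕ) → Prop) : Prop :=
  ∀ reg : ℕ → ℕ, (∀ i < V, reg i = r i) → ∃ k ≤ T, ∃ reg' M' r' : ℕ → ℕ,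
    RamExec w S p ⟨reg, M⟩ k ⟨reg', M'⟩ ∧ (∀ i < V, reg' i = r' i) ∧ Q r' M'

/-- Assign the value of an expression to a variable, using registers from `V` on. -/
def RamProg.assign (V d : ℕ) (e : RamExpr) : RamProg := .seq (e.compile V) (.copy d V)

namespace RunsWithin

variable {w S V : ℕ} {p q : RamProg} {r M : ℕ → ℕ} {T T' : ℕ} {Q Q' : (ℕ → ℕ) → (ℕ → ℕ) → Prop}

theorem mono (h : RunsWithin w S V p r M T Q) (hT : T ≤ T') (hQ : ∀ r' M', Q r' M' → Q' r' M') :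
    RunsWithin w S V p r M T' Q' := by
  intro reg hr
  obtain ⟨k, hk, reg', M', r', he, hr', hq⟩ := h reg hr
  exact ⟨k, hk.trans hT, reg', M', r', he, hr', hQ _ _ hq⟩

theorem seq (hp : RunsWithin w S V p r M T Q)
    (hq : ∀ r' M', Q r' M' → RunsWithin w S V q r' M' T' Q') :
    RunsWithin w S V (.seq p q) r M (T + T') Q' := by
  intro reg hr
  obtain ⟨k, hk, reg1, M1, r1, he, hr1, h1⟩ := hp reg hr
  obtain ⟨k', hk', reg2, M2, r2, he', hr2, h2⟩ := hq r1 M1 h1 reg1 hr1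
  exact ⟨k + k', add_le_add hk hk', reg2, M2, r2, RamExec.seq _ _ _ _ _ _ _ he he', hr2, h2⟩

theorem assign {d : ℕ} {e : RamExpr} {v : ℕ} (hd : d < V) (h : RamExpr.Ev w S V r M e v)
    (hQ : Q (Function.update r d v) M) :
    RunsWithin w S V (.assign V d e) r M (e.cost + 1) Q := by
  intro reg hr
  obtain ⟨k, hk, reg', he, hv, hp⟩ := RamExpr.exec_compile h V le_rfl reg hr
  refine ⟨k + 1, by omega, _, M, _, RamExec.seq _ _ _ _ _ _ _ he (RamExec.copy _ _ _), ?_, hQ⟩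
  intro i hi
  by_cases hid : i = d
  · subst hid
    simp [hv]
  · simp [Function.update_of_ne hid, hp i hi, hr i hi]

theorem ite {i j : ℕ} (hi : i < V) (hj : j < V)
    (hp : r i < r j → RunsWithin w S V p r M T Q) (hq : ¬ r i < r j → RunsWithin w S V q r M T Q) :
    RunsWithin w S V (.ite (.lt i j) p q) r M (T + 1) Q := by
  intro reg hr
  by_cases h : r i < r j
  · obtain ⟨k, hk, reg', M', r', he, hr', hq'⟩ := hp h reg hr
    refine ⟨k + 1, by omega, reg', M', r', RamExec.ite_true _ _ _ _ _ _ ?_ he, hr', hq'⟩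
    simpa [RamTest.Holds, hr i hi, hr j hj] using h
  · obtain ⟨k, hk, reg', M', r', he, hr', hq'⟩ := hq h reg hr
    refine ⟨k + 1, by omega, reg', M', r', RamExec.ite_false _ _ _ _ _ _ ?_ he, hr', hq'⟩
    simpa [RamTest.Holds, hr i hi, hr j hj] using h

theorem skip (hQ : Q r M) : RunsWithin w S V .skip r M 1 Q :=
  fun reg hr => ⟨1, le_rfl, reg, M, r, RamExec.skip _, hr, hQ⟩

end RunsWithin

/-! ## Running a program on a part of the memory -/

/-- All registers of a program are below this number. -/
def RamProg.regBound : RamProg → ℕ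
  | .skip => 0
  | .const d _ => d + 1
  | .copy d i => max (d + 1) (i + 1)
  | .op _ d i j => max (d + 1) (max (i + 1) (j + 1))
  | .load d i => max (d + 1) (i + 1)
  | .store i j => max (i + 1) (j + 1)
  | .seq p q => max p.regBound q.regBound
  | .ite (.lt i j) p q => max (max (i + 1) (j + 1)) (max p.regBound q.regBound)
  | .ite (.eq i j) p q => max (max (i + 1) (j + 1)) (max p.regBound q.regBound)
  | .while (.lt i j) p => max (max (i + 1) (j + 1)) p.regBound
  | .while (.eq i j) p => max (max (i + 1) (j + 1)) p.regBound

/-- A test on shifted registers. -/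
def RamTest.shift (V : ℕ) : RamTest → RamTest
  | .lt i j => .lt (i + V) (j + V)
  | .eq i j => .eq (i + V) (j + V)

/-- The program `p` on registers shifted by `V`, on the part of the memory that starts at the address
in register `base`; register `tmp` is used for addresses. -/
def RamProg.relocate (V base tmp : ℕ) : RamProg → RamProg
  | .skip => .skip
  | .const d c => .const (d + V) c
  | .copy d i => .copy (d + V) (i + V)
  | .op o d i j => .op o (d + V) (i + V) (j + V)
  | .load d i => .seq (.op .add tmp (i + V) base) (.load (d + V) tmp)
  | .store i j => .seq (.op .add tmp (i + V) base) (.store tmp (j + V))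
  | .seq p q => .seq (p.relocate V base tmp) (q.relocate V base tmp)
  | .ite c p q => .ite (c.shift V) (p.relocate V base tmp) (q.relocate V base tmp)
  | .while c p => .while (c.shift V) (p.relocate V base tmp)

/-- The configuration `σ'` simulates `σ` for programs with registers below `m`, on the `S` memory
cells from address `A` on. -/
structure Simulates (V base m A S : ℕ) (σ σ' : RamState) : Prop where
  reg : ∀ i < m, σ'.reg (i + V) = σ.reg i
  base : σ'.reg base = A
  mem : ∀ i < S, σ'.mem (A + i) = σ.mem i

/-- Variables other than `tmp` and memory cells outside the given part are the same. -/
structure SameOutside (V tmp A S : ℕ) (σ σ' : RamState) : Prop where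
  reg : ∀ i < V, i ≠ tmp → σ'.reg i = σ.reg i
  mem : ∀ a, a < A ∨ A + S ≤ a → σ'.mem a = σ.mem a

theorem SameOutside.trans {V tmp A S : ℕ} {σ ρ τ : RamState} (h : SameOutside V tmp A S σ ρ)
    (h' : SameOutside V tmp A S ρ τ) : SameOutside V tmp A S σ τ :=
  ⟨fun i hi ht => (h'.reg i hi ht).trans (h.reg i hi ht), fun a ha =>
    (h'.mem a ha).trans (h.mem a ha)⟩

theorem SameOutside.refl (V tmp A S : ℕ) (σ : RamState) : SameOutside V tmp A S σ σ :=
  ⟨fun _ _ _ => rfl, fun _ _ => rfl⟩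

/-- The program `ite c p q` serves here only to bound the registers of the test. -/
theorem RamTest.holds_shift {V base m A S : ℕ} {σ σ' : RamState}
    (hs : Simulates V base m A S σ σ') {c : RamTest} {p q : RamProg}
    (hc : (RamProg.ite c p q).regBound ≤ m) : (c.shift V).Holds σ'.reg ↔ c.Holds σ.reg := by
  cases c <;>
    simp only [RamProg.regBound, max_le_iff] at hc <;>
    simp only [RamTest.shift, RamTest.Holds] <;>
    rw [hs.reg _ (by omega), hs.reg _ (by omega)]

theorem regBound_while_le {c : RamTest} {p : RamProg} {m : ℕ}
    (h : (RamProg.while c p).regBound ≤ m) : (RamProg.ite c p p).regBound ≤ m ∧ p.regBound ≤ m := by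
  cases c <;> simp only [RamProg.regBound, max_le_iff] at h ⊢ <;> omega

theorem regBound_ite_le {c : RamTest} {p q : RamProg} {m : ℕ}
    (h : (RamProg.ite c p q).regBound ≤ m) : p.regBound ≤ m ∧ q.regBound ≤ m := by
  cases c <;> simp only [RamProg.regBound, max_le_iff] at h <;> omega

theorem Simulates.update {V base m A S : ℕ} {σ σ' : RamState} (hs : Simulates V base m A S σ σ')
    (hbase : base < V) (d v : ℕ) :
    Simulates V base m A S ⟨Function.update σ.reg d v, σ.mem⟩
      ⟨Function.update σ'.reg (d + V) v, σ'.mem⟩ := by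
  refine ⟨fun i hi => ?_, ?_, hs.mem⟩
  · by_cases h : i = d
    · subst h; simp
    · simp [Function.update_of_ne h, Function.update_of_ne (show i + V ≠ d + V by omega),
        hs.reg i hi]
  · simp [Function.update_of_ne (show base ≠ d + V by omega), hs.base]

theorem SameOutside.update (V tmp A S : ℕ) (σ : RamState) (d v : ℕ) :
    SameOutside V tmp A S σ ⟨Function.update σ.reg (d + V) v, σ.mem⟩ :=
  ⟨fun i hi _ => Function.update_of_ne (by omega) _ _, fun _ _ => rfl⟩

/-- Step by step simulation. A memory access needs one extra instruction to add the base address,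
whence the factor two; the sum does not overflow because the memory has at most `2 ^ w` cells.
Shifted registers never meet `base` or `tmp`, which lie below `V`. -/
theorem exec_relocate {w S S' V base tmp m A : ℕ} (hbase : base < V) (htmp : tmp < V)
    (hbt : base ≠ tmp) (hA : A + S ≤ S') (hw : S' ≤ 2 ^ w) {p : RamProg} {σ τ : RamState} {k : ℕ}
    (h : RamExec w S p σ k τ) (hp : p.regBound ≤ m) (σ' : RamState)
    (hs : Simulates V base m A S σ σ') :
    ∃ k' ≤ 2 * k, ∃ τ', RamExec w S' (p.relocate V base tmp) σ' k' τ' ∧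
      Simulates V base m A S τ τ' ∧ SameOutside V tmp A S σ' τ' := by
  induction h generalizing σ' with
  | skip σ => exact ⟨1, by omega, σ', RamExec.skip _, hs, SameOutside.refl _ _ _ _ _⟩
  | const d c σ =>
    exact ⟨1, by omega, _, RamExec.const _ _ _, hs.update hbase _ _, SameOutside.update _ _ _ _ _ _ _⟩
  | copy d i σ =>
    refine ⟨1, by omega, _, RamExec.copy _ _ _, ?_, SameOutside.update _ _ _ _ _ _ _⟩
    simp only [RamProg.regBound, max_le_iff] at hp
    rw [hs.reg i (by omega)]
    exact hs.update hbase _ _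
  | op o d i j σ =>
    refine ⟨1, by omega, _, RamExec.op _ _ _ _ _, ?_, SameOutside.update _ _ _ _ _ _ _⟩
    simp only [RamProg.regBound, max_le_iff] at hp
    rw [hs.reg i (by omega), hs.reg j (by omega)]
    exact hs.update hbase _ _
  | load d i σ hi =>
    simp only [RamProg.regBound, max_le_iff] at hp
    have haddr : RamOp.eval w .add (σ'.reg (i + V)) (σ'.reg base) = A + σ.reg i := by
      rw [hs.reg i (by omega), hs.base]
      change (σ.reg i + A) % 2 ^ w = _
      rw [Nat.mod_eq_of_lt (by omega), add_comm]
    have hs1 : Simulates V base m A S σ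
        ⟨Function.update σ'.reg tmp (A + σ.reg i), σ'.mem⟩ :=
      ⟨fun j hj => by rw [← hs.reg j hj]; exact Function.update_of_ne (by omega) _ _,
        by rw [← hs.base]; exact Function.update_of_ne hbt _ _, hs.mem⟩
    refine ⟨1 + 1, le_rfl, _, RamExec.seq _ _ _ _ _ _ _ (RamExec.op _ _ _ _ _)
      (RamExec.load _ _ _ ?_), ?_, ?_⟩
    · simp only [Function.update_self, haddr]
      omega
    · simp only [Function.update_self, haddr]
      rw [hs.mem _ hi]
      exact hs1.update hbase _ _
    · exact ⟨fun j hj hjt => by simp [Function.update_of_ne (show j ≠ d + V by omega),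
        Function.update_of_ne hjt], fun _ _ => rfl⟩
  | store i j σ hi =>
    simp only [RamProg.regBound, max_le_iff] at hp
    have haddr : RamOp.eval w .add (σ'.reg (i + V)) (σ'.reg base) = A + σ.reg i := by
      rw [hs.reg i (by omega), hs.base]
      change (σ.reg i + A) % 2 ^ w = _
      rw [Nat.mod_eq_of_lt (by omega), add_comm]
    refine ⟨1 + 1, le_rfl, _, RamExec.seq _ _ _ _ _ _ _ (RamExec.op _ _ _ _ _)
      (RamExec.store _ _ _ ?_), ?_, ?_⟩
    · simp only [Function.update_self, haddr]
      omega
    · refine ⟨fun l hl => ?_, ?_, fun l hl => ?_⟩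
      · simp [Function.update_of_ne (show l + V ≠ tmp by omega), hs.reg l hl]
      · simp [Function.update_of_ne hbt, hs.base]
      · simp only [Function.update_self, haddr]
        rw [Function.update_of_ne (show j + V ≠ tmp by omega), hs.reg j (by omega)]
        by_cases h : l = σ.reg i
        · subst h; simp
        · rw [Function.update_of_ne h, Function.update_of_ne (by omega), hs.mem l hl]
    · refine ⟨fun l hl hlt => by simp [Function.update_of_ne hlt], fun a ha => ?_⟩
      simp only [Function.update_self, haddr]
      exact Function.update_of_ne (by omega) _ _
  | seq p q σ ρ τ k l _ _ ihp ihq =>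
    simp only [RamProg.regBound, max_le_iff] at hp
    obtain ⟨k1, hk1, τ1, e1, s1, o1⟩ := ihp hp.1 σ' hs
    obtain ⟨k2, hk2, τ2, e2, s2, o2⟩ := ihq hp.2 τ1 s1
    exact ⟨k1 + k2, by omega, τ2, RamExec.seq _ _ _ _ _ _ _ e1 e2, s2, o1.trans o2⟩
  | ite_true c p q σ τ k hc _ ih =>
    obtain ⟨k1, hk1, τ1, e1, s1, o1⟩ := ih (regBound_ite_le hp).1 σ' hs
    exact ⟨k1 + 1, by omega, τ1, RamExec.ite_true _ _ _ _ _ _ ((RamTest.holds_shift hs hp).2 hc) e1,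
      s1, o1⟩
  | ite_false c p q σ τ k hc _ ih =>
    obtain ⟨k1, hk1, τ1, e1, s1, o1⟩ := ih (regBound_ite_le hp).2 σ' hs
    exact ⟨k1 + 1, by omega, τ1, RamExec.ite_false _ _ _ _ _ _
      (fun h => hc ((RamTest.holds_shift hs hp).1 h)) e1, s1, o1⟩
  | while_false c p σ hc =>
    exact ⟨1, by omega, σ', RamExec.while_false _ _ _
      (fun h => hc ((RamTest.holds_shift hs (regBound_while_le hp).1).1 h)), hs,
      SameOutside.refl _ _ _ _ _⟩
  | while_true c p σ ρ τ k l hc _ _ ihp ihl =>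
    obtain ⟨k1, hk1, τ1, e1, s1, o1⟩ := ihp (regBound_while_le hp).2 σ' hs
    obtain ⟨k2, hk2, τ2, e2, s2, o2⟩ := ihl hp τ1 s1
    exact ⟨k1 + k2 + 1, by omega, τ2, RamExec.while_true _ _ _ _ _ _ _
      ((RamTest.holds_shift hs (regBound_while_le hp).1).2 hc) e1 e2, s2, o1.trans o2⟩

/-- Set the registers `V, …, V + m - 1` to zero. -/
def RamProg.clear (V : ℕ) : ℕ → RamProg
  | 0 => .skip
  | m + 1 => .seq (RamProg.clear V m) (.const (m + V) 0)

theorem exec_clear (w S V m : ℕ) (reg M : ℕ → ℕ) :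
    RamExec w S (.clear V m) ⟨reg, M⟩ (m + 1)
      ⟨fun i => if V ≤ i ∧ i < m + V then 0 else reg i, M⟩ := by
  induction m with
  | zero =>
    have : (fun i => if V ≤ i ∧ i < 0 + V then 0 else reg i) = reg := by
      funext i
      rw [if_neg (by omega)]
    rw [this]
    exact RamExec.skip _
  | succ m ih =>
    have h := RamExec.seq _ _ _ _ _ _ _ ih (RamExec.const (w := w) (S := S) (m + V) 0 _)
    change RamExec w S (.seq (.clear V m) (.const (m + V) 0)) _ _ _
    convert h using 2
    funext i
    by_cases hi : i = m + V
    · subst hi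
      rw [if_pos (by omega)]
      simp
    · simp only [Function.update_of_ne hi]
      by_cases h' : V ≤ i ∧ i < m + V
      · rw [if_pos h', if_pos (by omega)]
      · rw [if_neg h', if_neg (by omega)]

/-- Run the query program `p` on the part of the memory at the address in variable `base`, with the
argument in variable `arg`, and put its two results into variables `d` and `d'`. -/
def RamProg.call (V base tmp arg d d' : ℕ) (p : RamProg) : RamProg :=
  .seq (.clear V (max 2 p.regBound)) (.seq (.copy V arg) (.seq (p.relocate V base tmp)
    (.seq (.copy d V) (.copy d' (V + 1)))))

/-- A query program expects zero registers apart from its argument. Clearing those that it mentions,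
and the two output registers, is enough. Besides the doubled query time there are `max 2 p.regBound
+ 1` steps for clearing and three copies. -/
theorem RunsWithin.call {w S S' V base tmp arg d d' A x T : ℕ} (hbase : base < V) (htmp : tmp < V)
    (hbt : base ≠ tmp) (hA : A + S ≤ S') (hw : S' ≤ 2 ^ w) (harg : arg < V)
    (hd : d < V) {p : RamProg} {r M M₀ : ℕ → ℕ} (hrA : r base = A)
    (hrx : r arg = x) (hM : ∀ i < S, M (A + i) = M₀ i) {I : Set (ℕ → ℕ)} {ans : (ℕ → ℕ) → Prop}
    (h : AnswersWithin w S I p (regInput x) M₀ T ans) {Q : (ℕ → ℕ) → (ℕ → ℕ) → Prop}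
    (hQ : ∀ (reg M' M₁ r' : ℕ → ℕ), ans reg → M₁ ∈ I → (∀ i < S, M' (A + i) = M₁ i) →
      (∀ a, a < A ∨ A + S ≤ a → M' a = M a) →
      (∀ i < V, i ≠ tmp → r' i = r i) →
      Q (Function.update (Function.update r' d (reg 0)) d' (reg 1)) M') :
    RunsWithin w S' V (.call V base tmp arg d d' p) r M (2 * T + max 2 p.regBound + 4) Q := by
  intro reg hr
  obtain ⟨k, hk, τ, he, hans, hI⟩ := h
  set m := max 2 p.regBound with hm
  set reg1 : ℕ → ℕ := Function.update (fun i => if V ≤ i ∧ i < m + V then 0 else reg i) V x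
    with hreg1
  have hm2 : 2 ≤ m := le_max_left _ _
  have hs : Simulates V base m A S ⟨regInput x, M₀⟩ ⟨reg1, M⟩ := by
    refine ⟨fun i hi => ?_, ?_, hM⟩
    · simp only [hreg1, regInput]
      rcases Nat.eq_zero_or_pos i with rfl | hi0
      · simp
      · rw [Function.update_of_ne (by omega), Function.update_of_ne (by omega), if_pos (by omega)]
        rfl
    · simp only [hreg1]
      rw [Function.update_of_ne (by omega), if_neg (by omega), hr base hbase, hrA]
  obtain ⟨k', hk', τ', he', hs', ho'⟩ := exec_relocate hbase htmp hbt hA hw he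
    (le_max_right 2 _) ⟨reg1, M⟩ hs
  have hcopy : RamExec w S' (.copy V arg)
      ⟨fun i => if V ≤ i ∧ i < m + V then 0 else reg i, M⟩ 1 ⟨reg1, M⟩ := by
    have := RamExec.copy (w := w) (S := S') V arg
      ⟨fun i => if V ≤ i ∧ i < m + V then 0 else reg i, M⟩
    simp only at this
    rwa [if_neg (by omega), hr arg harg, hrx] at this
  have e0 : τ'.reg V = τ.reg 0 := by have := hs'.reg 0 (by omega); rwa [zero_add] at this
  have e1 : τ'.reg (V + 1) = τ.reg 1 := by
    have := hs'.reg 1 (by omega); rwa [add_comm] at this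
  refine ⟨(m + 1) + (1 + (k' + (1 + 1))), by omega, _, τ'.mem, _,
    RamExec.seq _ _ _ _ _ _ _ (exec_clear w S' V m reg M) (RamExec.seq _ _ _ _ _ _ _ hcopy
      (RamExec.seq _ _ _ _ _ _ _ he' (RamExec.seq _ _ _ _ _ _ _ (RamExec.copy _ _ _)
        (RamExec.copy _ _ _)))), fun i _ => rfl, ?_⟩
  simp only
  rw [Function.update_of_ne (show V + 1 ≠ d by omega), e0, e1]
  refine hQ τ.reg τ'.mem τ.mem τ'.reg hans hI hs'.mem ho'.mem fun i hi hit => ?_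
  rw [ho'.reg i hi hit]
  simp only [hreg1]
  rw [Function.update_of_ne (by omega), if_neg (by omega), hr i hi]

/-! ## Search trees with fusion nodes -/

namespace RamExpr

/-- Entry `e` of array number `t`: the arrays are interleaved in the memory. -/
def cell (t : ℕ) (e : RamExpr) : RamExpr := .load (.op .add (.op .mul e (.const 16)) (.const t))

theorem Ev.cell {w S V : ℕ} {r M : ℕ → ℕ} {e : RamExpr} {x t v : ℕ} (he : Ev w S V r M e x)
    (hw : 16 < 2 ^ w) (hS : S ≤ 2 ^ w) (h : x * 16 + t < S) (hv : M (x * 16 + t) = v) :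
    Ev w S V r M (cell t e) v :=
  hv ▸ Ev.load (Ev.add (Ev.mul he (Ev.const hw) (by omega)) (Ev.const (by omega)) (by omega)) h

section Node

variable (p x : RamExpr)

/-- The constant number `i` of the node at `p`. -/
def nodeConst (i : ℕ) : RamExpr := cell 1 (.op .add p (.const (2 + i)))

/-- The address of child `j` of the node at `p`. -/
def nodeChild (j : RamExpr) : RamExpr :=
  .op .add (.op .add p (.const 20)) (.op .mul j (cell 1 (.op .add p (.const 1))))

/-- See `_root_.nodeSketch`. -/
def nodeSketch (v : RamExpr) : RamExpr :=
  .op .and (.op .mul (.op .mod (.op .and v (nodeConst p 0)) (nodeConst p 1)) (nodeConst p 2))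
    (nodeConst p 3)

/-- See `_root_.fieldCount`. -/
def fieldCount (i j : ℕ) (v : RamExpr) : RamExpr :=
  .op .mod (.op .and (.op .shr (.op .sub (nodeConst p i) (.op .mul v (nodeConst p j)))
    (nodeConst p 4)) (nodeConst p j)) (nodeConst p 5)

/-- See `_root_.nodeRank`. -/
def nodeRank : RamExpr := .op .sub (nodeConst p 11) (fieldCount p 6 7 (nodeSketch p x))

/-- See `_root_.nodeUpper`. -/
def nodeUpper : RamExpr :=
  .ifLt (nodeRank p x) (nodeConst p 11) (nodeRank p x) (.op .sub (nodeConst p 11) (.const 1))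

/-- See `_root_.nodeLower`. -/
def nodeLower : RamExpr :=
  .ifLt (.const 0) (nodeRank p x) (.op .sub (nodeRank p x) (.const 1)) (.const 0)

/-- See `_root_.nodeCand`. -/
def nodeCand : RamExpr :=
  .ifLt (.op .xor x (cell 1 (nodeChild p (nodeLower p x))))
    (.op .xor x (cell 1 (nodeChild p (nodeUpper p x)))) (nodeLower p x) (nodeUpper p x)

/-- See `_root_.nodeLevel`. -/
def nodeLevel (z : RamExpr) : RamExpr :=
  fieldCount p 8 9 (.op .or (nodeSketch p z) (.op .shr (nodeSketch p
    (.op .add (.op .and z (nodeConst p 10)) (nodeConst p 10))) (.const 1)))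

/-- See `_root_.nodeEntry`. -/
def nodeEntry (T i j : RamExpr) : RamExpr :=
  .op .mod (.op .shr T (.op .mul (nodeConst p 13) (.op .add (.op .mul i (nodeConst p 12)) j)))
    (nodeConst p 14)

/-- See `_root_.nodeIndex`. -/
def nodeIndex : RamExpr :=
  nodeEntry p (.ifLt x (cell 1 (nodeChild p (nodeCand p x))) (nodeConst p 15) (nodeConst p 16))
    (nodeCand p x) (nodeLevel p (.op .xor x (cell 1 (nodeChild p (nodeCand p x)))))

/-- The child of the node at `p` that contains the predecessor of `x`. -/
def nodeStep : RamExpr := nodeChild p (nodeIndex p x)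

end Node

/-! ### Evaluation of fusion nodes in memory without overflow -/

variable {w S V : ℕ} {r M : ℕ → ℕ} {p x : RamExpr} {a st l cnt X : ℕ} {c y : ℕ → ℕ}

/-- A fusion node with constants `c` and keys `y`, whose children have `st` words, is stored at
address `a` of array number one. -/
structure NodeAt (w S : ℕ) (M : ℕ → ℕ) (a st cnt : ℕ) (c y : ℕ → ℕ) : Prop where
  w_pos : 16 < 2 ^ w
  S_le : S ≤ 2 ^ w
  room : (a + 20 + cnt * st) * 16 ≤ S
  consts : ∀ i < 17, M ((a + (2 + i)) * 16 + 1) = c i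
  stride : M ((a + 1) * 16 + 1) = st
  keys : ∀ j < cnt, M ((a + 20 + j * st) * 16 + 1) = y j
  st_pos : 0 < st
  bounds : NodeBounds w c
  cnt_eq : c 11 = cnt

theorem Ev.nodeConst (h : NodeAt w S M a st cnt c y) (hp : Ev w S V r M p a) {i : ℕ}
    (hi : i < 17) : Ev w S V r M (nodeConst p i) (c i) := by
  have h1 := h.room
  have h2 := h.S_le
  exact Ev.cell (hp.add (Ev.const (by omega)) (by omega)) h.w_pos h.S_le (by omega) (h.consts i hi)

theorem Ev.nodeChild (h : NodeAt w S M a st cnt c y) (hp : Ev w S V r M p a) {e : RamExpr} {j : ℕ}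
    (he : Ev w S V r M e j) (hj : j < cnt) :
    Ev w S V r M (nodeChild p e) (a + 20 + j * st) := by
  have h1 := h.room
  have h2 := h.S_le
  have h3 : j * st ≤ cnt * st := Nat.mul_le_mul_right _ hj.le
  refine (hp.add (Ev.const (by omega)) (by omega)).add (he.mul (Ev.cell
    (hp.add (Ev.const (by omega)) (by omega)) h.w_pos h.S_le (by omega) h.stride) ?_) ?_ <;> omega

theorem Ev.nodeKey (h : NodeAt w S M a st cnt c y) (hp : Ev w S V r M p a) {e : RamExpr} {j : ℕ}
    (he : Ev w S V r M e j) (hj : j < cnt) :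
    Ev w S V r M (RamExpr.cell 1 (RamExpr.nodeChild p e)) (y j) := by
  have h1 := h.room
  have h2 := Nat.mul_le_mul_right st (show j + 1 ≤ cnt from hj)
  have h3 := h.st_pos
  rw [Nat.succ_mul] at h2
  exact Ev.cell (Ev.nodeChild h hp he hj) h.w_pos h.S_le (by omega) (h.keys j hj)

theorem Ev.nodeSketch (h : NodeAt w S M a st cnt c y) (hp : Ev w S V r M p a) {e : RamExpr} {v : ℕ}
    (he : Ev w S V r M e v) : Ev w S V r M (nodeSketch p e) (_root_.nodeSketch c v) := by
  refine Ev.and (Ev.mul (Ev.mod (Ev.and he (Ev.nodeConst h hp (by norm_num)))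
    (Ev.nodeConst h hp (by norm_num))) (Ev.nodeConst h hp (by norm_num)) ?_)
    (Ev.nodeConst h hp (by norm_num))
  exact lt_of_le_of_lt (Nat.mul_le_mul_right _ (Nat.mod_lt _ h.bounds.pos).le) h.bounds.prod

theorem Ev.fieldCount (h : NodeAt w S M a st cnt c y) (hp : Ev w S V r M p a) {e : RamExpr}
    {v i j : ℕ} (hi : i < 17) (hj : j < 17) (he : Ev w S V r M e v) (hv : v < 2 ^ c 4)
    (hij : 2 ^ c 4 * c j ≤ c i) :
    Ev w S V r M (fieldCount p i j e) (_root_.fieldCount (c i) (c j) (c 4) (c 5) v) := by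
  have h1 : v * c j ≤ c i := (Nat.mul_le_mul_right _ hv.le).trans hij
  have h2 := h.bounds.lt i
  exact Ev.mod (Ev.and (Ev.shr (Ev.sub (Ev.nodeConst h hp hi)
    (Ev.mul he (Ev.nodeConst h hp hj) (by omega)) h1 h2) (Ev.nodeConst h hp (by norm_num)))
    (Ev.nodeConst h hp hj)) (Ev.nodeConst h hp (by norm_num))

theorem nodeSketch_lt (h : NodeBounds w c) (v : ℕ) : _root_.nodeSketch c v < 2 ^ c 4 :=
  lt_of_le_of_lt Nat.and_le_right h.sketch_lt

theorem Ev.nodeRank (h : NodeAt w S M a st cnt c y) (hp : Ev w S V r M p a)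
    (hx : Ev w S V r M x X)
    (hX : _root_.fieldCount (c 6) (c 7) (c 4) (c 5) (_root_.nodeSketch c X) ≤ cnt) :
    Ev w S V r M (nodeRank p x) (_root_.nodeRank c X) :=
  Ev.sub (Ev.nodeConst h hp (by norm_num)) (Ev.fieldCount h hp (by norm_num) (by norm_num)
    (Ev.nodeSketch h hp hx) (nodeSketch_lt h.bounds X) h.bounds.keys) (by rwa [h.cnt_eq])
    (h.bounds.lt 11)

theorem Ev.nodeUpper (h : NodeAt w S M a st cnt c y) (hp : Ev w S V r M p a)
    (hx : Ev w S V r M x X)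
    (hX : _root_.fieldCount (c 6) (c 7) (c 4) (c 5) (_root_.nodeSketch c X) ≤ cnt) :
    Ev w S V r M (nodeUpper p x) (_root_.nodeUpper c X) := by
  have hw := h.w_pos
  exact Ev.ite (Ev.nodeRank h hp hx hX) (Ev.nodeConst h hp (by norm_num))
    (fun _ => Ev.nodeRank h hp hx hX)
    fun _ => Ev.sub (Ev.nodeConst h hp (by norm_num)) (Ev.const (by omega)) h.bounds.cnt_pos
      (h.bounds.lt 11)

theorem Ev.nodeLower (h : NodeAt w S M a st cnt c y) (hp : Ev w S V r M p a)
    (hx : Ev w S V r M x X)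
    (hX : _root_.fieldCount (c 6) (c 7) (c 4) (c 5) (_root_.nodeSketch c X) ≤ cnt) :
    Ev w S V r M (nodeLower p x) (_root_.nodeLower c X) := by
  have hw := h.w_pos
  have hr : _root_.nodeRank c X < 2 ^ w := lt_of_le_of_lt (Nat.sub_le _ _) (h.bounds.lt 11)
  exact Ev.ite (Ev.const (by omega)) (Ev.nodeRank h hp hx hX)
    (fun h0 => Ev.sub (Ev.nodeRank h hp hx hX) (Ev.const (by omega)) h0 hr)
    fun _ => Ev.const (by omega)

theorem nodeUpper_lt (h : NodeBounds w c) (v : ℕ) : _root_.nodeUpper c v < c 11 := by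
  have := h.cnt_pos
  rw [_root_.nodeUpper]
  split_ifs <;> omega

theorem nodeLower_lt (h : NodeBounds w c) (v : ℕ) : _root_.nodeLower c v < c 11 := by
  have := h.cnt_pos
  have h1 : _root_.nodeRank c v ≤ c 11 := Nat.sub_le _ _
  rw [_root_.nodeLower]
  split_ifs <;> omega

theorem nodeCand_lt (h : NodeBounds w c) (v : ℕ) : _root_.nodeCand c y v < c 11 := by
  rw [_root_.nodeCand]
  split_ifs
  · exact nodeLower_lt h v
  · exact nodeUpper_lt h v

theorem Ev.nodeCand (h : NodeAt w S M a st cnt c y) (hp : Ev w S V r M p a)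
    (hx : Ev w S V r M x X)
    (hX : _root_.fieldCount (c 6) (c 7) (c 4) (c 5) (_root_.nodeSketch c X) ≤ cnt) :
    Ev w S V r M (nodeCand p x) (_root_.nodeCand c y X) := by
  have hl := Ev.nodeLower h hp hx hX
  have hu := Ev.nodeUpper h hp hx hX
  exact Ev.ite (Ev.xor hx (Ev.nodeKey h hp hl (h.cnt_eq ▸ nodeLower_lt h.bounds X)))
    (Ev.xor hx (Ev.nodeKey h hp hu (h.cnt_eq ▸ nodeUpper_lt h.bounds X)))
    (fun _ => hl) fun _ => hu

theorem Ev.nodeLevel (h : NodeAt w S M a st cnt c y) (hp : Ev w S V r M p a) {e : RamExpr} {z : ℕ}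
    (he : Ev w S V r M e z) : Ev w S V r M (nodeLevel p e) (_root_.nodeLevel c z) := by
  have hw := h.w_pos
  have hgap := h.bounds.gap
  have hand : z &&& c 10 ≤ c 10 := Nat.and_le_right
  have hc10 := Ev.nodeConst h hp (i := 10) (by norm_num)
  exact Ev.fieldCount h hp (by norm_num) (by norm_num) (Ev.or (Ev.nodeSketch h hp he)
    (Ev.shr (Ev.nodeSketch h hp (Ev.add (Ev.and he hc10) hc10 (by omega))) (Ev.const (by omega))))
    (Nat.or_lt_two_pow (nodeSketch_lt h.bounds _) ((Nat.shiftRight_le _ _).trans_lt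
      (nodeSketch_lt h.bounds _))) h.bounds.levels

theorem Ev.nodeIndex (h : NodeAt w S M a st cnt c y) (hp : Ev w S V r M p a)
    (hx : Ev w S V r M x X)
    (hX : _root_.fieldCount (c 6) (c 7) (c 4) (c 5) (_root_.nodeSketch c X) ≤ cnt)
    (hlev : _root_.nodeLevel c (X ^^^ y (_root_.nodeCand c y X)) < c 12) :
    Ev w S V r M (nodeIndex p x) (_root_.nodeIndex c y X) := by
  have hc := Ev.nodeCand h hp hx hX
  have hclt := nodeCand_lt (y := y) h.bounds X
  have hk := Ev.nodeKey h hp hc (h.cnt_eq ▸ hclt)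
  have hl := Ev.nodeLevel h hp (Ev.xor hx hk)
  have h1 : _root_.nodeCand c y X * c 12 + _root_.nodeLevel c (X ^^^ y (_root_.nodeCand c y X))
      ≤ c 11 * c 12 := by nlinarith [Nat.mul_le_mul_right (c 12) hclt]
  have h2 := h.bounds.rows
  exact Ev.mod (Ev.shr (Ev.ite hx hk (fun _ => Ev.nodeConst h hp (by norm_num))
    fun _ => Ev.nodeConst h hp (by norm_num)) (Ev.mul (Ev.nodeConst h hp (by norm_num))
      (Ev.add (Ev.mul hc (Ev.nodeConst h hp (by norm_num)) (by omega)) hl (by omega))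
      (lt_of_le_of_lt (Nat.mul_le_mul_left _ h1) h.bounds.table)))
    (Ev.nodeConst h hp (by norm_num))

end RamExpr

/-! ### Trees of fusion nodes -/

/-- The program that walks down `h` levels of a tree, for the key in variable `x`, from the node in
variable `p`. -/
def RamProg.descend (V p x : ℕ) : ℕ → RamProg
  | 0 => .skip
  | h + 1 => .seq (.assign V p (.nodeStep (.var p) (.var x))) (.descend V p x h)

/-- A bound for the number of steps of `RamProg.descend`. -/
def descendCost (p x h : ℕ) : ℕ := h * ((RamExpr.nodeStep (.var p) (.var x)).cost + 1) + 1

/-- The number of words of a tree of height `h` with at most `k` children at each node. -/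
def treeSize (k : ℕ) : ℕ → ℕ
  | 0 => 2
  | h + 1 => 20 + k * treeSize k h

theorem two_le_treeSize (k h : ℕ) : 2 ≤ treeSize k h ∨ k = 0 := by
  cases h with
  | zero => exact Or.inl le_rfl
  | succ h => exact Or.inl (by rw [treeSize]; omega)

theorem treeSize_le {k : ℕ} (hk : 0 < k) (h : ℕ) : treeSize k h ≤ (2 + 20 * h) * k ^ h := by
  induction h with
  | zero => simp [treeSize]
  | succ h ih =>
    have h1 : 1 ≤ k ^ (h + 1) := Nat.one_le_pow _ _ hk
    rw [treeSize]
    calc 20 + k * treeSize k h ≤ 20 * k ^ (h + 1) + k * ((2 + 20 * h) * k ^ h) :=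
          add_le_add (by omega) (Nat.mul_le_mul_left k ih)
      _ = _ := by rw [pow_succ]; ring

/-- `T` are the contents of a search tree of height `h` for the keys `y` with associated
information `d`: from an address at which `T` is stored, one gets to the address of a pair that
consists of the predecessor of `x` and its information. -/
def IsSearchTree (w V P X k l h cnt : ℕ) (y d T : ℕ → ℕ) : Prop :=
  (∀ i, T i < 2 ^ w) ∧ T 0 = y 0 ∧ ∀ (S a x : ℕ) (M r : ℕ → ℕ), S ≤ 2 ^ w →
    (a + treeSize k h) * 16 ≤ S → (∀ i < treeSize k h, M ((a + i) * 16 + 1) = T i) →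
    x < 2 ^ l → y 0 ≤ x → r P = a → r X = x → ∃ i v, IsPredIndex cnt y x i ∧
      (v + 2) * 16 ≤ S ∧ M (v * 16 + 1) = y i ∧ M ((v + 1) * 16 + 1) = d i ∧
      RunsWithin w S V (.descend V P X h) r M (descendCost P X h)
        fun r' M' => r' = Function.update r P v ∧ M' = M

/-- The sorted keys are cut into at most `k` chunks of `k ^ h` keys, with one subtree for each
chunk. The root is a fusion node for the first keys of the chunks; the last chunk whose first key is
at most `x` contains the predecessor. -/
theorem exists_searchTree {w V P X k l s : ℕ} (hP : P < V) (hX : X < V) (hPX : X ≠ P)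
    (hl : l ≤ s * s) (hw : nodeBits k l s ≤ w) (hw16 : 16 < 2 ^ w) (h : ℕ) :
    ∀ (cnt : ℕ) (y d : ℕ → ℕ), 0 < cnt → cnt ≤ k ^ h → (∀ i j, i < j → j < cnt → y i < y j) →
      (∀ i < cnt, y i < 2 ^ l) → (∀ i < cnt, d i < 2 ^ w) → treeSize k h < 2 ^ w →
      ∃ T, IsSearchTree w V P X k l h cnt y d T := by
  have hlw : 2 ^ l ≤ 2 ^ w := Nat.pow_le_pow_right two_pos (by rw [nodeBits] at hw; omega)
  induction h with
  | zero =>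
    intro cnt y d hcnt hck _ hyl hd _
    have hcnt1 : cnt = 1 := by simpa using le_antisymm (by simpa using hck) hcnt
    subst hcnt1
    refine ⟨fun i => if i = 0 then y 0 else d 0, fun i => ?_, by simp, ?_⟩
    · dsimp only
      split_ifs
      · exact (hyl 0 (by norm_num)).trans_le hlw
      · exact hd 0 (by norm_num)
    · intro S a x M r hS ha hM hx hyx hrP hrX
      refine ⟨0, a, ⟨by norm_num, hyx, fun j hj _ => by omega⟩, ha, ?_, ?_, ?_⟩
      · simpa using hM 0 (by simp [treeSize])
      · simpa using hM 1 (by simp [treeSize])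
      · refine (RunsWithin.skip ?_).mono (by simp [descendCost]) fun _ _ h => h
        exact ⟨by rw [← hrP, Function.update_eq_self], rfl⟩
  | succ h ih =>
    intro cnt y d hcnt hck hy hyl hd hsize
    have hk : 0 < k := by
      rcases Nat.eq_zero_or_pos k with rfl | hk
      · simp at hck; omega
      · exact hk
    set b := k ^ h with hb
    have hb0 : 0 < b := Nat.pow_pos hk
    set sz := treeSize k h with hsz
    have hsz0 : 0 < sz := by rcases two_le_treeSize k h with h1 | h1 <;> omega
    have hsize' : 20 + k * sz < 2 ^ w := hsize
    have hszw : sz < 2 ^ w := by nlinarith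
    -- The number of chunks, that is `cnt / b` rounded up.
    set n := (cnt - 1) / b + 1 with hn
    have hjn : ∀ j, j < n ↔ j * b < cnt := by
      intro j
      have := Nat.le_div_iff_mul_le hb0 (x := j) (y := cnt - 1)
      omega
    have hnk : n ≤ k := by
      have : (cnt - 1) / b < k := Nat.div_lt_of_lt_mul (by
        rw [pow_succ, ← hb] at hck
        omega)
      omega
    have hn0 : 0 < n := Nat.succ_pos _
    obtain ⟨c, hc, hcn, hcx⟩ := exists_nodeConsts (y := fun j => y (j * b)) hn0 hnk
      (fun i j hij hj => hy _ _ (Nat.mul_lt_mul_of_pos_right hij hb0) ((hjn j).1 hj))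
      (fun i hi => hyl _ ((hjn i).1 hi)) hl hw
    have hchild : ∀ j, ∃ T, j < n → IsSearchTree w V P X k l h (min b (cnt - j * b))
        (fun i => y (j * b + i)) (fun i => d (j * b + i)) T := by
      intro j
      by_cases hj : j < n
      · have hj' := (hjn j).1 hj
        obtain ⟨T, hT⟩ := ih (min b (cnt - j * b)) (fun i => y (j * b + i)) (fun i => d (j * b + i))
          (by omega) (min_le_left _ _) (fun i i' hii hi => hy _ _ (by omega) (by omega))
          (fun i hi => hyl _ (by omega)) (fun i hi => hd _ (by omega)) hszw
        exact ⟨T, fun _ => hT⟩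
      · exact ⟨0, fun h => absurd h hj⟩
    choose T hT using hchild
    -- First key, stride, 17 constants (and one spare word), then from offset 20 on the children.
    -- Word `0` of each child is its first key, so the node keys need no separate copy.
    set TT : ℕ → ℕ := fun i => if i = 0 then y 0 else if i = 1 then sz else
      if i < 20 then c (i - 2) else
        if (i - 20) / sz < n then T ((i - 20) / sz) ((i - 20) % sz) else 0 with hTT
    have hTTchild : ∀ j < n, ∀ i < sz, TT (20 + j * sz + i) = T j i := by
      intro j hj i hi
      have h1 : (20 + j * sz + i - 20) / sz = j := by
        rw [show 20 + j * sz + i - 20 = sz * j + i by rw [mul_comm]; omega,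
          Nat.mul_add_div hsz0, Nat.div_eq_of_lt hi, add_zero]
      have h2 : (20 + j * sz + i - 20) % sz = i := by
        rw [show 20 + j * sz + i - 20 = sz * j + i by rw [mul_comm]; omega,
          Nat.mul_add_mod, Nat.mod_eq_of_lt hi]
      simp only [hTT]
      rw [if_neg (by omega), if_neg (by omega), if_neg (by omega), h1, h2, if_pos hj]
    refine ⟨TT, fun i => ?_, rfl, ?_⟩
    · simp only [hTT]
      split_ifs with h1 h2 h3 h4
      · exact (hyl 0 hcnt).trans_le hlw
      · exact hszw
      · exact hc.lt _
      · exact (hT _ h4).1 _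
      · positivity
    · intro S a x M r hS ha hM hx hyx hrP hrX
      rw [treeSize, ← hsz] at ha hM
      have hnsz : n * sz ≤ k * sz := Nat.mul_le_mul_right _ hnk
      have hjsz : ∀ j < n, j * sz + sz ≤ k * sz := fun j hj => by
        have := Nat.mul_le_mul_right sz (show j + 1 ≤ n from hj)
        rw [Nat.succ_mul] at this
        omega
      have hchildM : ∀ j < n, ∀ i < sz, M ((a + 20 + j * sz + i) * 16 + 1) = T j i := by
        intro j hj i hi
        have := hjsz j hj
        rw [← hTTchild j hj i hi, ← hM _ (by omega)]
        congr 2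
        ring
      have hnode : RamExpr.NodeAt w S M a sz n c (fun j => y (j * b)) := by
        refine ⟨hw16, hS, by omega, fun i hi => ?_, ?_, fun j hj => ?_, hsz0, hc, hcn⟩
        · rw [hM (2 + i) (by omega)]
          simp only [hTT]
          rw [if_neg (by omega), if_neg (by omega), if_pos (by omega)]
          congr 1
          omega
        · rw [hM 1 (by omega)]
          simp [hTT]
        · have := hchildM j hj 0 hsz0
          rw [add_zero] at this
          rw [this, (hT j hj).2.1]
          rfl
      obtain ⟨hfc, hlev, hidx⟩ := hcx x hx
      have hidx := hidx (by simpa using hyx)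
      set j := nodeIndex c (fun j => y (j * b)) x with hj
      obtain ⟨hjlt, hjx, hjmax⟩ := hidx
      have hev : RamExpr.Ev w S V r M (.nodeStep (.var P) (.var X)) (a + 20 + j * sz) :=
        RamExpr.Ev.nodeChild hnode (hrP ▸ RamExpr.Ev.var hP) (RamExpr.Ev.nodeIndex hnode
          (hrP ▸ RamExpr.Ev.var hP) (hrX ▸ RamExpr.Ev.var hX) hfc hlev) hjlt
      have hjs := hjsz j hjlt
      obtain ⟨i, v, hi, hv, hMv, hMv', hrun⟩ := (hT j hjlt).2.2 S (a + 20 + j * sz) x M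
        (Function.update r P (a + 20 + j * sz)) hS (by omega) (hchildM j hjlt) hx
        (by simpa using hjx) (Function.update_self _ _ _) (by rwa [Function.update_of_ne hPX])
      refine ⟨j * b + i, v, ⟨?_, hi.2.1, ?_⟩, hv, hMv, hMv', ?_⟩
      · have := hi.1
        omega
      · intro i' hi' hix'
        -- A key at most `x` has a chunk with first key at most `x`, hence a chunk number at most
        -- `j`; inside chunk `j` the subtree decides.
        have hle : i' / b * b ≤ i' := Nat.div_mul_le_self _ _
        have hq : i' / b ≤ j := by
          refine hjmax _ ((hjn _).2 (by omega)) ?_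
          rcases hle.eq_or_lt with heq | hlt
          · dsimp only
            rwa [heq]
          · exact (hy _ _ hlt hi').le.trans hix'
        have hmod := Nat.div_add_mod i' b
        have hmlt := Nat.mod_lt i' hb0
        rcases hq.eq_or_lt with heq | hlt
        · rw [heq, mul_comm] at hmod
          have := hi.2.2 (i' % b) (by omega) (by dsimp only; rwa [hmod])
          omega
        · have h1 := Nat.mul_le_mul_right b (show i' / b + 1 ≤ j from hlt)
          rw [Nat.succ_mul, mul_comm (i' / b)] at h1
          omega
      · have hcost : descendCost P X (h + 1) =
            (RamExpr.nodeStep (.var P) (.var X)).cost + 1 + descendCost P X h := by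
          rw [descendCost, descendCost]; ring
        rw [hcost]
        refine RunsWithin.seq (Q := fun r' M' => r' = Function.update r P (a + 20 + j * sz) ∧ M' = M)
          (RunsWithin.assign hP hev ⟨rfl, rfl⟩) ?_
        rintro r' M' ⟨rfl, rfl⟩
        refine hrun.mono le_rfl ?_
        rintro r' M' ⟨rfl, rfl⟩
        exact ⟨by simp, rfl⟩

/-! ## Perfect hashing -/

/-- The hash function with multiplier `a`, modulus `p` and range `m`. -/
def modHash (a p m x : ℕ) : ℕ := a * x % p % m

/-- The difference of the two residues is a positive multiple of `m` below `p`, and it determines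
the multiplier since `x - y` is invertible modulo `p`. -/
theorem card_hash_lt_le {p m x y : ℕ} (hp : p.Prime) (hx : x < p) (hy : y < p) (hxy : x ≠ y) :
    ((Finset.Ioc 0 (p - 1)).filter fun a =>
      a * y % p < a * x % p ∧ modHash a p m x = modHash a p m y).card ≤ (p - 1) / m := by
  rw [← Nat.Ioc_filter_dvd_card_eq_div]
  have hp0 := hp.pos
  apply Finset.card_le_card_of_injOn fun a => a * x % p - a * y % p
  · intro a ha
    rw [Finset.mem_coe, Finset.mem_filter, Finset.mem_Ioc] at ha
    rw [Finset.mem_coe, Finset.mem_filter, Finset.mem_Ioc]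
    obtain ⟨⟨h1, h2⟩, h3, h4⟩ := ha
    have h5 := Nat.mod_lt (a * x) hp0
    dsimp only
    exact ⟨by omega, (Nat.modEq_iff_dvd' h3.le).1 h4.symm⟩
  · intro a ha b hb hab
    rw [Finset.mem_coe, Finset.mem_filter, Finset.mem_Ioc] at ha hb
    dsimp only at hab
    have : Fact p.Prime := ⟨hp⟩
    have h1 : a * x % p + b * y % p = b * x % p + a * y % p := by omega
    have h2 : (a : ZMod p) * x + b * y = b * x + a * y := by
      have h3 := congrArg (Nat.cast (R := ZMod p)) h1
      simpa using h3
    have h3 : ((a : ZMod p) - b) * (x - y) = 0 := by linear_combination h2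
    have cast_inj : ∀ {u v : ℕ}, u < p → v < p → ((u : ZMod p) - v = 0) → u = v := by
      intro u v hu hv h
      have := (ZMod.natCast_eq_natCast_iff u v p).1 (sub_eq_zero.1 h)
      rwa [Nat.ModEq, Nat.mod_eq_of_lt hu, Nat.mod_eq_of_lt hv] at this
    rcases mul_eq_zero.1 h3 with h | h
    · exact cast_inj (by omega) (by omega) h
    · exact absurd (cast_inj hx hy h) hxy

/-- The residues of `x` and `y` are different for every admissible multiplier, so each collision is
counted with one of the two orders in `card_hash_lt_le`. -/
theorem card_hash_eq_le {p m x y : ℕ} (hp : p.Prime) (hx : x < p) (hy : y < p) (hxy : x ≠ y) :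
    ((Finset.Ioc 0 (p - 1)).filter fun a => modHash a p m x = modHash a p m y).card * m
      ≤ 2 * (p - 1) := by
  have h1 := card_hash_lt_le (m := m) hp hx hy hxy
  have h2 := card_hash_lt_le (m := m) hp hy hx hxy.symm
  have hsub : ((Finset.Ioc 0 (p - 1)).filter fun a => modHash a p m x = modHash a p m y) ⊆
      ((Finset.Ioc 0 (p - 1)).filter fun a =>
        a * y % p < a * x % p ∧ modHash a p m x = modHash a p m y) ∪
      ((Finset.Ioc 0 (p - 1)).filter fun a =>
        a * x % p < a * y % p ∧ modHash a p m y = modHash a p m x) := by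
    intro a ha
    rw [Finset.mem_filter] at ha
    rw [Finset.mem_union, Finset.mem_filter, Finset.mem_filter]
    rcases lt_trichotomy (a * x % p) (a * y % p) with h | h | h
    · exact Or.inr ⟨ha.1, h, ha.2.symm⟩
    · exfalso
      have ha' := Finset.mem_Ioc.1 ha.1
      have hcop : Nat.Coprime p a := Nat.coprime_of_lt_prime (by omega) (by omega) hp
      have := Nat.ModEq.cancel_left_of_coprime hcop h
      rw [Nat.ModEq, Nat.mod_eq_of_lt hx, Nat.mod_eq_of_lt hy] at this
      exact hxy this
    · exact Or.inl ⟨ha.1, h, ha.2⟩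
  have h3 := (Finset.card_le_card hsub).trans (Finset.card_union_le _ _)
  have h4 := Nat.div_mul_le_self (p - 1) m
  nlinarith [Nat.mul_le_mul_right m (h3.trans (add_le_add h1 h2))]

/-- The ordered pairs of different elements of `R` with the same hash value. -/
def collisions (R : Finset ℕ) (a p m : ℕ) : Finset (ℕ × ℕ) :=
  R.offDiag.filter fun z => modHash a p m z.1 = modHash a p m z.2

/-- Averaging over the multipliers `1, …, p - 1`: if each had too many collisions, the double count
of colliding pairs would contradict `card_hash_eq_le`. -/
theorem exists_hash {R : Finset ℕ} {p : ℕ} (hp : p.Prime) (hR : ∀ x ∈ R, x < p) (m : ℕ) :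
    ∃ a < p, (collisions R a p m).card * m ≤ 2 * R.offDiag.card := by
  by_contra! hcon
  have hp1 := hp.one_lt
  have h1 : ∑ a ∈ Finset.Ioc 0 (p - 1), (collisions R a p m).card * m ≤
      ∑ _z ∈ R.offDiag, 2 * (p - 1) := by
    have h2 : ∑ a ∈ Finset.Ioc 0 (p - 1), (collisions R a p m).card =
        ∑ z ∈ R.offDiag, ((Finset.Ioc 0 (p - 1)).filter fun a =>
          modHash a p m z.1 = modHash a p m z.2).card := by
      simp only [collisions, Finset.card_filter]
      exact Finset.sum_comm
    rw [← Finset.sum_mul, h2, Finset.sum_mul]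
    refine Finset.sum_le_sum fun z hz => ?_
    rw [Finset.mem_offDiag] at hz
    exact card_hash_eq_le hp (hR _ hz.1) (hR _ hz.2.1) hz.2.2
  have h3 : ∑ _a ∈ Finset.Ioc 0 (p - 1), (2 * R.offDiag.card + 1) ≤
      ∑ a ∈ Finset.Ioc 0 (p - 1), (collisions R a p m).card * m := by
    refine Finset.sum_le_sum fun a ha => hcon a ?_
    have := Finset.mem_Ioc.1 ha
    omega
  have h4 := h3.trans h1
  simp only [Finset.sum_const, Nat.card_Ioc, smul_eq_mul] at h4
  have h5 : (p - 1 - 0) * (2 * R.offDiag.card + 1) = R.offDiag.card * (2 * (p - 1)) + (p - 1) := by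
    rw [Nat.sub_zero]; ring
  omega

/-- A static dictionary for the set `R` in linear space with two levels of hashing. -/
theorem exists_dictionary {R : Finset ℕ} {p : ℕ} (hp : p.Prime) (hR : ∀ x ∈ R, x < p)
    (val : ℕ → ℕ) :
    ∃ (a : ℕ) (A m o cells : ℕ → ℕ), a < p ∧ (∀ b, A b < p) ∧
      (∀ b < R.card, m b ≤ 7 * R.card ∧ o b ≤ 7 * R.card) ∧
      ∀ x ∈ R, modHash a p R.card x < R.card ∧
        o (modHash a p R.card x) + modHash (A (modHash a p R.card x)) p (m (modHash a p R.card x)) x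
          < 7 * R.card ∧
        cells (o (modHash a p R.card x) +
          modHash (A (modHash a p R.card x)) p (m (modHash a p R.card x)) x) = val x := by
  classical
  set n := R.card with hn
  obtain ⟨a, ha, hcoll⟩ := exists_hash hp hR n
  set f : ℕ → ℕ := modHash a p n with hf
  have hflt : ∀ x ∈ R, f x < n := fun x hx => Nat.mod_lt _ (Finset.card_pos.2 ⟨x, hx⟩)
  set B : ℕ → Finset ℕ := fun b => R.filter fun x => f x = b with hB
  -- With range `2 * |B b| ^ 2 + 1` a single collision in bucket `b` would already violate the bound
  -- of `exists_hash`.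
  set m : ℕ → ℕ := fun b => 2 * ((B b).card * (B b).card) + 1 with hm
  have hsecond : ∀ b, ∃ a' < p, (collisions (B b) a' p (m b)).card * m b ≤ 2 * (B b).offDiag.card :=
    fun b => exists_hash hp (fun x hx => hR x (Finset.mem_filter.1 hx).1) (m b)
  choose A hA hAcoll using hsecond
  have hinj : ∀ b, ∀ x ∈ B b, ∀ y ∈ B b, modHash (A b) p (m b) x = modHash (A b) p (m b) y →
      x = y := by
    intro b x hx y hy hxy
    by_contra hne
    have h1 : (x, y) ∈ collisions (B b) (A b) p (m b) :=
      Finset.mem_filter.2 ⟨Finset.mem_offDiag.2 ⟨hx, hy, hne⟩, hxy⟩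
    have h2 : 1 ≤ (collisions (B b) (A b) p (m b)).card := Finset.card_pos.2 ⟨_, h1⟩
    have h3 := hAcoll b
    have h4 := Nat.mul_le_mul_right (m b) h2
    have h5 : (B b).offDiag.card ≤ (B b).card * (B b).card := by
      rw [Finset.offDiag_card]; exact Nat.sub_le _ _
    simp only [hm] at h3 h4
    omega
  set o : ℕ → ℕ := fun b => ∑ i ∈ Finset.range b, m i with ho
  have hosucc : ∀ b, o (b + 1) = o b + m b := fun b => Finset.sum_range_succ _ _
  have homono : Monotone o := monotone_nat_of_le_succ fun b => by rw [hosucc]; omega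
  -- The sum counts pairs with equal first hash value: `n` on the diagonal and at most `2 * n`
  -- collisions. The second-level tables then need `2 * (3 * n) + n = 7 * n` cells.
  have hsq : ∑ b ∈ Finset.range n, (B b).card * (B b).card ≤ 3 * n := by
    have h1 : ∑ b ∈ Finset.range n, (B b).card * (B b).card =
        ((R ×ˢ R).filter fun z => f z.1 = f z.2).card := by
      rw [Finset.card_eq_sum_card_fiberwise (f := fun z : ℕ × ℕ => f z.1) (t := Finset.range n)]
      · refine Finset.sum_congr rfl fun b _ => ?_
        rw [← Finset.card_product]
        congr 1
        ext z
        simp only [hB, Finset.mem_product, Finset.mem_filter]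
        constructor
        · rintro ⟨⟨h1, h2⟩, h3, h4⟩
          exact ⟨⟨⟨h1, h3⟩, h2.trans h4.symm⟩, h2⟩
        · rintro ⟨⟨⟨h1, h3⟩, h5⟩, h2⟩
          exact ⟨⟨h1, h2⟩, h3, h5.symm.trans h2⟩
      · intro z hz
        have := (Finset.mem_product.1 (Finset.mem_filter.1 hz).1).1
        exact Finset.mem_coe.2 (Finset.mem_range.2 (hflt _ this))
    have h2 : ((R ×ˢ R).filter fun z => f z.1 = f z.2) ⊆ R.diag ∪ collisions R a p n := by
      intro z hz
      rw [Finset.mem_filter, Finset.mem_product] at hz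
      rw [Finset.mem_union, Finset.mem_diag, collisions, Finset.mem_filter, Finset.mem_offDiag]
      by_cases h : z.1 = z.2
      · exact Or.inl ⟨hz.1.1, h⟩
      · exact Or.inr ⟨⟨hz.1.1, hz.1.2, h⟩, hz.2⟩
    have h3 : (collisions R a p n).card ≤ 2 * n := by
      rcases Nat.eq_zero_or_pos n with h0 | h0
      · have : R = ∅ := Finset.card_eq_zero.1 h0
        simp [collisions, this]
      · refine Nat.le_of_mul_le_mul_right (hcoll.trans ?_) h0
        rw [Finset.offDiag_card, mul_assoc]
        exact Nat.mul_le_mul_left 2 (Nat.sub_le _ _)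
    have h4 := (Finset.card_le_card h2).trans (Finset.card_union_le _ _)
    rw [Finset.diag_card] at h4
    omega
  have hon : o n ≤ 7 * n := by
    have h1 : o n = 2 * ∑ b ∈ Finset.range n, (B b).card * (B b).card + n := by
      simp only [ho, hm]
      rw [Finset.sum_add_distrib, ← Finset.mul_sum]
      simp
    omega
  set idx : ℕ → ℕ := fun x => o (f x) + modHash (A (f x)) p (m (f x)) x with hidx
  have hlt : ∀ x, idx x < o (f x + 1) := fun x => by
    rw [hosucc]
    exact Nat.add_lt_add_left (Nat.mod_lt _ (Nat.succ_pos _)) _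
  have hidxinj : ∀ x ∈ R, ∀ y ∈ R, idx x = idx y → x = y := by
    intro x hx y hy hxy
    have hfxy : f x = f y := by
      have h1 := hlt x
      have h2 := hlt y
      have h3 : o (f x) ≤ idx x := Nat.le_add_right _ _
      have h4 : o (f y) ≤ idx y := Nat.le_add_right _ _
      rcases lt_trichotomy (f x) (f y) with h | h | h
      · have := homono (show f x + 1 ≤ f y from h)
        omega
      · exact h
      · have := homono (show f y + 1 ≤ f x from h)
        omega
    refine hinj (f x) x (Finset.mem_filter.2 ⟨hx, rfl⟩) y (Finset.mem_filter.2 ⟨hy, hfxy.symm⟩) ?_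
    simp only [hidx] at hxy
    rw [← hfxy] at hxy
    omega
  refine ⟨a, A, m, o, fun i => if h : ∃ x ∈ R, idx x = i then val h.choose else 0, ha, hA,
    fun b hb => ?_, fun x hx => ⟨hflt x hx, ?_, ?_⟩⟩
  · have h1 := homono (show b + 1 ≤ n from hb)
    rw [hosucc] at h1
    omega
  · exact (hlt x).trans_le ((homono (hflt x hx)).trans hon)
  · have hex : ∃ y ∈ R, idx y = idx x := ⟨x, hx, rfl⟩
    change (if h : ∃ y ∈ R, idx y = idx x then val h.choose else 0) = val x
    rw [dif_pos hex]
    congr 1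
    exact hidxinj _ hex.choose_spec.1 x hx hex.choose_spec.2

/-! ## Elementary bounds for predecessor structures -/

theorem RamExec.one_le {w S : ℕ} {p : RamProg} {σ τ : RamState} {k : ℕ}
    (h : RamExec w S p σ k τ) : 1 ≤ k := by
  induction h <;> omega

theorem RamExec.deterministic {w S : ℕ} {p : RamProg} {σ τ τ' : RamState} {k k' : ℕ}
    (h : RamExec w S p σ k τ) (h' : RamExec w S p σ k' τ') : τ = τ' := by
  induction h generalizing k' τ' with
  | skip σ => cases h'; rfl
  | const d c σ => cases h'; rfl
  | copy d i σ => cases h'; rfl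
  | op o d i j σ => cases h'; rfl
  | load d i σ hi => cases h'; rfl
  | store i j σ hi => cases h'; rfl
  | seq p q σ ρ τ k l _ _ ihp ihq =>
    cases h' with
    | seq _ _ _ ρ' _ _ _ hp' hq' =>
      obtain rfl := ihp hp'
      exact ihq hq'
  | ite_true c p q σ τ k hc _ ih =>
    cases h' with
    | ite_true _ _ _ _ _ _ _ hp' => exact ih hp'
    | ite_false _ _ _ _ _ _ hc' => exact absurd hc hc'
  | ite_false c p q σ τ k hc _ ih =>
    cases h' with
    | ite_true _ _ _ _ _ _ hc' => exact absurd hc' hc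
    | ite_false _ _ _ _ _ _ _ hq' => exact ih hq'
  | while_false c p σ hc =>
    cases h' with
    | while_false => rfl
    | while_true _ _ _ _ _ _ _ hc' => exact absurd hc' hc
  | while_true c p σ ρ τ k l hc _ _ ihp ihl =>
    cases h' with
    | while_false _ _ _ hc' => exact absurd hc hc'
    | while_true _ _ _ ρ' _ _ _ _ hp' hl' =>
      obtain rfl := ihp hp'
      exact ihl hl'

/-- A program that runs without any memory runs in the same way on every memory. -/
theorem RamExec.of_no_memory {w : ℕ} {p : RamProg} {σ τ : RamState} {k : ℕ}
    (h : RamExec w 0 p σ k τ) (S : ℕ) (M : ℕ → ℕ) :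
    RamExec w S p ⟨σ.reg, M⟩ k ⟨τ.reg, M⟩ := by
  induction h with
  | skip σ => exact .skip _
  | const d c σ => exact .const d c ⟨σ.reg, M⟩
  | copy d i σ => exact .copy d i ⟨σ.reg, M⟩
  | op o d i j σ => exact .op o d i j ⟨σ.reg, M⟩
  | load d i σ hi => exact absurd hi (Nat.not_lt_zero _)
  | store i j σ hi => exact absurd hi (Nat.not_lt_zero _)
  | seq p q σ ρ τ k l _ _ ihp ihq => exact .seq _ _ _ _ _ _ _ ihp ihq
  | ite_true c p q σ τ k hc _ ih => exact .ite_true _ _ _ _ _ _ hc ih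
  | ite_false c p q σ τ k hc _ ih => exact .ite_false _ _ _ _ _ _ hc ih
  | while_false c p σ hc => exact .while_false _ _ ⟨σ.reg, M⟩ hc
  | while_true c p σ ρ τ k l hc _ _ ihp ihl => exact .while_true _ _ _ _ _ _ _ hc ihp ihl

namespace IsPredecessorStructure

variable {a : ℕ} {t s : ℕ → ℕ → ℕ} {pred succ : RamProg}

theorem one_le_time (h : IsPredecessorStructure a t s pred succ) {N n : ℕ} (hN : 0 < N)
    (hn : n ≤ N) : 1 ≤ t N n := by
  obtain ⟨S, I, -, -, ⟨M, hM⟩, hI⟩ := h.2 N _ (Finset.range n) le_rfl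
    (Finset.range_subset_range.2 hn)
  obtain ⟨k, hk, τ, he, -⟩ := ((hI M hM).2 0 hN).1
  rw [Finset.card_range] at hk
  exact he.one_le.trans hk

/-- Without memory the program cannot tell `{0, …, n - 1}` from the empty set: by determinism both
runs on the query `0` give the same output, but the correct answers differ. -/
theorem one_le_space (h : IsPredecessorStructure a t s pred succ) {N n : ℕ} (hn : 0 < n)
    (hnN : n ≤ N) : 1 ≤ s N n := by
  by_contra hs
  obtain ⟨S, I, hS, -, ⟨M, hM⟩, hI⟩ := h.2 N _ (Finset.range n) le_rfl
    (Finset.range_subset_range.2 hnN)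
  obtain ⟨S', I', -, -, ⟨M', hM'⟩, hI'⟩ := h.2 N _ ∅ le_rfl (Finset.empty_subset _)
  rw [Finset.card_range] at hS
  obtain rfl : S = 0 := by omega
  obtain ⟨k, -, τ, he, hans, -⟩ := ((hI M hM).2 0 (by omega)).1
  obtain ⟨k', -, τ', he', hans', -⟩ := ((hI' M' hM').2 0 (by omega)).1
  have hst : (⟨τ.reg, M'⟩ : RamState) = τ' := (he.of_no_memory S' M').deterministic he'
  have hreg : τ.reg = τ'.reg := by rw [← hst]
  have h1 : τ.reg 0 = 1 := by
    rcases hans with h | h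
    · exact h.1
    · exact absurd le_rfl (h.2 0 (Finset.mem_range.2 hn))
  have h0 : τ'.reg 0 = 0 := by
    rcases hans' with h | h
    · exact absurd h.2.1.1 (Finset.notMem_empty _)
    · exact h.1
  rw [hreg, h0] at h1
  exact absurd h1 (by norm_num)

end IsPredecessorStructure

/-! ## Predecessor structures for the blocks of a level -/

/-- The first element of block `β` of size `2 ^ j` in the universe of size `N`; the last block is
moved to the left if necessary. -/
def blockStart (N j β : ℕ) : ℕ := min (β * 2 ^ j) (N - 2 ^ j)

/-- The elements of `R` in a block, relative to the start of the block. -/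
def blockSet (N j β : ℕ) (R : Finset ℕ) : Finset ℕ :=
  (R.filter fun x => blockStart N j β ≤ x ∧ x < blockStart N j β + 2 ^ j).image
    (· - blockStart N j β)

theorem mem_blockSet {N j β v : ℕ} {R : Finset ℕ} :
    v ∈ blockSet N j β R ↔ v + blockStart N j β ∈ R ∧ v < 2 ^ j := by
  rw [blockSet, Finset.mem_image]
  constructor
  · rintro ⟨x, hx, rfl⟩
    rw [Finset.mem_filter] at hx
    rw [Nat.sub_add_cancel hx.2.1]
    exact ⟨hx.1, by omega⟩
  · rintro ⟨h1, h2⟩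
    exact ⟨v + blockStart N j β, Finset.mem_filter.2 ⟨h1, by omega, by omega⟩, by omega⟩

theorem blockSet_subset (N j β : ℕ) (R : Finset ℕ) : blockSet N j β R ⊆ Finset.range (2 ^ j) :=
  fun _ hv => Finset.mem_range.2 (mem_blockSet.1 hv).2

theorem card_blockSet_le (N j β : ℕ) (R : Finset ℕ) : (blockSet N j β R).card ≤ R.card :=
  Finset.card_image_le.trans (Finset.card_filter_le _ _)

theorem card_blockSet_le_two_pow (N j β : ℕ) (R : Finset ℕ) :
    (blockSet N j β R).card ≤ 2 ^ j :=
  (Finset.card_le_card (blockSet_subset N j β R)).trans (by simp)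

open Classical in
/-- The space for the structure of a block. -/
noncomputable def blockSpace (s : ℕ → ℕ → ℕ) (N j β : ℕ) (R : Finset ℕ) : ℕ :=
  if β * 2 ^ j < N ∧ (blockSet N j β R).Nonempty then s (2 ^ j) (blockSet N j β R).card else 0

/-- The blocks that fit before `N` are disjoint and form one admissible family. At most one further
block exists; moved to the left it may overlap the others, so it forms a family of its own. This
gives the factor two. -/
theorem sum_blockSpace_le {s : ℕ → ℕ → ℕ} {K : ℕ}
    (hK : ∀ (N n : ℕ) (l : List (ℕ × ℕ)), (∀ x ∈ l, 1 ≤ x.2 ∧ x.2 ≤ x.1) →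
      (l.map Prod.fst).sum ≤ N → (l.map Prod.snd).sum ≤ n →
      (l.map fun x => s x.1 x.2).sum ≤ K * s N n)
    {N j : ℕ} {R : Finset ℕ} (hj : 2 ^ j ≤ N) :
    ∑ β ∈ Finset.range N, blockSpace s N j β R ≤ 2 * K * s N R.card := by
  classical
  have hpos : 0 < 2 ^ j := Nat.two_pow_pos j
  set act : Finset ℕ := (Finset.range N).filter fun β =>
    β * 2 ^ j < N ∧ (blockSet N j β R).Nonempty with hact
  set g : ℕ → ℕ := fun β => s (2 ^ j) (blockSet N j β R).card with hg
  have hsum : ∑ β ∈ Finset.range N, blockSpace s N j β R = ∑ β ∈ act, g β := by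
    rw [hact, Finset.sum_filter]
    exact Finset.sum_congr rfl fun β _ => by simp only [blockSpace, hg]
  rw [hsum, ← Finset.sum_filter_add_sum_filter_not act fun β => (β + 1) * 2 ^ j ≤ N]
  have hfam : ∀ F : Finset ℕ, F ⊆ act → F.card * 2 ^ j ≤ N →
      ∑ β ∈ F, (blockSet N j β R).card ≤ R.card → ∑ β ∈ F, g β ≤ K * s N R.card := by
    intro F hF h1 h2
    have := hK N R.card (F.toList.map fun β => (2 ^ j, (blockSet N j β R).card)) ?_ ?_ ?_
    · simpa [List.map_map, Function.comp_def, Finset.sum_map_toList] using this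
    · intro x hx
      obtain ⟨β, hβ, rfl⟩ := List.mem_map.1 hx
      have := hF (Finset.mem_toList.1 hβ)
      rw [hact, Finset.mem_filter] at this
      exact ⟨Finset.card_pos.2 this.2.2, card_blockSet_le_two_pow _ _ _ _⟩
    · simpa [List.map_map, Function.comp_def] using h1
    · simpa [List.map_map, Function.comp_def, Finset.sum_map_toList] using h2
  have hfull : ∑ β ∈ act.filter (fun β => (β + 1) * 2 ^ j ≤ N), g β ≤ K * s N R.card := by
    refine hfam _ (Finset.filter_subset _ _) ?_ ?_
    · have hsub : act.filter (fun β => (β + 1) * 2 ^ j ≤ N) ⊆ Finset.range (N / 2 ^ j) := by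
        intro β hβ
        rw [Finset.mem_filter] at hβ
        exact Finset.mem_range.2 ((Nat.le_div_iff_mul_le hpos).2 hβ.2)
      have := Finset.card_le_card hsub
      rw [Finset.card_range] at this
      exact (Nat.mul_le_mul_right _ this).trans (Nat.div_mul_le_self _ _)
    · have hle : ∀ β ∈ act.filter (fun β => (β + 1) * 2 ^ j ≤ N),
          (blockSet N j β R).card ≤ (R.filter fun x => x / 2 ^ j = β).card := by
        intro β hβ
        have h1 := (Finset.mem_filter.1 hβ).2
        have hst : blockStart N j β = β * 2 ^ j := by
          rw [blockStart, min_eq_left]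
          rw [Nat.succ_mul] at h1
          omega
        refine Finset.card_image_le.trans (Finset.card_le_card fun x hx => ?_)
        rw [Finset.mem_filter, hst] at hx
        rw [Finset.mem_filter]
        exact ⟨hx.1, Nat.div_eq_of_lt_le hx.2.1 (by rw [Nat.succ_mul]; exact hx.2.2)⟩
      refine (Finset.sum_le_sum hle).trans ?_
      rw [← Finset.card_biUnion]
      · exact Finset.card_le_card (Finset.biUnion_subset.2 fun _ _ => Finset.filter_subset _ _)
      · intro β _ β' _ hne
        refine Finset.disjoint_left.2 fun x hx hx' => hne ?_
        rw [Finset.mem_filter] at hx hx'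
        exact hx.2.symm.trans hx'.2
  have hlast : ∑ β ∈ act.filter (fun β => ¬ (β + 1) * 2 ^ j ≤ N), g β ≤ K * s N R.card := by
    have hsub : act.filter (fun β => ¬ (β + 1) * 2 ^ j ≤ N) ⊆ {N / 2 ^ j} := by
      intro β hβ
      rw [Finset.mem_filter, hact, Finset.mem_filter] at hβ
      rw [Finset.mem_singleton]
      exact (Nat.div_eq_of_lt_le hβ.1.2.1.le (not_le.1 hβ.2)).symm
    refine hfam _ (Finset.filter_subset _ _) ?_ ?_
    · have := Finset.card_le_card hsub
      rw [Finset.card_singleton] at this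
      exact (Nat.mul_le_mul_right _ this).trans (by simpa using hj)
    · exact (Finset.sum_le_sum_of_subset hsub).trans (by simpa using card_blockSet_le _ _ _ _)
  rw [two_mul, add_mul]
  exact add_le_add hfull hlast

theorem sum_range_mul_eq (L N : ℕ) (g : ℕ → ℕ) :
    ∑ i ∈ Finset.range (L * N), g i = ∑ j ∈ Finset.range L, ∑ b ∈ Finset.range N, g (j * N + b) := by
  induction L with
  | zero => simp
  | succ L ih => rw [Nat.succ_mul, Finset.sum_range_add, ih, Finset.sum_range_succ]

theorem two_pow_le_of_lt_bitLength {N j : ℕ} (hN : 0 < N) (hj : j < bitLength N) : 2 ^ j ≤ N :=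
  (Nat.le_log_iff_pow_le one_lt_two hN.ne').1 (Nat.lt_succ_iff.1 hj)

theorem lt_two_pow_bitLength (N : ℕ) : N < 2 ^ bitLength N :=
  Nat.lt_pow_succ_log_self one_lt_two N

theorem bitLength_two_pow (j : ℕ) : bitLength (2 ^ j) = j + 1 := by
  rw [bitLength, Nat.log_pow one_lt_two]

/-- Structures for all blocks of all levels; block `β` of level `j` has number `j * N + β`. -/
theorem exists_blockStructures {a : ℕ} {t s : ℕ → ℕ → ℕ} {pred succ : RamProg}
    (h : IsPredecessorStructure a t s pred succ) {K : ℕ}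
    (hK : ∀ (N n : ℕ) (l : List (ℕ × ℕ)), (∀ x ∈ l, 1 ≤ x.2 ∧ x.2 ≤ x.1) →
      (l.map Prod.fst).sum ≤ N → (l.map Prod.snd).sum ≤ n →
      (l.map fun x => s x.1 x.2).sum ≤ K * s N n)
    {N w : ℕ} {R : Finset ℕ} (hN : 0 < N) (hw : a * bitLength N ≤ w) :
    ∃ (S : ℕ → ℕ) (I : ℕ → Set (ℕ → ℕ)), (∀ i, (I i).Nonempty) ∧
      (∀ i, S i ≤ 2 ^ (a * bitLength N)) ∧
      (∑ i ∈ Finset.range (bitLength N * N), S i ≤ bitLength N * (2 * K * s N R.card)) ∧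
      (∀ i, ∀ M ∈ I i, ∀ x < S i, M x < 2 ^ w) ∧
      ∀ j < bitLength N, ∀ β, β * 2 ^ j < N → (blockSet N j β R).Nonempty →
        ∀ M ∈ I (j * N + β), ∀ q < 2 ^ j,
          AnswersWithin w (S (j * N + β)) (I (j * N + β)) pred (regInput q) M
            (t (2 ^ j) (blockSet N j β R).card) (IsPredAnswer (blockSet N j β R) q) := by
  classical
  have key : ∀ i, ∃ (S : ℕ) (I : Set (ℕ → ℕ)), I.Nonempty ∧ S ≤ 2 ^ (a * bitLength N) ∧
      S ≤ blockSpace s N (i / N) (i % N) R ∧ (∀ M ∈ I, ∀ x < S, M x < 2 ^ w) ∧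
      (i / N < bitLength N → i % N * 2 ^ (i / N) < N →
        (blockSet N (i / N) (i % N) R).Nonempty → ∀ M ∈ I, ∀ q < 2 ^ (i / N),
          AnswersWithin w S I pred (regInput q) M
            (t (2 ^ (i / N)) (blockSet N (i / N) (i % N) R).card)
            (IsPredAnswer (blockSet N (i / N) (i % N) R) q)) := by
    intro i
    by_cases hi : i / N < bitLength N ∧ i % N * 2 ^ (i / N) < N ∧
        (blockSet N (i / N) (i % N) R).Nonempty
    · have hbl : a * bitLength (2 ^ (i / N)) ≤ a * bitLength N := by
        rw [bitLength_two_pow]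
        exact Nat.mul_le_mul_left _ hi.1
      obtain ⟨S, I, h1, h2, h3, h4⟩ := h.2 (2 ^ (i / N)) w (blockSet N (i / N) (i % N) R)
        (hbl.trans hw) (blockSet_subset _ _ _ _)
      refine ⟨S, I, h3, h2.trans (Nat.pow_le_pow_right two_pos hbl), ?_, fun M hM => (h4 M hM).1,
        fun _ _ _ M hM q hq => ((h4 M hM).2 q hq).1⟩
      rw [blockSpace, if_pos hi.2]
      exact h1
    -- Numbers that belong to no block with an element of `R` get an empty memory.
    · exact ⟨0, Set.univ, Set.univ_nonempty, Nat.zero_le _, Nat.zero_le _,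
        fun _ _ x hx => absurd hx (Nat.not_lt_zero x), fun h1 h2 h3 => absurd ⟨h1, h2, h3⟩ hi⟩
  choose S I hne hS hS' hb hq using key
  refine ⟨S, I, hne, hS, ?_, hb, fun j hj β hβ hb' => ?_⟩
  · rw [sum_range_mul_eq]
    calc ∑ j ∈ Finset.range (bitLength N), ∑ b ∈ Finset.range N, S (j * N + b)
        ≤ ∑ _j ∈ Finset.range (bitLength N), 2 * K * s N R.card := by
          refine Finset.sum_le_sum fun j hj => le_trans (Finset.sum_le_sum fun b hb => ?_)
            (sum_blockSpace_le hK (two_pow_le_of_lt_bitLength hN (Finset.mem_range.1 hj)))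
          have hbN := Finset.mem_range.1 hb
          have := hS' (j * N + b)
          rwa [mul_comm j N, Nat.mul_add_div hN, Nat.div_eq_of_lt hbN, add_zero,
            Nat.mul_add_mod, Nat.mod_eq_of_lt hbN, mul_comm N j] at this
      _ = bitLength N * (2 * K * s N R.card) := by simp
  · have hβN : β < N := lt_of_le_of_lt (Nat.le_mul_of_pos_right _ (Nat.two_pow_pos j)) hβ
    have h1 : (j * N + β) / N = j := by
      rw [mul_comm, Nat.mul_add_div hN, Nat.div_eq_of_lt hβN, add_zero]
    have h2 : (j * N + β) % N = β := by
      rw [mul_comm, Nat.mul_add_mod, Nat.mod_eq_of_lt hβN]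
    have := hq (j * N + β)
    rw [h1, h2] at this
    exact this hj hβ hb'

/-! ## Memory layout -/

/-- The address of structure `i` in a memory that starts with `S₀` fixed words, followed by
structures of `S 0, S 1, …` words. -/
def layoutBase (S₀ : ℕ) (S : ℕ → ℕ) (i : ℕ) : ℕ := S₀ + ∑ x ∈ Finset.range i, S x

theorem layoutBase_succ (S₀ : ℕ) (S : ℕ → ℕ) (i : ℕ) :
    layoutBase S₀ S (i + 1) = layoutBase S₀ S i + S i := by
  rw [layoutBase, layoutBase, Finset.sum_range_succ, add_assoc]

theorem layoutBase_mono (S₀ : ℕ) (S : ℕ → ℕ) : Monotone (layoutBase S₀ S) :=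
  monotone_nat_of_le_succ fun i => by rw [layoutBase_succ]; omega

/-- The memories that start with the words `c 0, …, c (S₀ - 1)`, followed by `B` structures with
contents from the sets `I i`. -/
def layoutSet (S₀ : ℕ) (c : ℕ → ℕ) (B : ℕ) (S : ℕ → ℕ) (I : ℕ → Set (ℕ → ℕ)) : Set (ℕ → ℕ) :=
  {M | (∀ x < S₀, M x = c x) ∧
    ∀ i < B, ∃ M₁ ∈ I i, ∀ x < S i, M (layoutBase S₀ S i + x) = M₁ x}

section Layout

variable {S₀ B : ℕ} {c S : ℕ → ℕ} {I : ℕ → Set (ℕ → ℕ)}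

theorem layout_disjoint {i i' x : ℕ} (h : layoutBase S₀ S i ≤ x)
    (h' : x < layoutBase S₀ S i + S i) (h1 : layoutBase S₀ S i' ≤ x)
    (h1' : x < layoutBase S₀ S i' + S i') : i = i' := by
  rw [← layoutBase_succ] at h' h1'
  rcases lt_trichotomy i i' with hlt | heq | hlt
  · have := layoutBase_mono S₀ S (show i + 1 ≤ i' from hlt)
    omega
  · exact heq
  · have := layoutBase_mono S₀ S (show i' + 1 ≤ i from hlt)
    omega

theorem layoutSet_nonempty (hI : ∀ i, (I i).Nonempty) : (layoutSet S₀ c B S I).Nonempty := by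
  classical
  choose M hM using hI
  refine ⟨fun x => if x < S₀ then c x else if h : ∃ i, layoutBase S₀ S i ≤ x ∧
    x < layoutBase S₀ S i + S i then M h.choose (x - layoutBase S₀ S h.choose) else 0,
    fun x hx => if_pos hx, fun i hi => ⟨M i, hM i, fun x hx => ?_⟩⟩
  have h0 : ¬ layoutBase S₀ S i + x < S₀ := by rw [layoutBase]; omega
  have hex : ∃ i', layoutBase S₀ S i' ≤ layoutBase S₀ S i + x ∧
      layoutBase S₀ S i + x < layoutBase S₀ S i' + S i' := ⟨i, by omega, by omega⟩
  dsimp only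
  rw [if_neg h0, dif_pos hex]
  have heq : hex.choose = i :=
    layout_disjoint hex.choose_spec.1 hex.choose_spec.2 (by omega) (by omega)
  rw [heq, Nat.add_sub_cancel_left]

theorem layoutSet_lt {w : ℕ} (hc : ∀ x, c x < 2 ^ w) (hI : ∀ i, ∀ M ∈ I i, ∀ x < S i, M x < 2 ^ w)
    {M : ℕ → ℕ} (hM : M ∈ layoutSet S₀ c B S I) {x : ℕ} (hx : x < layoutBase S₀ S B) :
    M x < 2 ^ w := by
  by_cases h0 : x < S₀
  · rw [hM.1 x h0]
    exact hc x
  · have hex : ∀ b, x < layoutBase S₀ S b → ∃ i < b, layoutBase S₀ S i ≤ x ∧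
        x < layoutBase S₀ S i + S i := by
      intro b
      induction b with
      | zero => intro h; simp [layoutBase] at h; omega
      | succ b ih =>
        intro h
        by_cases hb : x < layoutBase S₀ S b
        · obtain ⟨i, hi, h'⟩ := ih hb
          exact ⟨i, by omega, h'⟩
        · exact ⟨b, by omega, by omega, by rwa [← layoutBase_succ]⟩
    obtain ⟨i, hi, h1, h2⟩ := hex B hx
    obtain ⟨M₁, hM₁, h⟩ := hM.2 i hi
    have := h (x - layoutBase S₀ S i) (by omega)
    rw [Nat.add_sub_cancel' h1] at this
    rw [this]
    exact hI i M₁ hM₁ _ (by omega)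

/-- A call changes only the cells of its own structure, which are disjoint from all others; thus the
invariant of the whole memory survives a query that modifies its data structure. -/
theorem mem_layoutSet_of_same_outside {M M' M₁ : ℕ → ℕ} (hM : M ∈ layoutSet S₀ c B S I) {i : ℕ}
    (hM₁ : M₁ ∈ I i) (h : ∀ x < S i, M' (layoutBase S₀ S i + x) = M₁ x)
    (h' : ∀ x, x < layoutBase S₀ S i ∨ layoutBase S₀ S i + S i ≤ x → M' x = M x) :
    M' ∈ layoutSet S₀ c B S I := by
  refine ⟨fun x hx => ?_, fun i' hi' => ?_⟩
  · rw [h' x (Or.inl (by rw [layoutBase]; omega))]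
    exact hM.1 x hx
  · by_cases hii : i' = i
    · subst hii
      exact ⟨M₁, hM₁, h⟩
    · obtain ⟨M₂, hM₂, h2⟩ := hM.2 i' hi'
      refine ⟨M₂, hM₂, fun x hx => ?_⟩
      rw [← h2 x hx]
      apply h'
      by_contra hcon
      push Not at hcon
      exact hii (layout_disjoint (x := layoutBase S₀ S i' + x) (by omega) (by omega) hcon.1
        hcon.2)

end Layout

/-! ## Finger queries -/

namespace RamExpr

/-- Entry `i` of the table of parameters. -/
def param (i : ℕ) : RamExpr := cell 0 (.const i)

/-- The bucket of the first hash function for the key `v`. -/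
def firstHash (v : RamExpr) : RamExpr := .op .mod (.op .mod (.op .mul (param 3) v) (param 2)) (param 4)

/-- Look up the key `v` in the dictionary. -/
def lookup (v : RamExpr) : RamExpr :=
  cell 5 (.op .add (cell 4 (firstHash v)) (.op .mod (.op .mod (.op .mul (cell 2 (firstHash v)) v)
    (param 2)) (cell 3 (firstHash v))))

/-- The smallest element of group `i`. -/
def groupMin (i : RamExpr) : RamExpr := cell 1 (.op .mul (.op .add i (.const 1)) (param 5))

theorem Ev.var_eq {w S V : ℕ} {r M : ℕ → ℕ} {i v : ℕ} (hi : i < V) (h : r i = v) :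
    Ev w S V r M (RamExpr.var i) v := h ▸ Ev.var hi

end RamExpr

theorem RunsWithin.assign_seq {w S V d v T : ℕ} {e : RamExpr} {q : RamProg} {r M : ℕ → ℕ}
    {Q : (ℕ → ℕ) → (ℕ → ℕ) → Prop} (hd : d < V) (h : RamExpr.Ev w S V r M e v)
    (hq : RunsWithin w S V q (Function.update r d v) M T Q) :
    RunsWithin w S V (.seq (.assign V d e) q) r M (e.cost + 1 + T) Q := by
  refine RunsWithin.seq (Q := fun r' M' => r' = Function.update r d v ∧ M' = M)
    (RunsWithin.assign hd h ⟨rfl, rfl⟩) ?_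
  rintro _ _ ⟨rfl, rfl⟩
  exact hq

/-- The parameters that are stored at the beginning of the memory. -/
def fingerParam (N l p a n Z m : ℕ) (i : ℕ) : ℕ := [N, l, p, a, n, Z, m].getD i 0

/-- The memory `M` holds the static part of a finger search structure for the set of the `n` elements
`y 0 < y 1 < …` of `{0, …, N - 1}`, in `m` groups of `l` elements: a dictionary, search trees for
the powers of two and for the groups, and the tables `ptr` and `cc` for the blocks near the smallest
element of each group. -/
structure FingerMem (w S k N n l m p a : ℕ) (y A m₂ o : ℕ → ℕ) (ptr cc : ℕ → ℕ → ℕ)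
    (M : ℕ → ℕ) : Prop where
  w_pos : 16 < 2 ^ w
  S_le : S ≤ 2 ^ w
  N_lt : N + 2 < 2 ^ w
  N_lt' : N < 2 ^ l
  l_pos : 0 < l
  level_le : ∀ j < l, 2 ^ j ≤ N
  mono : ∀ i j, i < j → j < n → y i < y j
  lt_N : ∀ i < n, y i < N
  group : ∀ i, i < m ↔ i * l < n
  param_room : 112 ≤ S
  param : ∀ i < 7, M (i * 16 + 0) = fingerParam N l p a n (treeSize k 16) m i
  tree_room : (m + 1) * treeSize k 16 * 16 ≤ S
  powers : ∃ T, IsSearchTree w 16 5 6 k l 16 l (fun i => 2 ^ i) (fun i => i) T ∧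
    ∀ x < treeSize k 16, M ((0 + x) * 16 + 1) = T x
  groups : ∀ i < m, ∃ T, IsSearchTree w 16 5 6 k l 16 (min l (n - i * l)) (fun x => y (i * l + x))
    (fun x => if i * l + x + 1 < n then y (i * l + x + 1) + 1 else 0) T ∧
    ∀ x < treeSize k 16, M (((i + 1) * treeSize k 16 + x) * 16 + 1) = T x
  hash_room : ∀ g < n, a * y g < 2 ^ w ∧ (modHash a p n (y g) + 1) * 16 ≤ S ∧
    A (modHash a p n (y g)) * y g < 2 ^ w
  hash : ∀ g < n, M (modHash a p n (y g) * 16 + 2) = A (modHash a p n (y g)) ∧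
    M (modHash a p n (y g) * 16 + 3) = m₂ (modHash a p n (y g)) ∧
    M (modHash a p n (y g) * 16 + 4) = o (modHash a p n (y g))
  cell : ∀ g < n, (o (modHash a p n (y g)) + modHash (A (modHash a p n (y g))) p
      (m₂ (modHash a p n (y g))) (y g) + 1) * 16 ≤ S ∧
    M ((o (modHash a p n (y g)) + modHash (A (modHash a p n (y g))) p
      (m₂ (modHash a p n (y g))) (y g)) * 16 + 5) = g / l
  record_room : (m * l * 5) * 16 ≤ S
  record : ∀ i < m, ∀ j < l, ∀ e < 5, ∀ β, β + 2 = y (i * l) / 2 ^ j + e → β * 2 ^ j < N →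
    M (((i * l + j) * 5 + e) * 16 + 6) = ptr j β ∧ M (((i * l + j) * 5 + e) * 16 + 7) = cc j β
  count : ∀ j < l, ∀ β, cc j β =
    m - ((Finset.range m).filter fun i => blockStart N j β ≤ y (i * l)).card

namespace FingerMem

variable {w S k N n l m p a : ℕ} {y A m₂ o : ℕ → ℕ} {ptr cc : ℕ → ℕ → ℕ} {M : ℕ → ℕ} {V : ℕ}
  {r : ℕ → ℕ}

theorem treeSize_pos : 2 ≤ treeSize k 16 := by rw [treeSize]; omega

theorem ev_param (h : FingerMem w S k N n l m p a y A m₂ o ptr cc M) {i : ℕ} (hi : i < 7) :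
    RamExpr.Ev w S V r M (.param i) (fingerParam N l p a n (treeSize k 16) m i) := by
  have h1 := h.param_room
  have h2 := h.w_pos
  exact RamExpr.Ev.cell (RamExpr.Ev.const (by omega)) h.w_pos h.S_le (by omega) (h.param i hi)

theorem ev_lookup (h : FingerMem w S k N n l m p a y A m₂ o ptr cc M) {e : RamExpr} {g x : ℕ}
    (hg : g < n) (hx : x = y g) (he : RamExpr.Ev w S V r M e x) :
    RamExpr.Ev w S V r M (.lookup e) (g / l) := by
  subst hx
  obtain ⟨h1, h2, h3⟩ := h.hash_room g hg
  obtain ⟨h4, h5, h6⟩ := h.hash g hg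
  obtain ⟨h7, h8⟩ := h.cell g hg
  have hS := h.S_le
  have hb : RamExpr.Ev w S V r M (.firstHash e) (modHash a p n (y g)) :=
    RamExpr.Ev.mod (RamExpr.Ev.mod (RamExpr.Ev.mul (h.ev_param (i := 3) (by norm_num)) he h1)
      (h.ev_param (i := 2) (by norm_num))) (h.ev_param (i := 4) (by norm_num))
  have hA := RamExpr.Ev.cell hb h.w_pos hS (by omega) h4
  have hm := RamExpr.Ev.cell hb h.w_pos hS (by omega) h5
  have ho := RamExpr.Ev.cell hb h.w_pos hS (by omega) h6
  exact RamExpr.Ev.cell (RamExpr.Ev.add ho (RamExpr.Ev.mod (RamExpr.Ev.mod (RamExpr.Ev.mul hA he h3)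
    (h.ev_param (i := 2) (by norm_num))) hm) (by
      change o (modHash a p n (y g)) + modHash (A (modHash a p n (y g))) p
        (m₂ (modHash a p n (y g))) (y g) < 2 ^ w
      omega)) h.w_pos hS (by
      change (o (modHash a p n (y g)) + modHash (A (modHash a p n (y g))) p
        (m₂ (modHash a p n (y g))) (y g)) * 16 + 5 < S
      omega) h8

theorem group_room (h : FingerMem w S k N n l m p a y A m₂ o ptr cc M) {i : ℕ} (hi : i < m) :
    ((i + 1) * treeSize k 16 + treeSize k 16) * 16 ≤ S := by
  have h1 := Nat.mul_le_mul_right (treeSize k 16) (show i + 1 + 1 ≤ m + 1 by omega)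
  rw [Nat.succ_mul (i + 1)] at h1
  have := h.tree_room
  omega

theorem ev_groupMin (h : FingerMem w S k N n l m p a y A m₂ o ptr cc M) {e : RamExpr} {i : ℕ}
    (hi : i < m) (he : RamExpr.Ev w S V r M e i) :
    RamExpr.Ev w S V r M (.groupMin e) (y (i * l)) := by
  have h1 := h.group_room hi
  have h2 := treeSize_pos (k := k)
  have hS := h.S_le
  have h3 : i + 1 ≤ (i + 1) * treeSize k 16 := Nat.le_mul_of_pos_right _ (by omega)
  have hw := h.w_pos
  obtain ⟨T, hT, hTM⟩ := h.groups i hi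
  have h4 := hTM 0 (by omega)
  rw [add_zero, hT.2.1] at h4
  dsimp only at h4
  rw [add_zero] at h4
  exact RamExpr.Ev.cell (RamExpr.Ev.mul (RamExpr.Ev.add he (RamExpr.Ev.const (by omega)) (by omega))
    (h.ev_param (i := 5) (by norm_num)) (by
      change (i + 1) * treeSize k 16 < 2 ^ w
      omega)) h.w_pos hS (by
      change (i + 1) * treeSize k 16 * 16 + 1 < S
      omega) h4

theorem mono_le (h : FingerMem w S k N n l m p a y A m₂ o ptr cc M) {i j : ℕ} (hij : i ≤ j)
    (hj : j < n) : y i ≤ y j := by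
  rcases hij.eq_or_lt with rfl | hlt
  · exact le_rfl
  · exact (h.mono i j hlt hj).le

theorem group_mono (h : FingerMem w S k N n l m p a y A m₂ o ptr cc M) {i j : ℕ} (hij : i < j)
    (hj : j < m) : y (i * l) < y (j * l) :=
  h.mono _ _ (Nat.mul_lt_mul_of_pos_right hij h.l_pos) ((h.group j).1 hj)

end FingerMem

/-- `A` is the number of groups whose smallest element is at most `q`. -/
def IsGroupRank (m l : ℕ) (y : ℕ → ℕ) (q A : ℕ) : Prop := A ≤ m ∧ ∀ i < m, y (i * l) ≤ q ↔ i < A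

/-- Put the group of the finger into variable `2`, and into variable `3` the group next to the finger
whose smallest element lies between the finger and the query point (or `m`). -/
def selectGroup : RamProg :=
  .seq (.assign 16 2 (.lookup (.var 0)))
    (.seq (.assign 16 3 (.ifLt (.var 1) (.groupMin (.var 2)) (.var 2)
      (.ifLt (.op .add (.var 2) (.const 1)) (.param 6)
        (.ifLt (.var 1) (.groupMin (.op .add (.var 2) (.const 1))) (.param 6)
          (.op .add (.var 2) (.const 1))) (.param 6))))
      (.assign 16 6 (.param 6)))

/-- A bound for the number of steps of a program, if it consists of assignments, case distinctions
and descents in trees of height `16`. -/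
def selectGroupCost : ℕ :=
  (RamExpr.lookup (.var 0)).cost + 1 + ((RamExpr.ifLt (.var 1) (.groupMin (.var 2)) (.var 2)
      (.ifLt (.op .add (.var 2) (.const 1)) (.param 6)
        (.ifLt (.var 1) (.groupMin (.op .add (.var 2) (.const 1))) (.param 6)
          (.op .add (.var 2) (.const 1))) (.param 6))).cost + 1 + ((RamExpr.param 6).cost + 1))

/-! ### The stages of a finger query -/

section Query

variable {w S k N n l m p a : ℕ} {y A m₂ o : ℕ → ℕ} {ptr cc : ℕ → ℕ → ℕ} {M : ℕ → ℕ}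
  {r : ℕ → ℕ}

/-- Only the minimum of the finger's group and the next minimum matter. If `q` is below the first,
that one lies between `q` and the finger; if `q` has reached the second, that one does. Otherwise
the rank is known, which the value `m` in variable `3` signals. -/
theorem run_selectGroup (h : FingerMem w S k N n l m p a y A m₂ o ptr cc M) {g q : ℕ} (hg : g < n)
    (h0 : r 0 = y g) (h1 : r 1 = q) :
    RunsWithin w S 16 selectGroup r M selectGroupCost fun r' M' => M' = M ∧ r' 0 = y g ∧ r' 1 = q ∧
      r' 2 = g / l ∧ r' 6 = m ∧ ((r' 3 = m ∧ IsGroupRank m l y q (g / l + 1) ∧ g / l < m) ∨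
        (r' 3 < m ∧ y g ≠ q ∧ ((y g ≤ y (r' 3 * l) ∧ y (r' 3 * l) ≤ q) ∨
          (q ≤ y (r' 3 * l) ∧ y (r' 3 * l) ≤ y g)))) := by
  set i := g / l with hi
  have hl := h.l_pos
  have hil : i * l ≤ g := Nat.div_mul_le_self _ _
  have hgi : g < (i + 1) * l := by rw [mul_comm]; exact Nat.lt_mul_div_succ g hl
  have him : i < m := (h.group i).2 (by omega)
  have hyi := h.mono_le hil hg
  have hroom := h.group_room him
  have hS := h.S_le
  have hw := h.w_pos
  have hsz := FingerMem.treeSize_pos (k := k)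
  have hi1 : i + 1 ≤ (i + 1) * treeSize k 16 := Nat.le_mul_of_pos_right _ (by omega)
  have hfin : ∀ v, ((v = m ∧ IsGroupRank m l y q (i + 1)) ∨
      (v < m ∧ y g ≠ q ∧ ((y g ≤ y (v * l) ∧ y (v * l) ≤ q) ∨
        (q ≤ y (v * l) ∧ y (v * l) ≤ y g)))) →
      RamExpr.Ev w S 16 (Function.update r 2 i) M (.ifLt (.var 1) (.groupMin (.var 2)) (.var 2)
        (.ifLt (.op .add (.var 2) (.const 1)) (.param 6)
          (.ifLt (.var 1) (.groupMin (.op .add (.var 2) (.const 1))) (.param 6)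
            (.op .add (.var 2) (.const 1))) (.param 6))) v →
      RunsWithin w S 16 selectGroup r M selectGroupCost fun r' M' => M' = M ∧ r' 0 = y g ∧ r' 1 = q ∧
        r' 2 = i ∧ r' 6 = m ∧ ((r' 3 = m ∧ IsGroupRank m l y q (i + 1) ∧ i < m) ∨
        (r' 3 < m ∧ y g ≠ q ∧ ((y g ≤ y (r' 3 * l) ∧ y (r' 3 * l) ≤ q) ∨
          (q ≤ y (r' 3 * l) ∧ y (r' 3 * l) ≤ y g)))) := by
    intro v hv hev
    refine RunsWithin.assign_seq (by norm_num) (h.ev_lookup hg h0 (RamExpr.Ev.var (by norm_num))) ?_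
    refine RunsWithin.assign_seq (by norm_num) hev ?_
    refine RunsWithin.assign (by norm_num) (h.ev_param (i := 6) (by norm_num)) ?_
    refine ⟨rfl, by simp [h0], by simp [h1], by simp [hi], by simp [fingerParam], ?_⟩
    rw [show ∀ x, Function.update (Function.update (Function.update r 2 i) 3 v) 6 x 3 = v from
      fun x => by simp]
    rcases hv with ⟨hv1, hv2⟩ | hv
    · exact Or.inl ⟨hv1, hv2, him⟩
    · exact Or.inr hv
  have e1 : RamExpr.Ev w S 16 (Function.update r 2 i) M (.var 1) q :=
    RamExpr.Ev.var_eq (by norm_num) (by simp [h1])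
  have e2 : RamExpr.Ev w S 16 (Function.update r 2 i) M (.var 2) i :=
    RamExpr.Ev.var_eq (by norm_num) (by simp)
  have e3 : RamExpr.Ev w S 16 (Function.update r 2 i) M (.op .add (.var 2) (.const 1)) (i + 1) :=
    RamExpr.Ev.add e2 (RamExpr.Ev.const (by omega)) (by omega)
  have e4 : RamExpr.Ev w S 16 (Function.update r 2 i) M (.param 6) m :=
    h.ev_param (i := 6) (by norm_num)
  by_cases c1 : q < y (i * l)
  · exact hfin i (Or.inr ⟨him, by omega, Or.inr ⟨by omega, hyi⟩⟩)
      (RamExpr.Ev.ifLt_true e1 (h.ev_groupMin him e2) c1 e2)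
  have hrank : (i + 1 < m → q < y ((i + 1) * l)) → IsGroupRank m l y q (i + 1) := by
    intro hlt
    refine ⟨him, fun i' hi' => ⟨fun hle => ?_, fun hle => ?_⟩⟩
    · by_contra hcon
      have hm : i + 1 < m := by omega
      have h2 := hlt hm
      rcases (show i + 1 ≤ i' by omega).eq_or_lt with heq | hlt'
      · rw [← heq] at hle; omega
      · have := h.group_mono hlt' hi'; omega
    · have := h.mono_le (Nat.mul_le_mul_right l (show i' ≤ i by omega)) (by omega : i * l < n)
      omega
  by_cases c2 : i + 1 < m
  · by_cases c3 : q < y ((i + 1) * l)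
    · exact hfin m (Or.inl ⟨rfl, hrank fun _ => c3⟩) (RamExpr.Ev.ifLt_false e1
        (h.ev_groupMin him e2) c1 (RamExpr.Ev.ifLt_true e3 e4 c2
          (RamExpr.Ev.ifLt_true e1 (h.ev_groupMin c2 e3) c3 e4)))
    · have h5 := h.mono g _ hgi ((h.group _).1 c2)
      exact hfin (i + 1) (Or.inr ⟨c2, by omega, Or.inl ⟨h5.le, by omega⟩⟩)
        (RamExpr.Ev.ifLt_false e1 (h.ev_groupMin him e2) c1 (RamExpr.Ev.ifLt_true e3 e4 c2
          (RamExpr.Ev.ifLt_false e1 (h.ev_groupMin c2 e3) c3 e3)))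
  · exact hfin m (Or.inl ⟨rfl, hrank fun h => absurd h c2⟩) (RamExpr.Ev.ifLt_false e1
      (h.ev_groupMin him e2) c1 (RamExpr.Ev.ifLt_false e3 e4 c2 e4))

/-- The distance of the finger and the query point. -/
def distExpr : RamExpr :=
  .ifLt (.var 0) (.var 1) (.op .sub (.var 1) (.var 0)) (.op .sub (.var 0) (.var 1))

/-- Put the binary logarithm of the distance of finger and query point into variable `4`. -/
def findLevel : RamProg :=
  .seq (.assign 16 6 distExpr) (.seq (.assign 16 5 (.const 0)) (.seq (.descend 16 5 6 16)
    (.assign 16 4 (.cell 1 (.op .add (.var 5) (.const 1))))))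

/-- See `selectGroupCost`. -/
def findLevelCost : ℕ :=
  distExpr.cost + 1 + ((RamExpr.const 0).cost + 1 + (descendCost 5 6 16 +
    ((RamExpr.cell 1 (.op .add (.var 5) (.const 1))).cost + 1)))

/-- The logarithm is a predecessor search among the powers of two, in a tree whose associated
information is the exponent. -/
theorem run_findLevel (h : FingerMem w S k N n l m p a y A m₂ o ptr cc M) {f q : ℕ} (hf : f < N)
    (hq : q < N) (hfq : f ≠ q) (h0 : r 0 = f) (h1 : r 1 = q) :
    RunsWithin w S 16 findLevel r M findLevelCost fun r' M' => M' = M ∧ r' 0 = f ∧ r' 1 = q ∧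
      r' 3 = r 3 ∧ r' 4 < l ∧ 2 ^ r' 4 ≤ Nat.dist f q ∧ Nat.dist f q < 2 ^ (r' 4 + 1) := by
  set D := Nat.dist f q with hD
  have hw := h.w_pos
  have hS := h.S_le
  have hNl := h.N_lt'
  have hNw := h.N_lt
  have hD0 : 0 < D := Nat.dist_pos_of_ne hfq
  have hDN : D < N := by rw [hD, Nat.dist]; omega
  have hsz := FingerMem.treeSize_pos (k := k)
  have hroom := h.tree_room
  have hroom' : treeSize k 16 ≤ (m + 1) * treeSize k 16 := Nat.le_mul_of_pos_left _ (by omega)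
  have ed : RamExpr.Ev w S 16 r M distExpr D := by
    by_cases c : f < q
    · refine RamExpr.Ev.ifLt_true (RamExpr.Ev.var_eq (by norm_num) h0)
        (RamExpr.Ev.var_eq (by norm_num) h1) c ?_
      refine (RamExpr.Ev.sub (RamExpr.Ev.var_eq (by norm_num) h1)
        (RamExpr.Ev.var_eq (by norm_num) h0) c.le (by omega)).cast ?_
      rw [hD, Nat.dist]; omega
    · refine RamExpr.Ev.ifLt_false (RamExpr.Ev.var_eq (by norm_num) h0)
        (RamExpr.Ev.var_eq (by norm_num) h1) c ?_
      refine (RamExpr.Ev.sub (RamExpr.Ev.var_eq (by norm_num) h0)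
        (RamExpr.Ev.var_eq (by norm_num) h1) (by omega) (by omega)).cast ?_
      rw [hD, Nat.dist]; omega
  obtain ⟨T, hT, hTM⟩ := h.powers
  refine RunsWithin.assign_seq (by norm_num) ed ?_
  refine RunsWithin.assign_seq (v := 0) (by norm_num) (RamExpr.Ev.const (by omega)) ?_
  obtain ⟨j, v, hj, hv, -, hMv, hrun⟩ := hT.2.2 S 0 D M
    (Function.update (Function.update r 6 D) 5 0) hS (by omega) hTM (by omega)
    (show 2 ^ 0 ≤ D by rw [pow_zero]; exact hD0) (by simp) (by simp)
  refine RunsWithin.seq hrun ?_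
  rintro r' M' ⟨rfl, rfl⟩
  refine RunsWithin.assign (v := j) (by norm_num) (RamExpr.Ev.cell (x := v + 1)
    (RamExpr.Ev.add (RamExpr.Ev.var_eq (by norm_num) (by simp)) (RamExpr.Ev.const (by omega))
      (by omega)) hw hS (by omega) hMv) ?_
  refine ⟨rfl, by simp [h0], by simp [h1], by simp, ?_⟩
  simp only [Function.update_self]
  refine ⟨hj.1, hj.2.1, ?_⟩
  by_contra hcon
  rw [not_lt] at hcon
  have h2 : j + 1 < l := (Nat.pow_lt_pow_iff_right (by norm_num : 1 < 2)).1 (by omega)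
  have := hj.2.2 (j + 1) h2 hcon
  omega

/-- The start of the block of the query point. -/
def startExpr : RamExpr :=
  .ifLt (.op .shl (.op .shr (.var 1) (.var 4)) (.var 4))
    (.op .sub (.param 0) (.op .shl (.const 1) (.var 4)))
    (.op .shl (.op .shr (.var 1) (.var 4)) (.var 4))
    (.op .sub (.param 0) (.op .shl (.const 1) (.var 4)))

/-- The index of the record for the block of the query point in the tables for group `3`. -/
def recordExpr : RamExpr :=
  .op .add (.op .mul (.op .add (.op .mul (.var 3) (.param 1)) (.var 4)) (.const 5))
    (.op .sub (.op .add (.op .shr (.var 1) (.var 4)) (.const 2))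
      (.op .shr (.groupMin (.var 3)) (.var 4)))

/-- Find the record for the block of the query point. -/
def findBlock : RamProg :=
  .seq (.assign 16 13 startExpr) (.seq (.assign 16 15 recordExpr)
    (.seq (.assign 16 8 (.cell 6 (.var 15))) (.seq (.assign 16 14 (.cell 7 (.var 15)))
      (.seq (.assign 16 10 (.op .sub (.var 1) (.var 13))) (.assign 16 6 (.const 0))))))

/-- See `selectGroupCost`. -/
def findBlockCost : ℕ :=
  startExpr.cost + 1 + (recordExpr.cost + 1 + ((RamExpr.cell 6 (.var 15)).cost + 1 +
    ((RamExpr.cell 7 (.var 15)).cost + 1 + ((RamExpr.op .sub (.var 1) (.var 13)).cost + 1 +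
      ((RamExpr.const 0).cost + 1)))))

theorem blockStart_le {q j : ℕ} : blockStart N j (q / 2 ^ j) ≤ q :=
  (min_le_left _ _).trans (Nat.div_mul_le_self _ _)

theorem lt_blockStart_add {q j : ℕ} (hq : q < N) :
    q < blockStart N j (q / 2 ^ j) + 2 ^ j := by
  have h1 : q < q / 2 ^ j * 2 ^ j + 2 ^ j := by
    have := Nat.lt_mul_div_succ q (Nat.two_pow_pos j)
    rw [mul_comm, Nat.succ_mul] at this
    exact this
  rw [blockStart]
  omega

/-- Points at distance less than `2 ^ (j + 1)` have block numbers that differ by at most two. The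
shift by two makes the index `e` of the record range over `0, …, 4` in natural numbers. -/
theorem run_findBlock (h : FingerMem w S k N n l m p a y A m₂ o ptr cc M) {q i j : ℕ}
    (hq : q < N) (hi : i < m) (hj : j < l) (h1 : r 1 = q) (h3 : r 3 = i) (h4 : r 4 = j)
    (hd : Nat.dist (y (i * l)) q < 2 ^ (j + 1)) :
    RunsWithin w S 16 findBlock r M findBlockCost fun r' M' => M' = M ∧ r' 1 = q ∧ r' 6 = 0 ∧
      r' 8 = ptr j (q / 2 ^ j) ∧ r' 14 = cc j (q / 2 ^ j) ∧
      r' 13 = blockStart N j (q / 2 ^ j) ∧ r' 10 = q - blockStart N j (q / 2 ^ j) := by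
  have hw := h.w_pos
  have hS := h.S_le
  have hNw := h.N_lt
  have hjN := h.level_le j hj
  have hβ : q / 2 ^ j * 2 ^ j ≤ q := Nat.div_mul_le_self _ _
  have hy : y (i * l) < N := h.lt_N _ ((h.group i).1 hi)
  have hpos := Nat.two_pow_pos j
  obtain ⟨e, he, heβ⟩ : ∃ e < 5, q / 2 ^ j + 2 = y (i * l) / 2 ^ j + e := by
    have h5 : q < y (i * l) + 2 ^ j * 2 := by
      rw [Nat.dist, pow_succ] at hd; omega
    have h6 : y (i * l) < q + 2 ^ j * 2 := by
      rw [Nat.dist, pow_succ] at hd; omega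
    have h7 : q / 2 ^ j ≤ (y (i * l) + 2 ^ j * 2) / 2 ^ j := Nat.div_le_div_right h5.le
    have h8 : y (i * l) / 2 ^ j ≤ (q + 2 ^ j * 2) / 2 ^ j := Nat.div_le_div_right h6.le
    rw [Nat.add_mul_div_left _ _ hpos] at h7 h8
    exact ⟨q / 2 ^ j + 2 - y (i * l) / 2 ^ j, by omega, by omega⟩
  obtain ⟨hM6, hM7⟩ := h.record i hi j hj e he (q / 2 ^ j) heβ (by omega)
  have hidx : (i * l + j) * 5 + e < m * l * 5 := by
    have h5 := Nat.mul_le_mul_right l (show i + 1 ≤ m from hi)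
    rw [Nat.succ_mul] at h5
    omega
  have hroom := h.record_room
  have hquot : q / 2 ^ j ≤ q := Nat.div_le_self _ _
  have hlw : j < 2 ^ w := by have := Nat.lt_two_pow_self (n := j); omega
  have eq' : ∀ {r : ℕ → ℕ}, r 1 = q → r 4 = j →
      RamExpr.Ev w S 16 r M (.op .shr (.var 1) (.var 4)) (q / 2 ^ j) := fun h1 h4 =>
    (RamExpr.Ev.shr (RamExpr.Ev.var_eq (by norm_num) h1)
      (RamExpr.Ev.var_eq (by norm_num) h4)).cast (Nat.shiftRight_eq_div_pow _ _)
  have es1 : RamExpr.Ev w S 16 r M (.op .shl (.op .shr (.var 1) (.var 4)) (.var 4))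
      (q / 2 ^ j * 2 ^ j) :=
    RamExpr.Ev.shl (eq' h1 h4) (RamExpr.Ev.var_eq (by norm_num) h4) (by omega)
  have es2 : RamExpr.Ev w S 16 r M (.op .sub (.param 0) (.op .shl (.const 1) (.var 4)))
      (N - 2 ^ j) := by
    have := RamExpr.Ev.shl (RamExpr.Ev.const (w := w) (S := S) (V := 16) (r := r) (M := M) (c := 1)
      (by omega)) (RamExpr.Ev.var_eq (by norm_num) h4) (by omega)
    rw [one_mul] at this
    exact RamExpr.Ev.sub (h.ev_param (i := 0) (by norm_num)) this hjN (by omega)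
  have es : RamExpr.Ev w S 16 r M startExpr (blockStart N j (q / 2 ^ j)) := by
    refine (RamExpr.Ev.ite es1 es2 (fun _ => es1) fun _ => es2).cast ?_
    rw [blockStart]
    split_ifs <;> omega
  refine RunsWithin.assign_seq (by norm_num) es ?_
  set r1 := Function.update r 13 (blockStart N j (q / 2 ^ j)) with hr1
  have a1 : r1 1 = q := by simp [hr1, h1]
  have a3 : r1 3 = i := by simp [hr1, h3]
  have a4 : r1 4 = j := by simp [hr1, h4]
  have er : RamExpr.Ev w S 16 r1 M recordExpr ((i * l + j) * 5 + e) := by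
    have e3 : RamExpr.Ev w S 16 r1 M (.var 3) i := RamExpr.Ev.var_eq (by norm_num) a3
    have e4 : RamExpr.Ev w S 16 r1 M (.var 4) j := RamExpr.Ev.var_eq (by norm_num) a4
    have es := RamExpr.Ev.shr (h.ev_groupMin hi e3) e4
    rw [Nat.shiftRight_eq_div_pow] at es
    have ee := RamExpr.Ev.sub (RamExpr.Ev.add (eq' a1 a4) (RamExpr.Ev.const (c := 2) (by omega))
      (by omega)) es (by omega) (by omega)
    rw [show q / 2 ^ j + 2 - y (i * l) / 2 ^ j = e by omega] at ee
    have el : RamExpr.Ev w S 16 r1 M (.param 1) l := h.ev_param (i := 1) (by norm_num)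
    exact RamExpr.Ev.add (RamExpr.Ev.mul (RamExpr.Ev.add (RamExpr.Ev.mul e3 el (by omega)) e4
      (by omega)) (RamExpr.Ev.const (by omega)) (by omega)) ee (by omega)
  refine RunsWithin.assign_seq (by norm_num) er ?_
  refine RunsWithin.assign_seq (by norm_num) (RamExpr.Ev.cell (RamExpr.Ev.var_eq (by norm_num)
    (by simp)) hw hS (by omega) hM6) ?_
  refine RunsWithin.assign_seq (by norm_num) (RamExpr.Ev.cell (RamExpr.Ev.var_eq (by norm_num)
    (by simp)) hw hS (by omega) hM7) ?_
  refine RunsWithin.assign_seq (by norm_num) (RamExpr.Ev.sub (RamExpr.Ev.var_eq (by norm_num)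
    (by simpa using a1)) (RamExpr.Ev.var_eq (by norm_num) (by simp [hr1])) (blockStart_le (N := N) (j := j))
    (by omega)) ?_
  refine RunsWithin.assign (by norm_num) (RamExpr.Ev.const (c := 0) (by omega)) ?_
  refine ⟨rfl, by simpa using a1, by simp, by simp, by simp, by simp [hr1], by simp⟩

/-- Compute the group rank of the query point with the structure for its block. -/
def searchBlock (pred : RamProg) : RamProg :=
  .ite (.lt 6 8) (.seq (.call 16 8 9 10 11 12 pred) (.assign 16 7 (.ifLt (.const 0) (.var 11)
      (.op .add (.lookup (.op .add (.var 12) (.var 13))) (.const 1)) (.var 14))))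
    (.assign 16 7 (.var 14))

/-- The number of steps of `searchBlock` other than those of the predecessor query. -/
def searchBlockCost (pred : RamProg) : ℕ :=
  max 2 pred.regBound + 4 + ((RamExpr.ifLt (.const 0) (.var 11)
      (.op .add (.lookup (.op .add (.var 12) (.var 13))) (.const 1)) (.var 14)).cost + 1) +
    ((RamExpr.var 14).cost + 1) + 1

/-- The structures for the blocks: `ptr j β` is the address of the structure for block `β` of
level `j`, if the block is not empty; queries take at most `T j` steps. -/
def BlockSpec (w S N l m : ℕ) (y : ℕ → ℕ) (ptr : ℕ → ℕ → ℕ) (pred : RamProg) (T : ℕ → ℕ)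
    (C : Set (ℕ → ℕ)) : Prop :=
  ∀ j < l, ∀ β, β * 2 ^ j < N →
    (ptr j β = 0 → ¬ (blockSet N j β ((Finset.range m).image fun i => y (i * l))).Nonempty) ∧
    (ptr j β ≠ 0 → ∀ M ∈ C, ∀ q < 2 ^ j, ∀ r : ℕ → ℕ, r 8 = ptr j β → r 10 = q →
      RunsWithin w S 16 (.call 16 8 9 10 11 12 pred) r M (2 * T j + max 2 pred.regBound + 4)
        fun r' M' => M' ∈ C ∧ r' 1 = r 1 ∧ r' 13 = r 13 ∧ r' 14 = r 14 ∧
          IsPredAnswer (blockSet N j β ((Finset.range m).image fun i => y (i * l))) q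
            fun i => r' (11 + i))

/-- A group minimum at most `q` either precedes the block, and is counted by `cc`, or lies in it. A
predecessor found in the block is itself a group minimum, so the dictionary gives its group; if none
is found, the stored count is the rank. -/
theorem run_searchBlock {C : Set (ℕ → ℕ)} {T : ℕ → ℕ} {pred : RamProg}
    (hC : ∀ M ∈ C, FingerMem w S k N n l m p a y A m₂ o ptr cc M)
    (hB : BlockSpec w S N l m y ptr pred T C) (hM : M ∈ C) {q j : ℕ} (hq : q < N) (hj : j < l)
    (h1 : r 1 = q) (h6 : r 6 = 0) (h8 : r 8 = ptr j (q / 2 ^ j)) (h14 : r 14 = cc j (q / 2 ^ j))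
    (h13 : r 13 = blockStart N j (q / 2 ^ j)) (h10 : r 10 = q - blockStart N j (q / 2 ^ j)) :
    RunsWithin w S 16 (searchBlock pred) r M (2 * T j + searchBlockCost pred)
      fun r' M' => M' ∈ C ∧ r' 1 = q ∧ IsGroupRank m l y q (r' 7) := by
  have h := hC M hM
  set β := q / 2 ^ j with hβ
  set R := (Finset.range m).image fun i => y (i * l) with hR
  have hβN : β * 2 ^ j < N := lt_of_le_of_lt (Nat.div_mul_le_self _ _) hq
  obtain ⟨hz, hnz⟩ := hB j hj β hβN
  have hst : blockStart N j β ≤ q := blockStart_le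
  have hst' : q < blockStart N j β + 2 ^ j := lt_blockStart_add hq
  have hcount : ∀ i < m, cc j β ≤ i ↔ blockStart N j β ≤ y (i * l) := by
    intro i hi
    rw [h.count j hj β]
    exact sub_card_le_iff (f := fun i => y (i * l)) (fun i i' hii hi' => (h.group_mono hii hi').le) hi
  have hmemR : ∀ i < m, blockStart N j β ≤ y (i * l) → y (i * l) ≤ q →
      y (i * l) - blockStart N j β ∈ blockSet N j β R := by
    intro i hi hle hle'
    refine mem_blockSet.2 ⟨?_, by omega⟩
    rw [Nat.sub_add_cancel hle]
    exact Finset.mem_image.2 ⟨i, Finset.mem_range.2 hi, rfl⟩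
  have hrank : (∀ v ∈ blockSet N j β R, ¬ v ≤ q - blockStart N j β) →
      IsGroupRank m l y q (cc j β) := by
    intro hno
    refine ⟨by rw [h.count j hj β]; exact Nat.sub_le _ _, fun i hi => ⟨fun hle => ?_, fun hlt => ?_⟩⟩
    · by_contra hcon
      have h2 := (hcount i hi).1 (not_lt.1 hcon)
      exact hno _ (hmemR i hi h2 hle) (by omega)
    · by_contra hcon
      have := (hcount i hi).2 (by omega)
      omega
  by_cases c : ptr j β = 0
  · refine (RunsWithin.ite (by norm_num) (by norm_num) (fun h => by omega) fun _ =>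
      RunsWithin.assign (by norm_num) (RamExpr.Ev.var_eq (by norm_num) h14) ?_).mono
      (T := (RamExpr.var 14).cost + 1 + 1) (by rw [searchBlockCost]; omega) fun _ _ h => h
    refine ⟨hM, by simp [h1], ?_⟩
    simp only [Function.update_self]
    exact hrank fun v hv => absurd ⟨v, hv⟩ (hz c)
  · have hcall := hnz c M hM (q - blockStart N j β) (by omega) r h8 h10
    refine (RunsWithin.ite (T := 2 * T j + max 2 pred.regBound + 4 +
      ((RamExpr.ifLt (.const 0) (.var 11) (.op .add (.lookup (.op .add (.var 12) (.var 13)))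
        (.const 1)) (.var 14)).cost + 1)) (by norm_num) (by norm_num) (fun _ => RunsWithin.seq hcall
      ?_) fun h => by omega).mono (by rw [searchBlockCost]; omega) fun _ _ h => h
    rintro r' M' ⟨hM', a1, a13, a14, hans⟩
    have h' := hC M' hM'
    have hw := h'.w_pos
    have e0 : RamExpr.Ev w S 16 r' M' (.const 0) 0 := RamExpr.Ev.const (by omega)
    rcases hans with ⟨h11, hgr⟩ | ⟨h11, hno⟩
    · change r' 11 = _ at h11
      obtain ⟨⟨hv, hvq⟩, hmax⟩ := hgr
      change r' 12 ∈ blockSet N j β R at hv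
      change r' 12 ≤ _ at hvq
      obtain ⟨hvR, hvj⟩ := mem_blockSet.1 hv
      obtain ⟨i, hi, hiv⟩ := Finset.mem_image.1 hvR
      rw [Finset.mem_range] at hi
      have hin := (h.group i).1 hi
      have hyN := h.lt_N _ hin
      have hNw := h.N_lt
      have hm := h'.group_room hi
      have hSw := h'.S_le
      have hm' : i + 1 ≤ (i + 1) * treeSize k 16 :=
        Nat.le_mul_of_pos_right _ (by have := FingerMem.treeSize_pos (k := k); omega)
      -- The block structure works with elements relative to the block, so the start is added before
      -- the lookup. The lookup uses the memory left by the call, which still satisfies the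
      -- invariant.
      have el := h'.ev_lookup (V := 16) (r := r') hin rfl (((RamExpr.Ev.add (RamExpr.Ev.var_eq
        (i := 12) (by norm_num) rfl) (RamExpr.Ev.var_eq (i := 13) (by norm_num) (a13.trans h13))
        (by omega))).cast hiv.symm)
      rw [Nat.mul_div_cancel _ h.l_pos] at el
      refine RunsWithin.assign (v := i + 1) (by norm_num) (RamExpr.Ev.ifLt_true e0
        (RamExpr.Ev.var_eq (by norm_num) h11) (by norm_num) (RamExpr.Ev.add el
          (RamExpr.Ev.const (by omega)) (by omega))) ?_
      refine ⟨hM', by simp [a1, h1], ?_⟩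
      simp only [Function.update_self]
      refine ⟨hi, fun i' hi' => ⟨fun hle => ?_, fun hlt => ?_⟩⟩
      · by_contra hcon
        have h2 := h.group_mono (show i < i' by omega) hi'
        have h3 : _ ≤ r' 12 := hmax (show _ ∈ {x | x ∈ blockSet N j β R ∧ x ≤ q - blockStart N j β} from
          ⟨hmemR i' hi' (by omega) hle, by omega⟩)
        omega
      · have := h.mono_le (Nat.mul_le_mul_right l (show i' ≤ i by omega)) hin
        omega
    · change r' 11 = _ at h11
      refine RunsWithin.assign (v := cc j β) (by norm_num) (RamExpr.Ev.ifLt_false e0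
        (RamExpr.Ev.var_eq (by norm_num) h11) (by norm_num) (RamExpr.Ev.var_eq (by norm_num)
          (a14.trans h14))) ?_
      refine ⟨hM', by simp [a1, h1], ?_⟩
      simp only [Function.update_self]
      exact hrank hno

/-- Compute the group rank of the query point. -/
def locateGroup (pred : RamProg) : RamProg :=
  .seq selectGroup (.ite (.lt 3 6) (.seq findLevel (.seq findBlock (searchBlock pred)))
    (.assign 16 7 (.op .add (.var 2) (.const 1))))

/-- The number of steps of `locateGroup` other than those of the predecessor query. -/
def locateGroupCost (pred : RamProg) : ℕ :=
  selectGroupCost + (findLevelCost + (findBlockCost + searchBlockCost pred) +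
    ((RamExpr.op .add (.var 2) (.const 1)).cost + 1) + 1)

/-- The block search happens only if the finger differs from `q`, so `τ` need bound the query time
only at levels `j` with `2 ^ j ≤ D < 2 ^ (j + 1)`. -/
theorem run_locateGroup {C : Set (ℕ → ℕ)} {T : ℕ → ℕ} {pred : RamProg}
    (hC : ∀ M ∈ C, FingerMem w S k N n l m p a y A m₂ o ptr cc M)
    (hB : BlockSpec w S N l m y ptr pred T C) (hM : M ∈ C) {g q τ : ℕ} (hg : g < n) (hq : q < N)
    (hτ : ∀ j, 2 ^ j ≤ Nat.dist (y g) q → Nat.dist (y g) q < 2 ^ (j + 1) → T j ≤ τ)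
    (h0 : r 0 = y g) (h1 : r 1 = q) :
    RunsWithin w S 16 (locateGroup pred) r M (2 * τ + locateGroupCost pred)
      fun r' M' => M' ∈ C ∧ r' 1 = q ∧ IsGroupRank m l y q (r' 7) := by
  have h := hC M hM
  refine ((run_selectGroup h hg h0 h1).seq (T' := 2 * τ + (findLevelCost +
    (findBlockCost + searchBlockCost pred) +
    ((RamExpr.op .add (.var 2) (.const 1)).cost + 1) + 1)) ?_).mono
    (by rw [locateGroupCost]; omega) fun _ _ h => h
  rintro r1 M1 ⟨rfl, b0, b1, b2, b6, hcase⟩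
  refine (RunsWithin.ite (T := 2 * τ + (findLevelCost + (findBlockCost + searchBlockCost pred) +
    ((RamExpr.op .add (.var 2) (.const 1)).cost + 1))) (by norm_num) (by norm_num) (fun hlt => ?_)
    fun hnlt => ?_).mono (by omega) fun _ _ h => h
  · rcases hcase with hcase | ⟨hi, hne, hbt⟩
    · omega
    · refine ((run_findLevel h (h.lt_N g hg) hq hne b0 b1).seq
        (T' := findBlockCost + (2 * τ + searchBlockCost pred)) ?_).mono (by omega) fun _ _ h => h
      rintro r2 M2 ⟨rfl, -, c1, c3, c4, hle, hlt'⟩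
      refine (run_findBlock h hq hi c4 c1 c3 rfl ?_).seq ?_
      -- The selected minimum lies between finger and query point, so it is no farther from `q` than
      -- the finger.
      · refine lt_of_le_of_lt ?_ hlt'
        rw [Nat.dist, Nat.dist]
        omega
      · rintro r3 M3 ⟨rfl, d1, d6, d8, d14, d13, d10⟩
        exact (run_searchBlock hC hB hM hq c4 d1 d6 d8 d14 d13 d10).mono
          (by have := hτ _ hle hlt'; omega) fun _ _ h => h
  · rcases hcase with ⟨-, hrank, him⟩ | ⟨hi, -⟩
    · have hroom := h.group_room him
      have hS := h.S_le
      have hw := h.w_pos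
      have hm' : g / l + 1 ≤ (g / l + 1) * treeSize k 16 :=
        Nat.le_mul_of_pos_right _ (by have := FingerMem.treeSize_pos (k := k); omega)
      refine (RunsWithin.assign (v := g / l + 1) (by norm_num) (RamExpr.Ev.add
        (RamExpr.Ev.var_eq (by norm_num) b2) (RamExpr.Ev.const (by omega)) (by omega)) ?_).mono
        (by omega) fun _ _ h => h
      exact ⟨hM, by simp [b1], by simpa using hrank⟩
    · omega

/-- Walk down in the tree of the group with number `7`, and output with `found` or `none`. -/
def finishQuery (found none : RamProg) : RamProg :=
  .seq (.assign 16 6 (.const 0)) (.ite (.lt 6 7) (.seq (.assign 16 6 (.var 1))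
    (.seq (.assign 16 5 (.op .mul (.var 7) (.param 5))) (.seq (.descend 16 5 6 16) found))) none)

/-- The number of steps of `finishQuery` without the output. -/
def finishQueryCost : ℕ :=
  (RamExpr.const 0).cost + 1 + ((RamExpr.var 1).cost + 1 +
    ((RamExpr.op .mul (.var 7) (.param 5)).cost + 1 + descendCost 5 6 16) + 1)

/-- A positive group rank `i + 1` means that the predecessor is in group `i`. Its tree has number `i
+ 1`, since tree `0` holds the powers of two, so the rank is directly the tree number. Rank zero
means that `q` precedes all elements. -/
theorem run_finishQuery (h : FingerMem w S k N n l m p a y A m₂ o ptr cc M) {q τ : ℕ}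
    (hq : q < N) (hn : 0 < n) (h1 : r 1 = q) (h7 : IsGroupRank m l y q (r 7)) {found none : RamProg}
    {Q : (ℕ → ℕ) → (ℕ → ℕ) → Prop}
    (hfound : ∀ (r' : ℕ → ℕ) (g v : ℕ), g < n → y g ≤ q → (g + 1 < n → q < y (g + 1)) → r' 1 = q →
      r' 5 = v → (v + 2) * 16 ≤ S → M (v * 16 + 1) = y g →
      M ((v + 1) * 16 + 1) = (if g + 1 < n then y (g + 1) + 1 else 0) →
      RunsWithin w S 16 found r' M τ Q)
    (hnone : ∀ r' : ℕ → ℕ, q < y 0 → RunsWithin w S 16 none r' M τ Q) :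
    RunsWithin w S 16 (finishQuery found none) r M (finishQueryCost + τ) Q := by
  have hw := h.w_pos
  have hS := h.S_le
  have hNl := h.N_lt'
  have hl := h.l_pos
  refine (RunsWithin.assign_seq (v := 0) (T := ((RamExpr.var 1).cost + 1 +
    ((RamExpr.op .mul (.var 7) (.param 5)).cost + 1 + (descendCost 5 6 16 + τ))) + 1) (by norm_num)
    (RamExpr.Ev.const (by omega)) ?_).mono (by rw [finishQueryCost]; omega) fun _ _ h => h
  refine RunsWithin.ite (by norm_num) (by norm_num) (fun hlt => ?_) fun hnlt => ?_
  · obtain ⟨i, hi⟩ : ∃ i, r 7 = i + 1 := by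
      rw [Function.update_self, Function.update_of_ne (by norm_num)] at hlt
      exact ⟨r 7 - 1, by omega⟩
    rw [hi] at h7
    have him : i < m := h7.1
    have hroom := h.group_room him
    have hin := (h.group i).1 him
    obtain ⟨T, hT, hTM⟩ := h.groups i him
    refine RunsWithin.assign_seq (v := q) (by norm_num) (RamExpr.Ev.var_eq (by norm_num)
      (by simp [h1])) ?_
    refine RunsWithin.assign_seq (v := (i + 1) * treeSize k 16) (by norm_num)
      (RamExpr.Ev.mul (RamExpr.Ev.var_eq (by norm_num) (by simp [hi]))
        (h.ev_param (i := 5) (by norm_num)) (by omega)) ?_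
    obtain ⟨x, v, hx, hv, hMv, hMv', hrun⟩ := hT.2.2 S ((i + 1) * treeSize k 16) q M
      (Function.update (Function.update (Function.update r 6 0) 6 q) 5 ((i + 1) * treeSize k 16))
      hS hroom hTM (by omega) (by simpa using (h7.2 i him).2 (by omega)) (by simp) (by simp)
    refine RunsWithin.seq hrun ?_
    rintro r' M' ⟨rfl, rfl⟩
    have hxlt := hx.1
    refine hfound _ (i * l + x) v (by omega) hx.2.1 (fun hgn => ?_) (by simp [h1]) (by simp) hv hMv
      hMv'
    by_contra hcon
    rw [not_lt] at hcon
    -- The next element is either in the same group, where the tree excludes it, or the minimum of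
    -- the next group, which the group rank excludes.
    by_cases hxl : x + 1 < l
    · have := hx.2.2 (x + 1) (by omega) hcon
      omega
    · have hgl : i * l + x + 1 = (i + 1) * l := by rw [Nat.succ_mul]; omega
      rw [hgl] at hgn hcon
      have := (h7.2 (i + 1) ((h.group _).2 hgn)).1 hcon
      omega
  · have h70 : r 7 = 0 := by
      rw [Function.update_self, Function.update_of_ne (by norm_num)] at hnlt
      omega
    refine (hnone _ ?_).mono (by omega) fun _ _ h => h
    by_contra hcon
    have := (h7.2 0 ((h.group 0).2 (by omega))).1 (by rw [zero_mul]; omega)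
    omega

/-- Output the predecessor. -/
def outputPred : RamProg :=
  .seq (.assign 16 0 (.const 1)) (.assign 16 1 (.cell 1 (.var 5)))

/-- Output the successor; variable `5` points to the predecessor. -/
def outputSucc : RamProg :=
  .seq (.assign 16 2 (.cell 1 (.var 5)))
    (.seq (.assign 16 3 (.cell 1 (.op .add (.var 5) (.const 1))))
      (.seq (.assign 16 0 (.ifLt (.var 2) (.var 1)
          (.ifLt (.const 0) (.var 3) (.const 1) (.const 0)) (.const 1)))
        (.assign 16 1 (.ifLt (.var 2) (.var 1)
          (.ifLt (.const 0) (.var 3) (.op .sub (.var 3) (.const 1)) (.const 0)) (.var 1)))))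

/-- Output the smallest element. -/
def outputMin : RamProg :=
  .seq (.assign 16 0 (.const 1)) (.assign 16 1 (.groupMin (.const 0)))

/-- The program for predecessor queries with a finger. -/
def fingerPred (pred : RamProg) : RamProg :=
  .seq (locateGroup pred) (finishQuery outputPred (.assign 16 0 (.const 0)))

/-- The program for successor queries with a finger. -/
def fingerSucc (pred : RamProg) : RamProg :=
  .seq (locateGroup pred) (finishQuery outputSucc outputMin)

/-- A bound for the number of steps of the output. -/
def outputCost : ℕ :=
  (RamExpr.cell 1 (.var 5)).cost + 1 +
    ((RamExpr.cell 1 (.op .add (.var 5) (.const 1))).cost + 1 +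
      ((RamExpr.ifLt (.var 2) (.var 1)
          (.ifLt (.const 0) (.var 3) (.const 1) (.const 0)) (.const 1)).cost + 1 +
        ((RamExpr.ifLt (.var 2) (.var 1)
          (.ifLt (.const 0) (.var 3) (.op .sub (.var 3) (.const 1)) (.const 0)) (.var 1)).cost + 1)))
    + (RamExpr.groupMin (.const 0)).cost

/-- The number of steps of a query with a finger other than those of the predecessor query. -/
def fingerCost (pred : RamProg) : ℕ := locateGroupCost pred + (finishQueryCost + outputCost)

theorem run_fingerPred {C : Set (ℕ → ℕ)} {T : ℕ → ℕ} {pred : RamProg}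
    (hC : ∀ M ∈ C, FingerMem w S k N n l m p a y A m₂ o ptr cc M)
    (hB : BlockSpec w S N l m y ptr pred T C) (hM : M ∈ C) {g q τ : ℕ} (hg : g < n) (hq : q < N)
    (hτ : ∀ j, 2 ^ j ≤ Nat.dist (y g) q → Nat.dist (y g) q < 2 ^ (j + 1) → T j ≤ τ)
    (h0 : r 0 = y g) (h1 : r 1 = q) :
    RunsWithin w S 16 (fingerPred pred) r M (2 * τ + fingerCost pred)
      fun r' M' => M' ∈ C ∧ IsPredAnswer ((Finset.range n).image y) q r' := by
  refine ((run_locateGroup hC hB hM hg hq hτ h0 h1).seq (T' := finishQueryCost + outputCost)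
    ?_).mono (by rw [fingerCost]; omega) fun _ _ h => h
  rintro r1 M1 ⟨hM1, b1, b7⟩
  have h := hC M1 hM1
  have hw := h.w_pos
  have hS := h.S_le
  refine run_finishQuery h hq (by omega) b1 b7 ?_ ?_
  · intro r2 g' v hg' hle hlt _ c5 hv hMv _
    refine (RunsWithin.assign_seq (v := 1) (by norm_num) (RamExpr.Ev.const (by omega))
      (RunsWithin.assign (v := y g') (by norm_num) (RamExpr.Ev.cell (x := v)
        (RamExpr.Ev.var_eq (by norm_num) (by simp [c5])) hw hS (by omega) hMv) ?_)).mono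
      (by simp only [outputCost, RamExpr.cost]; omega) fun _ _ h => h
    refine ⟨hM1, Or.inl ⟨by simp, ?_⟩⟩
    simp only [Function.update_self]
    refine ⟨⟨Finset.mem_image.2 ⟨g', Finset.mem_range.2 hg', rfl⟩, hle⟩, ?_⟩
    rintro x ⟨hx, hxq⟩
    obtain ⟨i, hi, rfl⟩ := Finset.mem_image.1 hx
    rw [Finset.mem_range] at hi
    refine h.mono_le ?_ hg'
    by_contra hcon
    have h2 := hlt (by omega)
    have := h.mono_le (show g' + 1 ≤ i by omega) hi
    omega
  · intro r2 hq0
    refine (RunsWithin.assign (v := 0) (by norm_num) (RamExpr.Ev.const (by omega)) ?_).mono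
      (by simp only [outputCost, RamExpr.cost]; omega) fun _ _ h => h
    refine ⟨hM1, Or.inr ⟨by simp, fun x hx hxq => ?_⟩⟩
    obtain ⟨i, hi, rfl⟩ := Finset.mem_image.1 hx
    have := h.mono_le (Nat.zero_le i) (Finset.mem_range.1 hi)
    omega

/-- The successor is `q` itself if the predecessor equals `q`, and otherwise the element after the
predecessor. That element is stored increased by one, so that `0` can mark its absence. -/
theorem run_fingerSucc {C : Set (ℕ → ℕ)} {T : ℕ → ℕ} {pred : RamProg}
    (hC : ∀ M ∈ C, FingerMem w S k N n l m p a y A m₂ o ptr cc M)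
    (hB : BlockSpec w S N l m y ptr pred T C) (hM : M ∈ C) {g q τ : ℕ} (hg : g < n) (hq : q < N)
    (hτ : ∀ j, 2 ^ j ≤ Nat.dist (y g) q → Nat.dist (y g) q < 2 ^ (j + 1) → T j ≤ τ)
    (h0 : r 0 = y g) (h1 : r 1 = q) :
    RunsWithin w S 16 (fingerSucc pred) r M (2 * τ + fingerCost pred)
      fun r' M' => M' ∈ C ∧ IsSuccAnswer ((Finset.range n).image y) q r' := by
  refine ((run_locateGroup hC hB hM hg hq hτ h0 h1).seq (T' := finishQueryCost + outputCost)
    ?_).mono (by rw [fingerCost]; omega) fun _ _ h => h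
  rintro r1 M1 ⟨hM1, b1, b7⟩
  have h := hC M1 hM1
  have hw := h.w_pos
  have hS := h.S_le
  have hNw := h.N_lt
  refine run_finishQuery h hq (by omega) b1 b7 ?_ ?_
  · intro r2 g' v hg' hle hlt c1 c5 hv hMv hMv'
    set d := if g' + 1 < n then y (g' + 1) + 1 else 0 with hd
    have hdN : d ≤ N := by
      rw [hd]
      split_ifs with hgn
      · exact h.lt_N _ hgn
      · exact Nat.zero_le _
    refine (RunsWithin.assign_seq (v := y g') (by norm_num) (RamExpr.Ev.cell (x := v)
      (RamExpr.Ev.var_eq (by norm_num) c5) hw hS (by omega) hMv)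
      (RunsWithin.assign_seq (v := d) (by norm_num) (RamExpr.Ev.cell (x := v + 1)
        (RamExpr.Ev.add (RamExpr.Ev.var_eq (by norm_num) (by simp [c5])) (RamExpr.Ev.const
          (by omega)) (by omega)) hw hS (by omega) hMv') ?_)).mono
      (T := (RamExpr.cell 1 (.var 5)).cost + 1 +
        ((RamExpr.cell 1 (.op .add (.var 5) (.const 1))).cost + 1 +
        ((RamExpr.ifLt (.var 2) (.var 1)
          (.ifLt (.const 0) (.var 3) (.const 1) (.const 0)) (.const 1)).cost + 1 +
        ((RamExpr.ifLt (.var 2) (.var 1)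
          (.ifLt (.const 0) (.var 3) (.op .sub (.var 3) (.const 1)) (.const 0)) (.var 1)).cost + 1))))
      (by rw [outputCost]; omega) fun _ _ h => h
    set r3 := Function.update (Function.update r2 2 (y g')) 3 d with hr3
    have d1 : r3 1 = q := by simp [hr3, c1]
    have d2 : r3 2 = y g' := by simp [hr3]
    have d3 : r3 3 = d := by simp [hr3]
    have e0 : ∀ r, RamExpr.Ev w S 16 r M1 (.const 0) 0 := fun r => RamExpr.Ev.const (by omega)
    have e1 : ∀ r, RamExpr.Ev w S 16 r M1 (.const 1) 1 := fun r => RamExpr.Ev.const (by omega)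
    by_cases ceq : y g' < q
    · by_cases cn : g' + 1 < n
      · have hd' : d = y (g' + 1) + 1 := if_pos cn
        refine RunsWithin.assign_seq (v := 1) (by norm_num) (RamExpr.Ev.ifLt_true
          (RamExpr.Ev.var_eq (by norm_num) d2) (RamExpr.Ev.var_eq (by norm_num) d1) ceq
          (RamExpr.Ev.ifLt_true (e0 _) (RamExpr.Ev.var_eq (by norm_num) d3) (by omega) (e1 _))) ?_
        refine RunsWithin.assign (v := y (g' + 1)) (by norm_num) ((RamExpr.Ev.ifLt_true
          (RamExpr.Ev.var_eq (by norm_num) (by simpa using d2)) (RamExpr.Ev.var_eq (by norm_num)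
            (by simpa using d1)) ceq (RamExpr.Ev.ifLt_true (e0 _) (RamExpr.Ev.var_eq (by norm_num)
              (by simpa using d3)) (by omega) (RamExpr.Ev.sub (RamExpr.Ev.var_eq (by norm_num)
              (by simpa using d3)) (e1 _) (by omega) (by omega)))).cast (by omega)) ?_
        refine ⟨hM1, Or.inl ⟨by simp, ?_⟩⟩
        simp only [Function.update_self]
        refine ⟨⟨Finset.mem_image.2 ⟨g' + 1, Finset.mem_range.2 cn, rfl⟩, (hlt cn).le⟩, ?_⟩
        rintro x ⟨hx, hxq⟩
        obtain ⟨i, hi, rfl⟩ := Finset.mem_image.1 hx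
        refine h.mono_le ?_ (Finset.mem_range.1 hi)
        by_contra hcon
        have := h.mono_le (show i ≤ g' by omega) hg'
        omega
      · have hd' : d = 0 := if_neg cn
        refine RunsWithin.assign_seq (v := 0) (by norm_num) (RamExpr.Ev.ifLt_true
          (RamExpr.Ev.var_eq (by norm_num) d2) (RamExpr.Ev.var_eq (by norm_num) d1) ceq
          (RamExpr.Ev.ifLt_false (e0 _) (RamExpr.Ev.var_eq (by norm_num) d3) (by omega) (e0 _))) ?_
        refine RunsWithin.assign (v := 0) (by norm_num) (RamExpr.Ev.ifLt_true
          (RamExpr.Ev.var_eq (by norm_num) (by simpa using d2)) (RamExpr.Ev.var_eq (by norm_num)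
            (by simpa using d1)) ceq (RamExpr.Ev.ifLt_false (e0 _) (RamExpr.Ev.var_eq (by norm_num)
              (by simpa using d3)) (by omega) (e0 _))) ?_
        refine ⟨hM1, Or.inr ⟨by simp, fun x hx hxq => ?_⟩⟩
        obtain ⟨i, hi, rfl⟩ := Finset.mem_image.1 hx
        rw [Finset.mem_range] at hi
        have := h.mono_le (show i ≤ g' by omega) hg'
        omega
    · refine RunsWithin.assign_seq (v := 1) (by norm_num) (RamExpr.Ev.ifLt_false
        (RamExpr.Ev.var_eq (by norm_num) d2) (RamExpr.Ev.var_eq (by norm_num) d1) ceq (e1 _)) ?_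
      refine RunsWithin.assign (v := q) (by norm_num) (RamExpr.Ev.ifLt_false
        (RamExpr.Ev.var_eq (by norm_num) (by simpa using d2)) (RamExpr.Ev.var_eq (by norm_num)
          (by simpa using d1)) ceq (RamExpr.Ev.var_eq (by norm_num) (by simpa using d1))) ?_
      refine ⟨hM1, Or.inl ⟨by simp, ?_⟩⟩
      simp only [Function.update_self]
      exact ⟨⟨Finset.mem_image.2 ⟨g', Finset.mem_range.2 hg', by omega⟩, le_rfl⟩,
        fun x hx => hx.2⟩
  · intro r2 hq0
    have hm : 0 < m := (h.group 0).2 (by omega)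
    refine (RunsWithin.assign_seq (v := 1) (by norm_num) (RamExpr.Ev.const (by omega))
      (RunsWithin.assign (by norm_num) (h.ev_groupMin hm (RamExpr.Ev.const (by omega))) ?_)).mono
      (by simp only [outputCost, RamExpr.cost]; omega) fun _ _ h => h
    refine ⟨hM1, Or.inl ⟨by simp, ?_⟩⟩
    simp only [Function.update_self, zero_mul]
    refine ⟨⟨Finset.mem_image.2 ⟨0, Finset.mem_range.2 (by omega), rfl⟩, hq0.le⟩, ?_⟩
    rintro x ⟨hx, -⟩
    obtain ⟨i, hi, rfl⟩ := Finset.mem_image.1 hx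
    exact h.mono_le (Nat.zero_le i) (Finset.mem_range.1 hi)

end Query

/-! ## Existence of the static part of a finger search structure -/

/-- For the least such `k ≥ 2` one has `k ≤ 2 * (k - 1)`, whence `k ^ 16 ≤ 2 ^ 16 * (k - 1) ^ 16`,
and `2 ^ 16 = 65536`. -/
theorem exists_pow_sixteen {l : ℕ} (hl : 0 < l) :
    ∃ k, 0 < k ∧ l ≤ k ^ 16 ∧ k ^ 16 ≤ 65536 * l := by
  classical
  have hex : ∃ k, l ≤ k ^ 16 := ⟨l, Nat.le_self_pow (by norm_num) l⟩
  have hspec := Nat.find_spec hex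
  have hpos : 0 < Nat.find hex := by
    by_contra hcon
    rw [show Nat.find hex = 0 by omega] at hspec
    simp at hspec
    omega
  refine ⟨Nat.find hex, hpos, hspec, ?_⟩
  rcases (show 1 ≤ Nat.find hex from hpos).eq_or_lt with h1 | h1
  · rw [← h1]; omega
  · have h2 := Nat.find_min hex (show Nat.find hex - 1 < Nat.find hex by omega)
    have h3 : Nat.find hex ^ 16 ≤ (2 * (Nat.find hex - 1)) ^ 16 :=
      Nat.pow_le_pow_left (by omega) 16
    rw [mul_pow] at h3
    norm_num at h3
    omega

/-- This explains the height 16. With `s = k ^ 8` a sketch of `O(k ^ 2)` positions has `O(k ^ 6 * s)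
= O(k ^ 14)` bits, and `O(k ^ 2)` such fields fill a word of `O(k ^ 16)` bits. -/
theorem nodeBits_le {k l : ℕ} (hk : 0 < k) (hl : l ≤ k ^ 16) : nodeBits k l (k ^ 8) ≤ 75 * k ^ 16 := by
  have hp : ∀ i j, i ≤ j → k ^ i ≤ k ^ j := fun i j h => Nat.pow_le_pow_right hk h
  have h0 : 1 ≤ k ^ 2 := Nat.one_le_pow _ _ hk
  have hF : k * k + 1 ≤ 2 * k ^ 2 := by rw [← sq]; omega
  have hF' : k * k + 2 ≤ 3 * k ^ 2 := by rw [← sq]; omega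
  have hs : sketchBits (k * k + 1) (k ^ 8) ≤ 22 * k ^ 14 := by
    rw [sketchBits]
    calc _ ≤ 2 * k ^ 2 * (2 * k ^ 2 + 2 * k ^ 2 * (2 * k ^ 2) * (2 * k ^ 8) + 1) := by gcongr
      _ = 4 * k ^ 4 + 16 * k ^ 14 + 2 * k ^ 2 := by ring
      _ ≤ 22 * k ^ 14 := by have := hp 4 14 (by norm_num); have := hp 2 14 (by norm_num); omega
  have h14 : 1 ≤ k ^ 14 := Nat.one_le_pow _ _ hk
  have h16 : 1 ≤ k ^ 16 := Nat.one_le_pow _ _ hk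
  rw [nodeBits]
  calc _ ≤ k ^ 16 + 2 + (23 * k ^ 14) * (3 * k ^ 2) + k * (k * (3 * k ^ 2)) := by
        gcongr; omega
    _ = 70 * k ^ 16 + 3 * k ^ 4 + 2 := by ring
    _ ≤ 75 * k ^ 16 := by have := hp 4 16 (by norm_num); omega

/-- The number of words of the static part of a finger search structure with `m` groups of `l`
elements. -/
def staticSize (m l : ℕ) : ℕ := 16 * (42205200 * (m * l))

/-- Dictionary, trees and records are written into interleaved arrays and shown to fit. The word
length suffices for the fusion nodes since `75 * 65536 ≤ 8388608`. A tree has at most `322 * 65536 *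
l = 21102592 * l` words, so `m + 1 ≤ 2 * m` trees use at most `42205184 * (m * l)`; the remaining
arrays are shorter than the bound in `staticSize`. -/
theorem exists_fingerMem {w N n m l : ℕ} {y : ℕ → ℕ} {ptr cc : ℕ → ℕ → ℕ} (hl : 0 < l)
    (hNl : N < 2 ^ l) (hlev : ∀ j < l, 2 ^ j ≤ N) (hw : 8388608 * l ≤ w) (hn : 0 < n)
    (hy : ∀ i j, i < j → j < n → y i < y j) (hyN : ∀ i < n, y i < N)
    (hgroup : ∀ i, i < m ↔ i * l < n) (hptr : ∀ j β, ptr j β < 2 ^ w)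
    (hcc : ∀ j β, cc j β =
      m - ((Finset.range m).filter fun i => blockStart N j β ≤ y (i * l)).card) :
    ∃ (k p a : ℕ) (A m₂ o c : ℕ → ℕ), (∀ x, c x < 2 ^ w) ∧ ∀ (S : ℕ) (M : ℕ → ℕ),
      staticSize m l ≤ S → S ≤ 2 ^ w → (∀ x < staticSize m l, M x = c x) →
      FingerMem w S k N n l m p a y A m₂ o ptr cc M := by
  classical
  obtain ⟨k, hk, hlk, hkl⟩ := exists_pow_sixteen hl
  have hZ := treeSize_le hk 16
  have hZ2 := FingerMem.treeSize_pos (k := k)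
  set Z := treeSize k 16 with hZdef
  have hZl : Z ≤ 21102592 * l := by omega
  have hm0 : 0 < m := (hgroup 0).2 (by omega)
  have hnml : n ≤ m * l := by
    by_contra hcon
    exact lt_irrefl m ((hgroup m).2 (by omega))
  have hml : m ≤ m * l := Nat.le_mul_of_pos_right _ hl
  have hinj : ∀ i j, i < n → j < n → y i = y j → i = j := by
    intro i j hi hj hij
    rcases lt_trichotomy i j with h | h | h
    · have := hy i j h hj; omega
    · exact h
    · have := hy j i h hi; omega
  set R := (Finset.range n).image y with hR
  have hcard : R.card = n := by
    rw [hR, Finset.card_image_of_injOn, Finset.card_range]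
    intro i hi j hj hij
    exact hinj i j (by simpa using hi) (by simpa using hj) hij
  have hnN : n ≤ N := by
    rw [← hcard, ← Finset.card_range N]
    refine Finset.card_le_card fun x hx => ?_
    obtain ⟨i, hi, rfl⟩ := Finset.mem_image.1 hx
    exact Finset.mem_range.2 (hyN i (Finset.mem_range.1 hi))
  have hmn : m ≤ n := by
    have h1 := (hgroup (m - 1)).1 (by omega)
    have h2 : m - 1 ≤ (m - 1) * l := Nat.le_mul_of_pos_right _ hl
    omega
  have hlN : l < 2 ^ l := Nat.lt_two_pow_self
  have hpw : ∀ e, e ≤ 8388608 * l → 2 ^ e ≤ 2 ^ w := fun e he =>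
    Nat.pow_le_pow_right two_pos (he.trans hw)
  have hN40 : 2 ^ 40 * 2 ^ l ≤ 2 ^ w := by rw [← pow_add]; exact hpw _ (by omega)
  have hNN : 2 * (N * N) < 2 ^ w := by
    have h1 : N * N < 2 ^ l * 2 ^ l := Nat.mul_lt_mul'' hNl hNl
    have h2 : 2 * (2 ^ l * 2 ^ l) ≤ 2 ^ w := by
      rw [← pow_add, ← pow_succ']; exact hpw _ (by omega)
    omega
  norm_num at hN40
  have hw16 : 16 < 2 ^ w := by omega
  have hZw : Z < 2 ^ w := by omega
  have hbits : nodeBits k l (k ^ 8) ≤ w := by have := nodeBits_le hk hlk; omega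
  have hls : l ≤ k ^ 8 * k ^ 8 := by rw [← pow_add]; exact hlk
  -- A prime below `2 * N` or equal to it keeps all products in the hash functions below `2 ^ w`.
  obtain ⟨p, hp, hNp, hp2⟩ := Nat.exists_prime_lt_and_le_two_mul N (by have := hyN 0 hn; omega)
  -- The number of smaller elements divided by `l`, which for an element of the set is its group.
  set val : ℕ → ℕ := fun x => ((Finset.range n).filter fun i => y i < x).card / l with hval
  have hvaly : ∀ g < n, val (y g) = g / l := by
    intro g hg
    have : ((Finset.range n).filter fun i => y i < y g) = Finset.range g := by
      ext i
      rw [Finset.mem_filter, Finset.mem_range, Finset.mem_range]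
      refine ⟨fun ⟨h1, h2⟩ => ?_, fun h1 => ⟨by omega, hy i g h1 hg⟩⟩
      by_contra hcon
      rcases (not_lt.1 hcon).eq_or_lt with h | h
      · subst h; omega
      · have := hy g i h h1; omega
    rw [hval]
    dsimp only
    rw [this, Finset.card_range]
  obtain ⟨a, A, m₂, o, cells, ha, hA, hmo, hdict⟩ := exists_dictionary hp
    (R := R) (fun x hx => by
      obtain ⟨i, hi, rfl⟩ := Finset.mem_image.1 hx
      have := hyN i (Finset.mem_range.1 hi)
      omega) val
  rw [hcard] at hmo hdict
  obtain ⟨T₀, hT₀⟩ := exists_searchTree (w := w) (V := 16) (P := 5) (X := 6) (by norm_num)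
    (by norm_num) (by norm_num) hls hbits hw16 16 l (fun i => 2 ^ i) (fun i => i) hl hlk
    (fun i j hij _ => Nat.pow_lt_pow_right (by norm_num) hij)
    (fun i hi => Nat.pow_lt_pow_right (by norm_num) hi) (fun i hi => by omega) hZw
  have htree : ∀ i < m, ∃ T, IsSearchTree w 16 5 6 k l 16 (min l (n - i * l))
      (fun x => y (i * l + x))
      (fun x => if i * l + x + 1 < n then y (i * l + x + 1) + 1 else 0) T := by
    intro i hi
    have hin := (hgroup i).1 hi
    refine exists_searchTree (by norm_num) (by norm_num) (by norm_num) hls hbits hw16 16 _ _ _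
      (by omega) (by omega) (fun x x' hx hx' => hy _ _ (by omega) (by omega))
      (fun x hx => (hyN _ (by omega)).trans hNl) (fun x hx => ?_) hZw
    split_ifs with hlt
    · have := hyN _ hlt; omega
    · omega
  choose! T hT using htree
  set arr : ℕ → ℕ → ℕ := fun t x => match t with
    | 0 => fingerParam N l p a n Z m x
    | 1 => if x / Z = 0 then T₀ (x % Z) else T (x / Z - 1) (x % Z)
    | 2 => A x
    | 3 => m₂ x
    | 4 => o x
    | 5 => cells x
    | 6 => ptr (x / 5 % l) (y (x / 5 / l * l) / 2 ^ (x / 5 % l) + x % 5 - 2)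
    | _ => cc (x / 5 % l) (y (x / 5 / l * l) / 2 ^ (x / 5 % l) + x % 5 - 2)
  -- Reduction modulo `2 ^ w` makes every cell a word, including cells that are never read; the
  -- entries in use are already smaller.
  refine ⟨k, p, a, A, m₂, o, fun x => arr (x % 16) (x / 16) % 2 ^ w,
    fun x => Nat.mod_lt _ (Nat.two_pow_pos w), fun S M hS hSw hM => ?_⟩
  rw [staticSize] at hS hM
  have hread : ∀ t x, t < 16 → x < 42205200 * (m * l) → arr t x < 2 ^ w →
      M (x * 16 + t) = arr t x := by
    intro t x ht hx hlt
    rw [hM _ (by omega)]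
    dsimp only
    rw [show (x * 16 + t) % 16 = t by omega, show (x * 16 + t) / 16 = x by omega,
      Nat.mod_eq_of_lt hlt]
  have arr1 : ∀ x, arr 1 x = if x / Z = 0 then T₀ (x % Z) else T (x / Z - 1) (x % Z) :=
    fun _ => rfl
  have arr6 : ∀ x, arr 6 x =
      ptr (x / 5 % l) (y (x / 5 / l * l) / 2 ^ (x / 5 % l) + x % 5 - 2) := fun _ => rfl
  have arr7 : ∀ x, arr 7 x =
      cc (x / 5 % l) (y (x / 5 / l * l) / 2 ^ (x / 5 % l) + x % 5 - 2) := fun _ => rfl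
  have hmZ : (m + 1) * Z ≤ 42205184 * (m * l) := by
    calc (m + 1) * Z ≤ (m + m) * (21102592 * l) := Nat.mul_le_mul (by omega) hZl
      _ = 42205184 * (m * l) := by ring
  have hdivZ : ∀ i x, x < Z → (i * Z + x) / Z = i ∧ (i * Z + x) % Z = x := fun i x hx => by
    rw [mul_comm, Nat.mul_add_div (by omega), Nat.div_eq_of_lt hx, Nat.mul_add_mod,
      Nat.mod_eq_of_lt hx]
    exact ⟨rfl, rfl⟩
  have hmemR : ∀ g < n, y g ∈ R := fun g hg => Finset.mem_image.2 ⟨g, Finset.mem_range.2 hg, rfl⟩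
  refine
    { w_pos := hw16
      S_le := hSw
      N_lt := by omega
      N_lt' := hNl
      l_pos := hl
      level_le := hlev
      mono := hy
      lt_N := hyN
      group := hgroup
      param_room := by omega
      param := fun i hi => ?_
      tree_room := by rw [← hZdef]; omega
      powers := ⟨T₀, hT₀, fun x hx => ?_⟩
      groups := fun i hi => ⟨T i, hT i hi, fun x hx => ?_⟩
      hash_room := fun g hg => ?_
      hash := fun g hg => ?_
      cell := fun g hg => ?_
      record_room := by omega
      record := fun i hi j hj e he β hβ hβN => ?_
      count := fun j _ β => hcc j β }
  · refine hread 0 i (by norm_num) (by omega) ?_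
    change fingerParam N l p a n Z m i < 2 ^ w
    interval_cases i <;> simp only [fingerParam, List.getD_cons_zero, List.getD_cons_succ] <;> omega
  · rw [← hZdef] at hx
    have h1 : arr 1 (0 + x) = T₀ x := by
      have := hdivZ 0 x hx
      rw [zero_mul] at this
      rw [arr1, this.1, this.2, if_pos rfl]
    have hZm : Z ≤ (m + 1) * Z := Nat.le_mul_of_pos_left _ (by omega)
    rw [hread 1 _ (by norm_num) (by omega) (by rw [h1]; exact hT₀.1 x), h1]
  · rw [← hZdef] at hx ⊢
    have h1 : arr 1 ((i + 1) * Z + x) = T i x := by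
      rw [arr1, (hdivZ _ x hx).1, (hdivZ _ x hx).2, if_neg (by omega), Nat.add_sub_cancel]
    have h2 := Nat.mul_le_mul_right Z (show i + 1 + 1 ≤ m + 1 by omega)
    rw [Nat.succ_mul (i + 1)] at h2
    rw [hread 1 _ (by norm_num) (by omega) (by rw [h1]; exact (hT i hi).1 x), h1]
  · have hb := (hdict _ (hmemR g hg)).1
    have hmul : ∀ u < p, u * y g < 2 ^ w := fun u hu => by
      have := Nat.mul_le_mul (show u ≤ 2 * N by omega) (hyN g hg).le
      rw [mul_assoc] at this
      omega
    exact ⟨hmul a ha, by omega, hmul _ (hA _)⟩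
  · have hb := (hdict _ (hmemR g hg)).1
    have := hmo _ hb
    have := hA (modHash a p n (y g))
    exact ⟨hread 2 _ (by norm_num) (by omega) (show A _ < 2 ^ w by omega),
      hread 3 _ (by norm_num) (by omega) (show m₂ _ < 2 ^ w by omega),
      hread 4 _ (by norm_num) (by omega) (show o _ < 2 ^ w by omega)⟩
  · obtain ⟨hb, hi, hc⟩ := hdict _ (hmemR g hg)
    refine ⟨by omega, ?_⟩
    rw [hvaly g hg] at hc
    have h1 : arr 5 (o (modHash a p n (y g)) + modHash (A (modHash a p n (y g))) p
        (m₂ (modHash a p n (y g))) (y g)) = g / l := hc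
    have h2 : g / l ≤ g := Nat.div_le_self _ _
    rw [hread 5 _ (by norm_num) (by omega) (by rw [h1]; omega), h1]
  · have hidx : (i * l + j) * 5 + e < m * l * 5 := by
      have h5 := Nat.mul_le_mul_right l (show i + 1 ≤ m from hi)
      rw [Nat.succ_mul] at h5
      omega
    have e1 : ((i * l + j) * 5 + e) / 5 = i * l + j := by omega
    have e2 : ((i * l + j) * 5 + e) % 5 = e := by omega
    have e3 : (i * l + j) / l = i := by
      rw [mul_comm, Nat.mul_add_div hl, Nat.div_eq_of_lt hj, add_zero]
    have e4 : (i * l + j) % l = j := by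
      rw [mul_comm, Nat.mul_add_mod, Nat.mod_eq_of_lt hj]
    have e5 : y (i * l) / 2 ^ j + e - 2 = β := by omega
    have h6 : arr 6 ((i * l + j) * 5 + e) = ptr j β := by
      rw [arr6, e1, e2, e3, e4, e5]
    have h7 : arr 7 ((i * l + j) * 5 + e) = cc j β := by
      rw [arr7, e1, e2, e3, e4, e5]
    have hccm : cc j β ≤ m := by rw [hcc]; exact Nat.sub_le _ _
    exact ⟨(hread 6 _ (by norm_num) (by omega) (by rw [h6]; exact hptr _ _)).trans h6,
      (hread 7 _ (by norm_num) (by omega) (by rw [h7]; omega)).trans h7⟩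

/-! ## The finger search structure -/

section Structure

variable {w N n m l : ℕ} {y : ℕ → ℕ}

open Classical in
/-- The address of the structure for a block, and `0` if the block contains no element. -/
noncomputable def blockPtr (N l S₀ : ℕ) (S : ℕ → ℕ) (R : Finset ℕ) (j β : ℕ) : ℕ :=
  if j < l ∧ β < N ∧ (blockSet N j β R).Nonempty then layoutBase S₀ S (j * N + β) else 0

theorem block_number_lt {j β : ℕ} (hj : j < l) (hβ : β < N) : j * N + β < l * N := by
  have := Nat.mul_le_mul_right N (show j + 1 ≤ l from hj)
  rw [Nat.succ_mul] at this
  omega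

theorem blockPtr_le (S₀ : ℕ) (S : ℕ → ℕ) (R : Finset ℕ) (j β : ℕ) :
    blockPtr N l S₀ S R j β ≤ layoutBase S₀ S (l * N) := by
  rw [blockPtr]
  split_ifs with h
  · exact layoutBase_mono _ _ (block_number_lt h.1 h.2.1).le
  · exact Nat.zero_le _

/-- The largest query time for a block of level `j`. -/
def levelTime (t : ℕ → ℕ → ℕ) (N : ℕ) (R : Finset ℕ) (j : ℕ) : ℕ :=
  (Finset.range N).sup fun β => t (2 ^ j) (blockSet N j β R).card

/-- The static part is nonempty, so no structure has address `0`, which is free to mark empty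
blocks. -/
theorem blockSpec_layoutSet {t : ℕ → ℕ → ℕ} {pred : RamProg} {S₀ : ℕ} {c S : ℕ → ℕ}
    {I : ℕ → Set (ℕ → ℕ)} (hS₀ : 0 < S₀) (hw : layoutBase S₀ S (l * N) ≤ 2 ^ w)
    (hI : ∀ j < l, ∀ β, β * 2 ^ j < N →
      (blockSet N j β ((Finset.range m).image fun i => y (i * l))).Nonempty →
      ∀ M ∈ I (j * N + β), ∀ q < 2 ^ j,
        AnswersWithin w (S (j * N + β)) (I (j * N + β)) pred (regInput q) M
          (t (2 ^ j) (blockSet N j β ((Finset.range m).image fun i => y (i * l))).card)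
          (IsPredAnswer (blockSet N j β ((Finset.range m).image fun i => y (i * l))) q)) :
    BlockSpec w (layoutBase S₀ S (l * N)) N l m y
      (blockPtr N l S₀ S ((Finset.range m).image fun i => y (i * l))) pred
      (levelTime t N ((Finset.range m).image fun i => y (i * l)))
      (layoutSet S₀ c (l * N) S I) := by
  intro j hj β hβ
  have hI := hI j hj β hβ
  set R := (Finset.range m).image fun i => y (i * l)
  have hβN : β < N := lt_of_le_of_lt (Nat.le_mul_of_pos_right _ (Nat.two_pow_pos j)) hβ
  by_cases hne : (blockSet N j β R).Nonempty
  · have hptr : blockPtr N l S₀ S R j β = layoutBase S₀ S (j * N + β) := if_pos ⟨hj, hβN, hne⟩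
    have hpos : 0 < layoutBase S₀ S (j * N + β) := by rw [layoutBase]; omega
    refine ⟨fun h0 => by omega, fun _ M hM q hq r h8 h10 => ?_⟩
    have hlt := block_number_lt hj hβN
    obtain ⟨M₁, hM₁, hMM⟩ := hM.2 _ hlt
    have hend := layoutBase_mono S₀ S (show j * N + β + 1 ≤ l * N from hlt)
    rw [layoutBase_succ] at hend
    refine (RunsWithin.call (by norm_num) (by norm_num) (by norm_num) hend hw (by norm_num)
      (by norm_num) (h8.trans hptr) h10 hMM (hI hne M₁ hM₁ q hq)
      fun reg M' M₂ r' hans hM₂ hin hout hr' => ?_).mono ?_ fun _ _ h => h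
    · refine ⟨mem_layoutSet_of_same_outside hM hM₂ hin hout, ?_, ?_, ?_, ?_⟩
      · simpa using hr' 1 (by norm_num) (by norm_num)
      · simpa using hr' 13 (by norm_num) (by norm_num)
      · simpa using hr' 14 (by norm_num) (by norm_num)
      · simpa [IsPredAnswer] using hans
    · have : t (2 ^ j) (blockSet N j β R).card ≤ levelTime t N R j :=
        Finset.le_sup (f := fun β => t (2 ^ j) (blockSet N j β R).card) (Finset.mem_range.2 hβN)
      omega
  · exact ⟨fun _ => hne, fun h => absurd (if_neg fun h' => hne h'.2.2) h⟩

theorem RunsWithin.answersWithin {S : ℕ} {p : RamProg} {r M : ℕ → ℕ} {T T' : ℕ}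
    {C : Set (ℕ → ℕ)} {ans : (ℕ → ℕ) → Prop}
    (hans : ∀ r r' : ℕ → ℕ, r 0 = r' 0 → r 1 = r' 1 → ans r → ans r')
    (h : RunsWithin w S 16 p r M T fun r' M' => M' ∈ C ∧ ans r') (hT : T ≤ T') :
    AnswersWithin w S C p r M T' ans := by
  obtain ⟨k, hk, reg', M', r', he, hr', hC, ha⟩ := h r fun _ _ => rfl
  exact ⟨k, hk.trans hT, ⟨reg', M'⟩, he, hans r' reg' (hr' 0 (by norm_num)).symm
    (hr' 1 (by norm_num)).symm ha, hC⟩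

theorem exists_strictMono_enumeration (R : Finset ℕ) :
    ∃ y : ℕ → ℕ, (∀ i j, i < j → j < R.card → y i < y j) ∧ R = (Finset.range R.card).image y := by
  refine ⟨fun i => if h : i < R.card then R.orderEmbOfFin rfl ⟨i, h⟩ else 0, fun i j hij hj => ?_,
    ?_⟩
  · dsimp only
    rw [dif_pos hj, dif_pos (hij.trans hj)]
    exact (R.orderEmbOfFin rfl).strictMono (Fin.mk_lt_mk.2 hij)
  · ext x
    rw [Finset.mem_image, ← Finset.mem_coe, ← Finset.range_orderEmbOfFin R rfl, Set.mem_range]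
    constructor
    · rintro ⟨i, rfl⟩
      exact ⟨i, Finset.mem_range.2 i.2, dif_pos i.2⟩
    · rintro ⟨i, hi, rfl⟩
      exact ⟨⟨i, Finset.mem_range.1 hi⟩, by rw [dif_pos (Finset.mem_range.1 hi)]⟩

end Structure

/-! ### Final estimates and the theorem -/

/-- Regularity is applied to `n` one-point universes, each of which needs at least one word. This
pays for the static part. -/
theorem IsPredecessorStructure.le_mul_space {a : ℕ} {t s : ℕ → ℕ → ℕ} {pred succ : RamProg}
    (h : IsPredecessorStructure a t s pred succ) {K : ℕ}
    (hK : ∀ (N n : ℕ) (l : List (ℕ × ℕ)), (∀ x ∈ l, 1 ≤ x.2 ∧ x.2 ≤ x.1) →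
      (l.map Prod.fst).sum ≤ N → (l.map Prod.snd).sum ≤ n →
      (l.map fun x => s x.1 x.2).sum ≤ K * s N n) {N n : ℕ} (hn : n ≤ N) : n ≤ K * s N n := by
  have h1 := h.one_le_space one_pos le_rfl
  have h2 := hK N n (List.replicate n (1, 1))
    (fun x hx => by rw [List.eq_of_mem_replicate hx]; exact ⟨le_rfl, le_rfl⟩) (by simpa using hn)
    (by simp)
  simp only [List.map_replicate, List.sum_replicate, smul_eq_mul] at h2
  exact (Nat.le_mul_of_pos_right n h1).trans h2

/-- Both parts of the memory have at most `2 ^ ((a + 40) * l)` words, because `N`, `m` and `l` are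
at most `2 ^ l`. The constant `8388608` is required by the fusion nodes and leaves ample room for
addresses. -/
theorem layoutBase_lt_two_pow {a m N : ℕ} {S : ℕ → ℕ} (hm : m ≤ N)
    (hS : ∀ i, S i ≤ 2 ^ (a * bitLength N)) :
    layoutBase (staticSize m (bitLength N)) S (bitLength N * N) <
      2 ^ ((a + 8388608) * bitLength N) := by
  set l := bitLength N with hl
  have hl0 : 0 < l := Nat.succ_pos _
  have hN : N < 2 ^ l := lt_two_pow_bitLength N
  have hlt : l < 2 ^ l := Nat.lt_two_pow_self
  have h1 : staticSize m l ≤ 2 ^ 30 * (2 ^ l * 2 ^ l) := by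
    rw [staticSize, ← mul_assoc]
    exact Nat.mul_le_mul (by norm_num) (Nat.mul_le_mul (by omega) hlt.le)
  have h2 : ∑ i ∈ Finset.range (l * N), S i ≤ 2 ^ l * 2 ^ l * 2 ^ (a * l) := by
    refine (Finset.sum_le_card_nsmul _ _ _ fun i _ => hS i).trans ?_
    rw [Finset.card_range, smul_eq_mul]
    exact Nat.mul_le_mul_right _ (Nat.mul_le_mul hlt.le hN.le)
  have h3 : 2 ^ 30 * (2 ^ l * 2 ^ l) ≤ 2 ^ ((a + 40) * l) := by
    rw [← pow_add, ← pow_add]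
    exact Nat.pow_le_pow_right two_pos (by rw [add_mul]; omega)
  have h4 : 2 ^ l * 2 ^ l * 2 ^ (a * l) ≤ 2 ^ ((a + 40) * l) := by
    rw [← pow_add, ← pow_add]
    exact Nat.pow_le_pow_right two_pos (by rw [add_mul]; omega)
  have h5 : 2 ^ ((a + 40) * l + 1) < 2 ^ ((a + 8388608) * l) :=
    Nat.pow_lt_pow_right one_lt_two (by rw [add_mul, add_mul]; omega)
  rw [pow_succ] at h5
  rw [layoutBase]
  omega

theorem mainTheorem4 (t s : ℕ → ℕ → ℕ) (ht : RegularTimeBound t) (hs : RegularSpaceBound s)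
    (a : ℕ) (pred succ : RamProg) (h : IsPredecessorStructure a t s pred succ) :
    ∃ (C b : ℕ) (fpred fsucc : RamProg),
      IsFingerPredecessorStructure b
        (fun D n => C * t (max D 1) n)
        (fun N n => C * (s N (n ⌈/⌉ bitLength N) * bitLength N))
        fpred fsucc := by
  obtain ⟨K, hK⟩ := ht
  obtain ⟨K', hK'⟩ := hs
  -- The terms of `C` pay for the relocated query, the constant overhead, and the space, where
  -- `675283202 = 16 * 42205200 + 2`.
  refine ⟨2 * K + fingerCost pred + 675283202 * K', a + 8388608, fingerPred pred, fingerSucc pred,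
    by omega, fun N w R hw hR => ?_⟩
  rcases R.eq_empty_or_nonempty with rfl | hRne
  -- The empty set has no fingers, hence no queries.
  · exact ⟨0, Set.univ, Nat.zero_le _, Nat.zero_le _, Set.univ_nonempty, fun M _ =>
      ⟨fun i hi => absurd hi (Nat.not_lt_zero i), fun f hf => absurd hf (Finset.notMem_empty f)⟩⟩
  obtain ⟨y, hy, hRy⟩ := exists_strictMono_enumeration R
  have hn : 0 < R.card := Finset.card_pos.2 hRne
  have hnN : R.card ≤ N := by simpa using Finset.card_le_card hR
  have hN : 0 < N := by omega
  have hNl := lt_two_pow_bitLength N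
  have hl : 0 < bitLength N := Nat.succ_pos _
  have hlev : ∀ j < bitLength N, 2 ^ j ≤ N := fun j hj => two_pow_le_of_lt_bitLength hN hj
  have hbase := @layoutBase_lt_two_pow a (R.card ⌈/⌉ bitLength N) N
  set l := bitLength N with hldef
  set n := R.card with hndef
  set m := n ⌈/⌉ l with hm
  have hgroup : ∀ i, i < m ↔ i * l < n := fun i => by
    rw [← not_le, ← not_le, hm, ceilDiv_le_iff_le_mul hl, mul_comm]
  have hmn : m ≤ n := by
    rw [hm, ceilDiv_le_iff_le_mul hl]
    exact Nat.le_mul_of_pos_left _ hl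
  have hm0 : 0 < m := (hgroup 0).2 (by omega)
  have hyN : ∀ i < n, y i < N := fun i hi => by
    refine Finset.mem_range.1 (hR ?_)
    rw [hRy]
    exact Finset.mem_image_of_mem _ (Finset.mem_range.2 hi)
  set R' := (Finset.range m).image fun i => y (i * l) with hR'
  have hcard : R'.card = m := by
    rw [hR', Finset.card_image_of_injOn, Finset.card_range]
    intro i hi j hj hij
    simp only [Finset.coe_range, Set.mem_Iio] at hi hj
    rcases lt_trichotomy i j with hlt | heq | hlt
    · exact absurd hij (hy _ _ (Nat.mul_lt_mul_of_pos_right hlt hl) ((hgroup j).1 hj)).ne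
    · exact heq
    · exact absurd hij (hy _ _ (Nat.mul_lt_mul_of_pos_right hlt hl) ((hgroup i).1 hi)).ne'
  rw [add_mul] at hw
  obtain ⟨S, I, hne, hSa, hSsum, hIlt, hI⟩ := exists_blockStructures h hK' (R := R') (w := w) hN
    (by rw [← hldef]; omega)
  rw [← hldef] at hSa hSsum hI
  rw [hcard] at hSsum
  replace hbase := @hbase S (hmn.trans hnN) hSa
  set S₀ := staticSize m l with hS₀
  have hS₀pos : 0 < S₀ := Nat.mul_pos (by norm_num) (Nat.mul_pos (by norm_num) (Nat.mul_pos hm0 hl))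
  have hbw : 2 ^ ((a + 8388608) * l) ≤ 2 ^ w :=
    Nat.pow_le_pow_right two_pos (by rw [add_mul]; exact hw)
  have hbase' := hbase.trans_le hbw
  obtain ⟨k, p, a', A, m₂, o, c, hc, hmem⟩ := exists_fingerMem (w := w)
    (ptr := blockPtr N l S₀ S R') (cc := fun j β =>
      m - ((Finset.range m).filter fun i => blockStart N j β ≤ y (i * l)).card) hl hNl hlev
    (by omega) hn hy hyN hgroup (fun j β => (blockPtr_le _ _ _ _ _).trans_lt hbase')
    fun _ _ => rfl
  have hC : ∀ M ∈ layoutSet S₀ c (l * N) S I, FingerMem w (layoutBase S₀ S (l * N)) k N n l m p a' y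
      A m₂ o (blockPtr N l S₀ S R') (fun j β =>
        m - ((Finset.range m).filter fun i => blockStart N j β ≤ y (i * l)).card) M := fun M hM =>
    hmem _ M (Nat.le_add_right _ _) hbase'.le hM.1
  have hB := blockSpec_layoutSet (c := c) hS₀pos hbase'.le hI
  refine ⟨layoutBase S₀ S (l * N), layoutSet S₀ c (l * N) S I, ?_, hbase.le,
    layoutSet_nonempty hne, fun M hM => ⟨fun x hx => layoutSet_lt hc hIlt hM hx,
      fun f hf q hq => ?_⟩⟩
  · have h1 : m ≤ K' * s N m := h.le_mul_space hK' (hmn.trans hnN)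
    calc layoutBase S₀ S (l * N) ≤ S₀ + l * (2 * K' * s N m) := Nat.add_le_add_left hSsum _
      _ ≤ 16 * (42205200 * (K' * s N m * l)) + l * (2 * K' * s N m) := by
          rw [hS₀, staticSize]; gcongr
      _ = 675283202 * K' * (s N m * l) := by ring
      _ ≤ (2 * K + fingerCost pred + 675283202 * K') * (s N m * l) :=
          Nat.mul_le_mul_right _ (Nat.le_add_left _ _)
  · obtain ⟨g, hg, rfl⟩ := Finset.mem_image.1 (hRy ▸ hf)
    rw [Finset.mem_range] at hg
    set D := Nat.dist (y g) q with hD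
    -- The block size is within a factor two of `D`, and a block contains at most `m ≤ n` group
    -- minima, so regularity of the time bound applies.
    have hτ : ∀ j, 2 ^ j ≤ D → D < 2 ^ (j + 1) → levelTime t N R' j ≤ K * t (max D 1) n := by
      intro j hj hj'
      refine Finset.sup_le fun β _ => hK _ _ _ _ (by omega) (by rw [pow_succ] at hj'; omega) ?_
      exact ((card_blockSet_le _ _ _ _).trans hcard.le).trans hmn
    -- The overhead is absorbed because `t` is positive. As `n` may exceed `D`, positivity is first
    -- obtained for one element and then carried to `n` by regularity.
    have ht1 : 1 ≤ t (max D 1) n := by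
      have h1 := h.one_le_time (N := max D 1) (n := 1) (by omega) (by omega)
      have h2 := hK (max D 1) (max D 1) n 1 le_rfl (by omega) hn
      by_contra hcon
      rw [show t (max D 1) n = 0 by omega, mul_zero] at h2
      omega
    have hT : 2 * (K * t (max D 1) n) + fingerCost pred ≤
        (2 * K + fingerCost pred + 675283202 * K') * t (max D 1) n := by
      have := Nat.le_mul_of_pos_right (fingerCost pred) ht1
      rw [add_mul, add_mul, mul_assoc]
      omega
    have h0 : regInput₂ (y g) q 0 = y g := by simp [regInput₂]
    have h1 : regInput₂ (y g) q 1 = q := by simp [regInput₂]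
    constructor
    · refine RunsWithin.answersWithin (fun r r' h0 h1 hr => ?_)
        (hRy ▸ run_fingerPred hC hB hM hg hq hτ h0 h1) hT
      rwa [IsPredAnswer, ← h0, ← h1]
    · refine RunsWithin.answersWithin (fun r r' h0 h1 hr => ?_)
        (hRy ▸ run_fingerSucc hC hB hM hg hq hτ h0 h1) hT
      rwa [IsSuccAnswer, ← h0, ← h1]
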